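/- Let $\mathbb S=\mathbb R/2\pi\mathbb Z$, let $L^2(\mathbb S)$ carry the scalar product $\langle u,v\rangle=\int_0^{2\pi}u(\theta)\overline{v(\theta)}\,d\theta$, and let $\Lambda:C^\infty(\mathbb S)\to C^\infty(\mathbb S)$ be the operator with $\Lambda e^{in\theta}=|n|e^{in\theta}$ for $n\in\mathbb Z$ (the Dirichlet-to-Neumann operator of the unit disk). For a positive function $a\in C^\infty(\mathbb S)$ satisfying the normalization $\frac1{2\pi}\int_0^{2\pi}\frac{d\theta}{a(\theta)}=1$, put $\Lambda_a=a^{1/2}\Lambda a^{1/2}$, $$\phi_n(\theta)=\frac{1}{\sqrt{2\pi a(\theta)}}\,e^{in\int_0^\theta a(t)^{-1}dt}\qquad(n\in\mathbb Z),$$ and let $P_0$ be the orthogonal projection of $L^2(\mathbb S)$ onto the line spanned by $\phi_0$, which is the kernel of $\Lambda_a$. Real powers are defined spectrally: if $(\psi_k)_{k\in\mathbb N}$ is an orthonormal basis of $L^2(\mathbb S)$ of smooth eigenvectors of $\Lambda_a+P_0$ with eigenvalues $\lambda_k>0$, then $(\Lambda_a+P_0)^su=\sum_k\lambda_k^s\langle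 u,\psi_k\rangle\psi_k$ for $u\in C^\infty(\mathbb S)$. **Corollary.** Let $\mathcal U$ be an open neighborhood of the constant function $1$ in $C^\infty(\mathbb S)$ and let $m$ be a positive integer. There exist a positive function $a\in\mathcal U$ satisfying the above normalization, for which the powers $(\Lambda_a+P_0)^s$, $s\in\mathbb R$, are well defined (an eigenbasis as above exists, and the series converges in $L^2(\mathbb S)$ to a limit that does not depend on the eigenbasis), a positive integer $\tilde m$ and a number $s_m\in(0,1)$ such that for all $s\in(0,s_m)$ $$\langle(\Lambda_a+P_0)^s\phi_m,\phi_m\rangle<m^s\qquad\text{and}\qquad\langle(\Lambda_a+P_0)^{-s}\phi_{\tilde m},\phi_{\tilde m}\rangle<\tilde m^{-s}.$$ That is, the estimate $\langle(\Lambda_a+P_0)^s\phi_n,\phi_n\rangle\ge|n|^s$ fails for $n=m$ and every $s\in(0,s_m)$, and for $n=\tilde m$ and every $s\in(-s_m,0)$. -/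

import Mathlib

open Real Set MeasureTheory
open scoped ContDiff InnerProductSpace

noncomputable section

namespace Steklov

/-- The circle `𝕊` is `ℝ / 2πℤ`; this provides its measure `dθ` of total mass `2π`. -/
instance factTwoPiPos : Fact (0 < 2 * π) := ⟨Real.two_pi_pos⟩

/-- The smooth `𝕜`-valued functions on `𝕊 = ℝ / 2πℤ` (`𝕜 = ℝ` or `ℂ`), as an algebra. -/
def smoothAlg (𝕜 : Type) [RCLike 𝕜] : Subalgebra 𝕜 (AddCircle (2 * π) → 𝕜) where
  carrier := {f | ContDiff ℝ ∞ fun θ : ℝ => f (θ : AddCircle (2 * π))}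
  mul_mem' {f g} (hf : ContDiff ℝ ∞ fun θ : ℝ => f θ) (hg : ContDiff ℝ ∞ fun θ : ℝ => g θ) :=
    show ContDiff ℝ ∞ fun θ : ℝ => f θ * g θ from hf.mul hg
  add_mem' {f g} (hf : ContDiff ℝ ∞ fun θ : ℝ => f θ) (hg : ContDiff ℝ ∞ fun θ : ℝ => g θ) :=
    show ContDiff ℝ ∞ fun θ : ℝ => f θ + g θ from hf.add hg
  algebraMap_mem' c :=
    show ContDiff ℝ ∞ fun _ : ℝ => algebraMap 𝕜 𝕜 c from contDiff_const

/-- `C^∞(𝕊; 𝕜)`. -/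
def CInf (𝕜 : Type) [RCLike 𝕜] : Type := smoothAlg 𝕜

instance (𝕜 : Type) [RCLike 𝕜] : CommRing (CInf 𝕜) := inferInstanceAs (CommRing (smoothAlg 𝕜))

instance (𝕜 : Type) [RCLike 𝕜] : Algebra 𝕜 (CInf 𝕜) :=
  inferInstanceAs (Algebra 𝕜 (smoothAlg 𝕜))

instance (𝕜 : Type) [RCLike 𝕜] : CoeFun (CInf 𝕜) fun _ => AddCircle (2 * π) → 𝕜 :=
  ⟨fun f => f.1⟩

theorem CInf.contDiff {𝕜 : Type} [RCLike 𝕜] (f : CInf 𝕜) :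
    ContDiff ℝ ∞ fun θ : ℝ => f (θ : AddCircle (2 * π)) := f.2

theorem CInf.continuous {𝕜 : Type} [RCLike 𝕜] (f : CInf 𝕜) :
    Continuous (f : AddCircle (2 * π) → 𝕜) :=
  (QuotientAddGroup.isQuotientMap_mk (N := AddSubgroup.zmultiples (2 * π))).continuous_iff.2
    f.contDiff.continuous

/-- The `C^∞` topology: uniform convergence of the derivatives of every order. -/
instance smoothTopology (𝕜 : Type) [RCLike 𝕜] : TopologicalSpace (CInf 𝕜) :=
  ⨅ k : ℕ, TopologicalSpace.induced
    (fun f : CInf 𝕜 =>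
      UniformFun.ofFun (iteratedDeriv k fun θ : ℝ => f (θ : AddCircle (2 * π))))
    (inferInstanceAs (TopologicalSpace (UniformFun ℝ 𝕜)))

/-- The smooth function on the circle given by a smooth `2π`-periodic function on `ℝ`. -/
def CInf.ofPeriodic {𝕜 : Type} [RCLike 𝕜] (f : ℝ → 𝕜) (hper : Function.Periodic f (2 * π))
    (hf : ContDiff ℝ ∞ f) : CInf 𝕜 :=
  ⟨hper.lift, hf⟩

/-- `L²(𝕊)` with respect to `dθ`. Mathlib's inner product `⟪u, v⟫_ℂ = ∫ conj u · v dθ` is linear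
in the second variable: the product `⟨u, v⟩ = ∫ u · conj v dθ` is `⟪v, u⟫_ℂ`. -/
abbrev L2Circle : Type := Lp ℂ 2 (volume : Measure (AddCircle (2 * π)))

/-- The inclusion of `C^∞(𝕊; ℂ)` in `L²(𝕊)`. -/
def toL2 : CInf ℂ →ₗ[ℂ] L2Circle where
  toFun f := ContinuousMap.toLp 2 volume ℂ ⟨f, f.continuous⟩
  map_add' _ _ := by rw [← map_add]; rfl
  map_smul' _ _ := by rw [RingHom.id_apply, ← map_smul]; rfl

/-! ### The operator `Λ e^{inθ} = |n| e^{inθ}` -/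

/-- The derivative `d/dθ` on `C^∞(𝕊; ℂ)`. -/
def dθ (f : CInf ℂ) : CInf ℂ :=
  CInf.ofPeriodic (deriv fun θ : ℝ => f (θ : AddCircle (2 * π)))
    (fun x => by
      rw [← deriv_comp_add_const]
      congr 1
      funext θ
      rw [AddCircle.coe_add_period])
    (contDiff_infty_iff_deriv.1 f.contDiff).2

theorem fourierCoeff_dθ (f : CInf ℂ) (n : ℤ) :
    fourierCoeff (dθ f) n = Complex.I * n * fourierCoeff f n := by
  have hd : ∀ x : ℝ, HasDerivAt (fun θ : ℝ => f (θ : AddCircle (2 * π)))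
      (dθ f (x : AddCircle (2 * π))) x := fun x =>
    ((f.contDiff.differentiable (by simp)) x).hasDerivAt
  have hc : Continuous fun θ : ℝ => dθ f (θ : AddCircle (2 * π)) := (dθ f).contDiff.continuous
  have he : ∀ x : ℝ, HasDerivAt (fun y : ℝ => fourier (-n) (y : AddCircle (2 * π)))
      (-2 * π * Complex.I * n / (2 * π : ℝ) * fourier (-n) (x : AddCircle (2 * π))) x := fun x =>
    hasDerivAt_fourier_neg (2 * π) n x
  have hec : Continuous fun y : ℝ => (fourier (-n) (y : AddCircle (2 * π)) : ℂ) :=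
    (fourier (-n)).continuous.comp (AddCircle.continuous_mk' (2 * π))
  have hparts := intervalIntegral.integral_mul_deriv_eq_deriv_mul (a := 0) (b := 0 + 2 * π)
    (fun x _ => he x) (fun x _ => hd x)
    ((continuous_const.mul hec).intervalIntegrable _ _) (hc.intervalIntegrable _ _)
  rw [fourierCoeff_eq_intervalIntegral _ n 0, fourierCoeff_eq_intervalIntegral _ n 0]
  simp only [smul_eq_mul]
  rw [hparts]
  simp only [AddCircle.coe_add_period, sub_self, zero_sub, mul_assoc,
    intervalIntegral.integral_const_mul]
  have : (π : ℂ) ≠ 0 := by exact_mod_cast Real.pi_ne_zero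
  simp only [Complex.real_smul]
  push_cast
  field_simp

theorem norm_fourierCoeff_iterate_dθ (f : CInf ℂ) (k : ℕ) (n : ℤ) :
    ‖fourierCoeff (dθ^[k] f) n‖ = |(n : ℝ)| ^ k * ‖fourierCoeff f n‖ := by
  induction k generalizing f with
  | zero => simp
  | succ k ih =>
    rw [Function.iterate_succ_apply, ih, fourierCoeff_dθ]
    simp [pow_succ, mul_assoc]

theorem norm_fourierCoeff_le (f : CInf ℂ) : ∃ C : ℝ, ∀ n : ℤ, ‖fourierCoeff f n‖ ≤ C := by
  refine ⟨‖(⟨f, f.continuous⟩ : C(AddCircle (2 * π), ℂ))‖, fun n => ?_⟩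
  refine (norm_integral_le_of_norm_le_const (C := ‖(⟨f, f.continuous⟩ : C(AddCircle (2 * π), ℂ))‖)
    (Filter.Eventually.of_forall fun x => ?_)).trans ?_
  · rw [norm_smul, fourier_apply, Circle.norm_coe, one_mul]
    exact ContinuousMap.norm_coe_le_norm (⟨f, f.continuous⟩ : C(AddCircle (2 * π), ℂ)) x
  · simp

/-- The Fourier coefficients of a smooth function decrease rapidly. -/
theorem summable_pow_mul_fourierCoeff (f : CInf ℂ) (k : ℕ) :
    Summable fun n : ℤ => |(n : ℝ)| ^ k * ‖fourierCoeff f n‖ := by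
  obtain ⟨C, hC⟩ := norm_fourierCoeff_le (dθ^[k + 2] f)
  have hs : Summable fun n : ℤ => C * (1 / (n : ℝ) ^ 2) :=
    (Real.summable_one_div_int_pow.2 one_lt_two).mul_left C
  refine Summable.of_norm_bounded_eventually hs ?_
  filter_upwards [(Set.finite_singleton (0 : ℤ)).compl_mem_cofinite] with n hn
  have hn0 : (n : ℝ) ≠ 0 := by exact_mod_cast hn
  have h := hC n
  rw [norm_fourierCoeff_iterate_dθ, pow_add, sq_abs] at h
  rw [norm_mul, norm_norm, norm_pow, Real.norm_eq_abs, abs_abs, mul_one_div,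
    le_div_iff₀ (by positivity)]
  linarith

theorem contDiff_fourier_term (c : ℂ) (n : ℤ) :
    ContDiff ℝ ∞ fun θ : ℝ => c * fourier n (θ : AddCircle (2 * π)) := by
  simp only [fourier_coe_apply]
  exact contDiff_const.mul
    ((contDiff_const.mul Complex.ofRealCLM.contDiff).div_const _).cexp

theorem norm_iteratedFDeriv_fourier_term (c : ℂ) (n : ℤ) (k : ℕ) (θ : ℝ) :
    ‖iteratedFDeriv ℝ k (fun θ : ℝ => c * fourier n (θ : AddCircle (2 * π))) θ‖ =
      |(n : ℝ)| ^ k * ‖c‖ := by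
  have h : ∀ (k : ℕ) (c : ℂ),
      iteratedDeriv k (fun θ : ℝ => c * fourier n (θ : AddCircle (2 * π))) =
        fun θ : ℝ => (Complex.I * n) ^ k * c * fourier n (θ : AddCircle (2 * π)) := by
    intro k
    induction k with
    | zero => intro c; simp
    | succ k ih =>
      intro c
      rw [iteratedDeriv_succ', show deriv (fun θ : ℝ => c * fourier n (θ : AddCircle (2 * π))) =
        fun θ : ℝ => (Complex.I * n * c) * fourier n (θ : AddCircle (2 * π)) from ?_, ih]
      · funext θ
        ring
      · funext θ
        rw [((hasDerivAt_fourier (2 * π) n θ).const_mul c).deriv]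
        have : (π : ℂ) ≠ 0 := by exact_mod_cast Real.pi_ne_zero
        push_cast
        field_simp
  rw [norm_iteratedFDeriv_eq_norm_iteratedDeriv, h, norm_mul, norm_mul, fourier_apply,
    Circle.norm_coe, norm_pow, norm_mul, Complex.norm_I]
  simp

theorem summable_Λ (f : CInf ℂ) (θ : AddCircle (2 * π)) :
    Summable fun n : ℤ => ((|n| : ℤ) : ℂ) * fourierCoeff f n * fourier n θ := by
  refine Summable.of_norm ((summable_pow_mul_fourierCoeff f 1).congr fun n => ?_)
  rw [norm_mul, norm_mul, fourier_apply, Circle.norm_coe]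
  simp

/-- The Dirichlet-to-Neumann operator of the unit disk,
`Λ (∑ₙ cₙ e^{inθ}) = ∑ₙ |n| cₙ e^{inθ}` on `C^∞(𝕊; ℂ)`. -/
def Λ : CInf ℂ →ₗ[ℂ] CInf ℂ where
  toFun f := ⟨fun θ => ∑' n : ℤ, ((|n| : ℤ) : ℂ) * fourierCoeff f n * fourier n θ, by
    refine contDiff_tsum (N := (⊤ : ℕ∞))
      (v := fun k (n : ℤ) => |(n : ℝ)| ^ (k + 1) * ‖fourierCoeff f n‖)
      (fun n => contDiff_fourier_term _ n) (fun k _ => summable_pow_mul_fourierCoeff f (k + 1))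
      fun k n θ _ => le_of_eq ?_
    rw [norm_iteratedFDeriv_fourier_term, norm_mul]
    simp [pow_succ, mul_assoc]⟩
  map_add' f g := by
    refine Subtype.ext (funext fun θ => ?_)
    refine Eq.trans (tsum_congr fun n => ?_) ((summable_Λ f θ).tsum_add (summable_Λ g θ))
    rw [← add_mul, ← mul_add]
    congr 2
    have hi : ∀ h : CInf ℂ, Integrable (h : AddCircle (2 * π) → ℂ) AddCircle.haarAddCircle :=
      fun h => h.continuous.integrable_of_hasCompactSupport (HasCompactSupport.of_compactSpace _)
    exact congrFun (fourierCoeff.add (hi f) (hi g)) n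
  map_smul' c f := by
    refine Subtype.ext (funext fun θ => ?_)
    refine Eq.trans (tsum_congr fun n => ?_) (tsum_mul_left (a := c))
    have : fourierCoeff (c • f : CInf ℂ) n = c * fourierCoeff f n := fourierCoeff.const_mul _ c n
    rw [this]
    ring

/-! ### The operators attached to a normalized positive function -/

/-- `a` is positive and `(1 / 2π) ∫₀^{2π} dθ / a(θ) = 1`. -/
structure IsNormalized (a : CInf ℝ) : Prop where
  pos : ∀ θ, 0 < a θ
  integral_eq : (1 / (2 * π)) * ∫ θ : ℝ in 0..2 * π, (a (θ : AddCircle (2 * π)))⁻¹ = 1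

variable {a : CInf ℝ}

/-- The function `a^{1/2}`. -/
def sqrtFun (ha : IsNormalized a) : CInf ℂ :=
  ⟨fun θ => ((√(a θ) : ℝ) : ℂ),
    Complex.ofRealCLM.contDiff.comp (a.contDiff.sqrt fun θ => (ha.pos θ).ne')⟩

/-- `Λ_a = a^{1/2} Λ a^{1/2}`. -/
def Λa (ha : IsNormalized a) : CInf ℂ →ₗ[ℂ] CInf ℂ :=
  LinearMap.mulLeft ℂ (sqrtFun ha) ∘ₗ Λ ∘ₗ LinearMap.mulLeft ℂ (sqrtFun ha)

/-- The function `(2π a(θ))^{-1/2} exp(i n ∫₀^θ a(s)⁻¹ ds)` of the real variable `θ`. -/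
def φFun (a : CInf ℝ) (n : ℤ) (θ : ℝ) : ℂ :=
  ((1 / √(2 * π * a (θ : AddCircle (2 * π))) : ℝ) : ℂ) *
    Complex.exp (Complex.I * n * ((∫ s : ℝ in 0..θ, (a (s : AddCircle (2 * π)))⁻¹ : ℝ) : ℂ))

theorem continuous_inv (ha : IsNormalized a) :
    Continuous fun s : ℝ => (a (s : AddCircle (2 * π)))⁻¹ :=
  a.contDiff.continuous.inv₀ fun θ => (ha.pos θ).ne'

theorem φFun_periodic (ha : IsNormalized a) (n : ℤ) : Function.Periodic (φFun a n) (2 * π) := by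
  intro θ
  have hint : ∫ s : ℝ in θ..θ + 2 * π, (a (s : AddCircle (2 * π)))⁻¹ = 2 * π := by
    have hp : Function.Periodic (fun s : ℝ => (a (s : AddCircle (2 * π)))⁻¹) (2 * π) := fun s => by
      simp only [AddCircle.coe_add_period]
    rw [hp.intervalIntegral_add_eq θ 0, zero_add]
    have h := ha.integral_eq
    rw [one_div, inv_mul_eq_div, div_eq_one_iff_eq Real.two_pi_pos.ne'] at h
    exact h
  unfold φFun
  rw [AddCircle.coe_add_period, ← intervalIntegral.integral_add_adjacent_intervals
    ((continuous_inv ha).intervalIntegrable 0 θ) ((continuous_inv ha).intervalIntegrable θ _), hint]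
  congr 1
  rw [Complex.exp_eq_exp_iff_exists_int]
  refine ⟨n, ?_⟩
  push_cast
  ring

theorem φFun_contDiff (ha : IsNormalized a) (n : ℤ) : ContDiff ℝ ∞ (φFun a n) := by
  have hinv : ContDiff ℝ ∞ fun s : ℝ => (a (s : AddCircle (2 * π)))⁻¹ :=
    a.contDiff.inv fun θ => (ha.pos θ).ne'
  have hprim : ContDiff ℝ ∞ fun θ : ℝ => ∫ s : ℝ in 0..θ, (a (s : AddCircle (2 * π)))⁻¹ := by
    have hd : ∀ θ : ℝ, HasDerivAt (fun θ : ℝ => ∫ s : ℝ in 0..θ, (a (s : AddCircle (2 * π)))⁻¹)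
        ((a (θ : AddCircle (2 * π)))⁻¹) θ := fun θ =>
      ((continuous_inv ha).integral_hasStrictDerivAt 0 θ).hasDerivAt
    rw [contDiff_infty_iff_deriv]
    refine ⟨fun θ => (hd θ).differentiableAt, ?_⟩
    rwa [show deriv (fun θ : ℝ => ∫ s : ℝ in 0..θ, (a (s : AddCircle (2 * π)))⁻¹) = _ from
      funext fun θ => (hd θ).deriv]
  have h1 : ContDiff ℝ ∞ fun θ : ℝ => 1 / √(2 * π * a (θ : AddCircle (2 * π))) := by
    have hpos : ∀ θ : ℝ, 0 < 2 * π * a (θ : AddCircle (2 * π)) := fun θ =>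
      mul_pos Real.two_pi_pos (ha.pos θ)
    exact contDiff_const.div ((contDiff_const.mul a.contDiff).sqrt fun θ => (hpos θ).ne')
      fun θ => (Real.sqrt_pos.2 (hpos θ)).ne'
  exact (Complex.ofRealCLM.contDiff.comp h1).mul
    ((contDiff_const.mul (Complex.ofRealCLM.contDiff.comp hprim)).cexp)

/-- `φ_n(θ) = (2π a(θ))^{-1/2} exp(i n ∫₀^θ a(s)⁻¹ ds)`. -/
def φ (ha : IsNormalized a) (n : ℤ) : CInf ℂ :=
  CInf.ofPeriodic (φFun a n) (φFun_periodic ha n) (φFun_contDiff ha n)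

/-- `P₀ u = ⟨u, φ₀⟩ φ₀`: the orthogonal projection onto the line spanned by the unit vector `φ₀`,
which is the kernel of `Λ_a`. -/
def P₀ (ha : IsNormalized a) : CInf ℂ →ₗ[ℂ] CInf ℂ :=
  (((innerSL ℂ (toL2 (φ ha 0))).toLinearMap) ∘ₗ toL2).smulRight (φ ha 0)

/-! ### Real powers through an orthonormal eigenbasis -/

/-- An orthonormal basis of `L²(𝕊)` made of smooth eigenvectors of `A`, with positive
eigenvalues. -/
structure Eigenbasis (A : CInf ℂ →ₗ[ℂ] CInf ℂ) where
  /-- the eigenvectors `ψ_k` -/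
  vec : ℕ → CInf ℂ
  /-- the eigenvalues `λ_k` -/
  eig : ℕ → ℝ
  eig_pos : ∀ k, 0 < eig k
  apply_vec : ∀ k, A (vec k) = (eig k : ℂ) • vec k
  orthonormal : Orthonormal ℂ fun k => toL2 (vec k)
  complete : (Submodule.span ℂ (Set.range fun k => toL2 (vec k))).topologicalClosure = ⊤

/-- The `k`-th term `λ_k^s ⟨u, ψ_k⟩ ψ_k` of the expansion of `A^s u`. -/
def Eigenbasis.powTerm {A : CInf ℂ →ₗ[ℂ] CInf ℂ} (E : Eigenbasis A) (s : ℝ) (u : CInf ℂ)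
    (k : ℕ) : L2Circle :=
  (((E.eig k ^ s : ℝ) : ℂ) * ⟪toL2 (E.vec k), toL2 u⟫_ℂ) • toL2 (E.vec k)

open Classical in
/-- The power `A^s`, `A^s u = ∑_k λ_k^s ⟨u, ψ_k⟩ ψ_k`, computed in some eigenbasis of `A`. It is a
meaningful object when `PowersWellDefined A` holds. -/
def realPower (A : CInf ℂ →ₗ[ℂ] CInf ℂ) (s : ℝ) (u : CInf ℂ) : L2Circle :=
  if h : Nonempty (Eigenbasis A) then ∑' k, h.some.powTerm s u k else 0

/-- The real powers of `A` exist: `A` has an orthonormal eigenbasis with positive eigenvalues and,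
in every such basis, the expansion of `A^s u` converges in `L²(𝕊)` to the same vector. -/
def PowersWellDefined (A : CInf ℂ →ₗ[ℂ] CInf ℂ) : Prop :=
  Nonempty (Eigenbasis A) ∧
    ∀ (E : Eigenbasis A) (s : ℝ) (u : CInf ℂ), HasSum (E.powTerm s u) (realPower A s u)

/-- The number `⟨(Λ_a + P₀)^s φ_n, φ_n⟩`. -/
def powerForm (ha : IsNormalized a) (s : ℝ) (n : ℤ) : ℂ :=
  ⟪toL2 (φ ha n), realPower (Λa ha + P₀ ha) s (φ ha n)⟫_ℂ

end Steklov

end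

noncomputable section

namespace Steklov

open scoped ComplexConjugate

variable {a : CInf ℝ}

/-! Put A = Λ_a + P₀ and g = e^{inΦ} with Φ' = 1/a, and let c_l be the Fourier coefficients of g. In
an eigenbasis (ψ_k, λ_k) of A the numbers |⟨φ_n, ψ_k⟩|² are the weights of a probability
distribution. With x = λ/n the inequality for small s > 0 reads E[x^s] < 1. Since E[x^s] ≤ 1 + s
E[log x] + O(s²), it suffices that E[log x] < 0. Negative powers are the same problem for x = n/λ.

Since a⁻¹g = n⁻¹(-i g'), moments of this distribution become Fourier sums: E[x] and E[1/x] are both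
1 + T/n, where T = ∑ (|l| - l)|c_l|² (`re_inner_φ_Λa_add_P₀_φ`, `re_inner_φ_invOp_φ`). So (x -
1/x)/2 has mean zero, and the inequality log x ≤ (x - 1/x)/2 - (x-1)³/(6x²) gives E[log x] < 0 as
soon as E[1/x²] < 1 + 4T/n (`exists_forall_hasSum_rpow_lt_one`). This last moment is n²‖A⁻¹φ_n‖² or
n⁻²‖Aφ_n‖². Both are at most 1 + 2T/n plus an error carried by the frequencies l ≤ 0
(`norm_invOp_φ_sq_le`, `norm_Λa_add_P₀_φ_sq_le`), and the error has to stay below 2T/n.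

Take 1/a = 1 + η cos(Nθ) with N = 2m + 1. To first order in η the only nonpositive frequency of g is
n - N; call its weight w. For n = m it is -(m+1), the error is about 4w and 2T/n ≥ 4w(m+1)/m. For n
= m + 1 it is -m, the error is about 4m²w/n² and 2T/n ≥ 4mw/n. Both comparisons are strict because m
< m + 1, and this leaves room for the other nonpositive frequencies, whose weights are O(η⁴) while w
is of order η². Hence m + 1 serves as the second index.

The powers make sense because A has an explicit inverse that is compact on L², and elliptic
regularity makes its eigenvectors smooth (`nonempty_eigenbasis`, `exists_toL2_eq_of_invOpL2_eq`). -/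

/-- The exponential `e^{inθ}` as a smooth function on the circle. -/
def mode (n : ℤ) : CInf ℂ :=
  ⟨fun θ => fourier n θ, show ContDiff ℝ ∞ fun θ : ℝ => fourier n (θ : AddCircle (2 * π)) by
    simpa only [one_mul] using contDiff_fourier_term 1 n⟩

theorem mode_apply (n : ℤ) (θ : AddCircle (2 * π)) : mode n θ = fourier n θ := rfl

theorem CInf.ext {𝕜 : Type} [RCLike 𝕜] {f g : CInf 𝕜} (h : ∀ θ, f θ = g θ) : f = g :=
  Subtype.ext (funext h)

theorem CInf.mul_apply {𝕜 : Type} [RCLike 𝕜] (f g : CInf 𝕜) (θ) : (f * g) θ = f θ * g θ := rfl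
theorem CInf.sub_apply {𝕜 : Type} [RCLike 𝕜] (f g : CInf 𝕜) (θ) : (f - g) θ = f θ - g θ := rfl
theorem CInf.smul_apply {𝕜 : Type} [RCLike 𝕜] (c : 𝕜) (f : CInf 𝕜) (θ) : (c • f) θ = c * f θ := rfl
theorem CInf.one_apply {𝕜 : Type} [RCLike 𝕜] (θ) : (1 : CInf 𝕜) θ = 1 := rfl

theorem mode_zero : mode 0 = 1 := CInf.ext fun θ => by rw [mode_apply, fourier_zero]; rfl

/-! ### Fourier coefficients as inner products, and the basis of exponentials -/

theorem inner_toL2 (f g : CInf ℂ) :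
    ⟪toL2 f, toL2 g⟫_ℂ = ∫ x, g x * conj (f x) := by
  exact ContinuousMap.inner_toLp volume (⟨f, f.continuous⟩ : C(AddCircle (2 * π), ℂ))
    ⟨g, g.continuous⟩

theorem inner_mode (f : CInf ℂ) (n : ℤ) :
    ⟪toL2 (mode n), toL2 f⟫_ℂ = 2 * π * fourierCoeff f n := by
  rw [inner_toL2, AddCircle.volume_eq_smul_haarAddCircle, integral_smul_measure, fourierCoeff]
  rw [ENNReal.toReal_ofReal Real.two_pi_pos.le, Complex.real_smul]
  push_cast
  congr 1
  refine integral_congr_ae (Filter.Eventually.of_forall fun x => ?_)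
  simp only [mode_apply, fourier_neg, smul_eq_mul]
  ring

theorem fourierCoeff_eq_inner (f : CInf ℂ) (n : ℤ) :
    fourierCoeff f n = (2 * π : ℂ)⁻¹ * ⟪toL2 (mode n), toL2 f⟫_ℂ := by
  have : (2 * π : ℂ) ≠ 0 := by exact_mod_cast Real.two_pi_pos.ne'
  rw [inner_mode, inv_mul_cancel_left₀ this]

theorem fourierCoeff_add (f g : CInf ℂ) (n : ℤ) :
    fourierCoeff (f + g : CInf ℂ) n = fourierCoeff f n + fourierCoeff g n := by
  simp only [fourierCoeff_eq_inner, map_add, inner_add_right, mul_add]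

theorem fourierCoeff_sub (f g : CInf ℂ) (n : ℤ) :
    fourierCoeff (f - g : CInf ℂ) n = fourierCoeff f n - fourierCoeff g n := by
  simp only [fourierCoeff_eq_inner, map_sub, inner_sub_right, mul_sub]

theorem fourierCoeff_smul (c : ℂ) (f : CInf ℂ) (n : ℤ) :
    fourierCoeff (c • f : CInf ℂ) n = c * fourierCoeff f n := by
  simp only [fourierCoeff_eq_inner, map_smul, inner_smul_right]
  ring

theorem fourierCoeff_mode (k n : ℤ) : fourierCoeff (mode k) n = if n = k then 1 else 0 := by
  have := fourierCoeff_fourier (T := 2 * π) k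
  have h : fourierCoeff (mode k) n = (Pi.single k 1 : ℤ → ℂ) n := congrFun this n
  rw [h, Pi.single_apply]

theorem sqrt_two_pi_mul_self : ((√(2 * π) : ℝ) : ℂ) * ((√(2 * π) : ℝ) : ℂ) = 2 * π := by
  rw [← Complex.ofReal_mul, Real.mul_self_sqrt Real.two_pi_pos.le]
  push_cast
  rfl

theorem sqrt_two_pi_ne_zero : ((√(2 * π) : ℝ) : ℂ) ≠ 0 :=
  Complex.ofReal_ne_zero.2 (Real.sqrt_pos.2 Real.two_pi_pos).ne'

theorem orthonormal_mode :
    Orthonormal ℂ fun n : ℤ => (((√(2 * π) : ℝ) : ℂ)⁻¹) • toL2 (mode n) := by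
  rw [orthonormal_iff_ite]
  intro i j
  rw [inner_smul_left, inner_smul_right, inner_mode, fourierCoeff_mode, map_inv₀,
    Complex.conj_ofReal]
  split_ifs
  · rw [mul_one, ← sqrt_two_pi_mul_self]
    field_simp [sqrt_two_pi_ne_zero]
  · simp

theorem span_mode_topologicalClosure :
    (Submodule.span ℂ (range fun n : ℤ => toL2 (mode n))).topologicalClosure = ⊤ := by
  have h := (ContinuousMap.toLp_denseRange ℂ (volume : Measure (AddCircle (2 * π))) ℂ
    (p := 2) (by simp)).topologicalClosure_map_submodule
      (span_fourier_closure_eq_top (T := 2 * π))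
  rw [Submodule.map_span, ← range_comp] at h
  exact h

/-- The orthonormal basis `(2π)^{-1/2} e^{inθ}` of `L²(𝕊)`. -/
def modeBasis : HilbertBasis ℤ ℂ L2Circle :=
  HilbertBasis.mk orthonormal_mode <| by
    rw [top_le_iff, ← span_mode_topologicalClosure]
    congr 1
    refine le_antisymm (Submodule.span_le.2 ?_) (Submodule.span_le.2 ?_)
    · rintro _ ⟨n, rfl⟩
      exact Submodule.smul_mem _ _ (Submodule.subset_span ⟨n, rfl⟩)
    · rintro _ ⟨n, rfl⟩
      have h := Submodule.smul_mem (Submodule.span ℂ (range fun n : ℤ =>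
        (((√(2 * π) : ℝ) : ℂ)⁻¹) • toL2 (mode n))) ((√(2 * π) : ℝ) : ℂ)
        (Submodule.subset_span ⟨n, rfl⟩)
      rwa [smul_smul, mul_inv_cancel₀ sqrt_two_pi_ne_zero, one_smul] at h

theorem modeBasis_apply (n : ℤ) :
    modeBasis n = (((√(2 * π) : ℝ) : ℂ)⁻¹) • toL2 (mode n) := by
  rw [modeBasis, HilbertBasis.coe_mk]

theorem inner_modeBasis_toL2 (f : CInf ℂ) (n : ℤ) :
    ⟪modeBasis n, toL2 f⟫_ℂ = ((√(2 * π) : ℝ) : ℂ) * fourierCoeff f n := by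
  rw [modeBasis_apply, inner_smul_left, inner_mode, map_inv₀, Complex.conj_ofReal,
    ← sqrt_two_pi_mul_self]
  field_simp [sqrt_two_pi_ne_zero]

/-- Parseval's identity. -/
theorem hasSum_conj_fourierCoeff_mul (f g : CInf ℂ) :
    HasSum (fun n : ℤ => conj (fourierCoeff f n) * fourierCoeff g n)
      ((2 * π : ℂ)⁻¹ * ⟪toL2 f, toL2 g⟫_ℂ) := by
  refine ((modeBasis.hasSum_inner_mul_inner (toL2 f) (toL2 g)).mul_left (2 * π : ℂ)⁻¹).congr_fun
    fun n => ?_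
  rw [← inner_conj_symm, inner_modeBasis_toL2, inner_modeBasis_toL2, map_mul, Complex.conj_ofReal,
    ← sqrt_two_pi_mul_self]
  field_simp [sqrt_two_pi_ne_zero]

theorem inner_toL2_eq_tsum (f g : CInf ℂ) :
    ⟪toL2 f, toL2 g⟫_ℂ = 2 * π * ∑' n : ℤ, conj (fourierCoeff f n) * fourierCoeff g n := by
  have : (2 * π : ℂ) ≠ 0 := by exact_mod_cast Real.two_pi_pos.ne'
  rw [(hasSum_conj_fourierCoeff_mul f g).tsum_eq, mul_inv_cancel_left₀ this]

theorem ext_inner_modeBasis {u v : L2Circle} (h : ∀ n, ⟪modeBasis n, u⟫_ℂ = ⟪modeBasis n, v⟫_ℂ) :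
    u = v := by
  rw [← (modeBasis.hasSum_repr u).tsum_eq, ← (modeBasis.hasSum_repr v).tsum_eq]
  simp only [HilbertBasis.repr_apply_apply, h]

theorem toL2_injective : Function.Injective toL2 := by
  intro f g h
  have h' : (⟨f, f.continuous⟩ : C(AddCircle (2 * π), ℂ)) = ⟨g, g.continuous⟩ :=
    ContinuousMap.toLp_injective (p := 2) (𝕜 := ℂ) volume h
  exact CInf.ext fun θ => DFunLike.congr_fun h' θ

theorem CInf.ext_fourierCoeff {f g : CInf ℂ} (h : ∀ n, fourierCoeff f n = fourierCoeff g n) :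
    f = g :=
  toL2_injective <| ext_inner_modeBasis fun n => by
    rw [inner_modeBasis_toL2, inner_modeBasis_toL2, h]

theorem dense_range_toL2 : DenseRange toL2 := by
  have h : (LinearMap.range toL2).topologicalClosure = ⊤ := by
    rw [← top_le_iff, ← span_mode_topologicalClosure]
    refine Submodule.topologicalClosure_mono (Submodule.span_le.2 ?_)
    rintro _ ⟨n, rfl⟩
    exact ⟨mode n, rfl⟩
  rw [DenseRange, ← LinearMap.coe_range]
  exact Submodule.dense_iff_topologicalClosure_eq_top.2 h

/-! ### Smooth functions with given Fourier coefficients -/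

/-- The sequence `c` decreases faster than every power. -/
def RapidDecay (c : ℤ → ℂ) : Prop := ∀ k : ℕ, Summable fun n : ℤ => |(n : ℝ)| ^ k * ‖c n‖

theorem rapidDecay_fourierCoeff (f : CInf ℂ) : RapidDecay (fourierCoeff f) :=
  summable_pow_mul_fourierCoeff f

/-- The smooth function `∑ₙ cₙ e^{inθ}`. -/
def ofCoeff (c : ℤ → ℂ) (hc : RapidDecay c) : CInf ℂ :=
  ⟨fun θ => ∑' n : ℤ, c n * fourier n θ, by
    refine contDiff_tsum (N := (⊤ : ℕ∞))
      (v := fun k (n : ℤ) => |(n : ℝ)| ^ k * ‖c n‖)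
      (fun n => contDiff_fourier_term _ n) (fun k _ => hc k)
      fun k n θ _ => le_of_eq ?_
    rw [norm_iteratedFDeriv_fourier_term]⟩

/-- The series converges absolutely in the sup norm, so its uniform sum is the pointwise one
defining `ofCoeff`, and the continuous map from C(𝕊) to L² carries the convergence over. -/
theorem hasSum_toL2_ofCoeff (c : ℤ → ℂ) (hc : RapidDecay c) :
    HasSum (fun n : ℤ => c n • toL2 (mode n)) (toL2 (ofCoeff c hc)) := by
  have hs : Summable fun n : ℤ => c n • (fourier n : C(AddCircle (2 * π), ℂ)) := by
    refine Summable.of_norm ((hc 0).congr fun n => ?_)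
    rw [norm_smul, fourier_norm]
    simp
  have h : (∑' n : ℤ, c n • (fourier n : C(AddCircle (2 * π), ℂ))) =
      ⟨ofCoeff c hc, (ofCoeff c hc).continuous⟩ := by
    ext θ
    exact (ContinuousMap.tsum_apply hs θ).symm
  have h2 := hs.hasSum.mapL (ContinuousMap.toLp (E := ℂ) 2 volume ℂ)
  rw [h] at h2
  refine h2.congr_fun fun n => ?_
  rw [map_smul]
  rfl

theorem fourierCoeff_ofCoeff (c : ℤ → ℂ) (hc : RapidDecay c) (n : ℤ) :
    fourierCoeff (ofCoeff c hc) n = c n := by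
  have h := (hasSum_toL2_ofCoeff c hc).mapL (innerSL ℂ (toL2 (mode n)))
  have h2 : HasSum (fun k : ℤ => innerSL ℂ (toL2 (mode n)) (c k • toL2 (mode k)))
      (2 * π * c n) := by
    convert hasSum_single n ?_ using 1
    · rw [innerSL_apply_apply, inner_smul_right, inner_mode, fourierCoeff_mode, if_pos rfl]
      ring
    · intro k hk
      rw [innerSL_apply_apply, inner_smul_right, inner_mode, fourierCoeff_mode, if_neg hk.symm]
      ring
  have h3 := h.unique h2
  have : (2 * π : ℂ) ≠ 0 := by exact_mod_cast Real.two_pi_pos.ne'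
  rw [fourierCoeff_eq_inner, ← innerSL_apply_apply, h3, inv_mul_cancel_left₀ this]

theorem fourierCoeff_Λ (f : CInf ℂ) (n : ℤ) :
    fourierCoeff (Λ f) n = ((|n| : ℤ) : ℂ) * fourierCoeff f n := by
  have hc : RapidDecay fun n : ℤ => ((|n| : ℤ) : ℂ) * fourierCoeff f n := fun k =>
    (summable_pow_mul_fourierCoeff f (k + 1)).congr fun n => by
      rw [norm_mul]
      simp [pow_succ, mul_assoc]
  exact fourierCoeff_ofCoeff _ hc n

/-- A square-integrable function with rapidly decreasing coefficients is smooth. -/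
theorem exists_toL2_eq_of_rapidDecay {u : L2Circle}
    (hu : RapidDecay fun n => ⟪modeBasis n, u⟫_ℂ) : ∃ f, toL2 f = u := by
  have hc : RapidDecay fun n => ((√(2 * π) : ℝ) : ℂ)⁻¹ * ⟪modeBasis n, u⟫_ℂ := fun k =>
    ((hu k).mul_left ‖((√(2 * π) : ℝ) : ℂ)⁻¹‖).congr fun n => by
      rw [norm_mul]
      ring
  refine ⟨ofCoeff _ hc, ext_inner_modeBasis fun n => ?_⟩
  rw [inner_modeBasis_toL2, fourierCoeff_ofCoeff, mul_inv_cancel_left₀ sqrt_two_pi_ne_zero]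

/-! ### Fourier multipliers and multiplication operators -/

theorem rapidDecay_mul_fourierCoeff {σ : ℤ → ℂ} (hσ : ∀ n, ‖σ n‖ ≤ 1) (f : CInf ℂ) :
    RapidDecay fun n => σ n * fourierCoeff f n := fun k =>
  Summable.of_nonneg_of_le (fun n => by positivity)
    (fun n => mul_le_mul_of_nonneg_left (by
      rw [norm_mul]
      exact mul_le_of_le_one_left (norm_nonneg _) (hσ n)) (by positivity))
    (summable_pow_mul_fourierCoeff f k)

/-- The Fourier multiplier with bounded symbol `σ` on `C^∞(𝕊; ℂ)`. -/
def multiplier (σ : ℤ → ℂ) (hσ : ∀ n, ‖σ n‖ ≤ 1) : CInf ℂ →ₗ[ℂ] CInf ℂ :=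
  { toFun := fun f => ofCoeff _ (rapidDecay_mul_fourierCoeff hσ f)
    map_add' := fun f g => CInf.ext_fourierCoeff fun n => by
      rw [fourierCoeff_add, fourierCoeff_ofCoeff, fourierCoeff_ofCoeff, fourierCoeff_ofCoeff,
        fourierCoeff_add, mul_add]
    map_smul' := fun c f => CInf.ext_fourierCoeff fun n => by
      rw [RingHom.id_apply, fourierCoeff_smul, fourierCoeff_ofCoeff, fourierCoeff_ofCoeff,
        fourierCoeff_smul]
      ring }

theorem fourierCoeff_multiplier (σ : ℤ → ℂ) (hσ : ∀ n, ‖σ n‖ ≤ 1) (f : CInf ℂ) (n : ℤ) :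
    fourierCoeff (multiplier σ hσ f) n = σ n * fourierCoeff f n :=
  fourierCoeff_ofCoeff _ (rapidDecay_mul_fourierCoeff hσ f) n

/-- The convention `0⁻¹ = 0` makes this symbol vanish at n = 0, so the multiplier annihilates
constants. -/
theorem norm_inv_abs_le (n : ℤ) : ‖((|(n : ℝ)|⁻¹ : ℝ) : ℂ)‖ ≤ 1 := by
  rw [Complex.norm_real, norm_inv, Real.norm_eq_abs, abs_abs]
  rcases eq_or_ne n 0 with rfl | hn
  · simp
  · exact inv_le_one_of_one_le₀ (by exact_mod_cast Int.one_le_abs hn)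

theorem norm_sign_le (n : ℤ) : ‖((n.sign : ℤ) : ℂ)‖ ≤ 1 := by
  rcases lt_trichotomy n 0 with h | rfl | h
  · simp [Int.sign_eq_neg_one_of_neg h]
  · simp
  · simp [Int.sign_eq_one_of_pos h]

/-- The pseudo-inverse of `Λ`: `e^{inθ} ↦ |n|⁻¹ e^{inθ}` for `n ≠ 0`, and `1 ↦ 0`. -/
def Λinv : CInf ℂ →ₗ[ℂ] CInf ℂ := multiplier _ norm_inv_abs_le

/-- The Hilbert transform `e^{inθ} ↦ sgn(n) e^{inθ}`. -/
def hilb : CInf ℂ →ₗ[ℂ] CInf ℂ := multiplier _ norm_sign_le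

theorem fourierCoeff_Λinv (f : CInf ℂ) (n : ℤ) :
    fourierCoeff (Λinv f) n = ((|(n : ℝ)|⁻¹ : ℝ) : ℂ) * fourierCoeff f n :=
  fourierCoeff_multiplier _ _ f n

theorem fourierCoeff_hilb (f : CInf ℂ) (n : ℤ) :
    fourierCoeff (hilb f) n = ((n.sign : ℤ) : ℂ) * fourierCoeff f n :=
  fourierCoeff_multiplier _ _ f n

theorem memLp_smooth_mul (b : CInf ℂ) (u : L2Circle) :
    MemLp (fun x => b x * u x) 2 volume :=
  have hb : MemLp (b : AddCircle (2 * π) → ℂ) ⊤ volume :=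
    memLp_top_of_bound b.continuous.aestronglyMeasurable
      ‖(⟨b, b.continuous⟩ : C(AddCircle (2 * π), ℂ))‖
      (Filter.Eventually.of_forall fun x =>
        ContinuousMap.norm_coe_le_norm (⟨b, b.continuous⟩ : C(AddCircle (2 * π), ℂ)) x)
  (Lp.memLp u).mul hb

/-- Multiplication by a smooth function on `L²(𝕊)`. -/
def mulOp (b : CInf ℂ) : L2Circle →L[ℂ] L2Circle :=
  LinearMap.mkContinuous
    { toFun := fun u => (memLp_smooth_mul b u).toLp
      map_add' := fun u v => by
        rw [← MemLp.toLp_add]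
        refine MemLp.toLp_congr _ _ ?_
        filter_upwards [Lp.coeFn_add u v] with x hx
        rw [hx]
        simp only [Pi.add_apply, mul_add]
      map_smul' := fun c u => by
        rw [RingHom.id_apply, ← MemLp.toLp_const_smul]
        refine MemLp.toLp_congr _ _ ?_
        filter_upwards [Lp.coeFn_smul c u] with x hx
        rw [hx]
        simp only [Pi.smul_apply, smul_eq_mul]
        ring }
    ‖(⟨b, b.continuous⟩ : C(AddCircle (2 * π), ℂ))‖
    fun u => by
      refine Lp.norm_le_mul_norm_of_ae_le_mul ?_
      filter_upwards [(memLp_smooth_mul b u).coeFn_toLp] with x hx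
      refine (congrArg norm hx).le.trans ?_
      rw [norm_mul]
      exact mul_le_mul_of_nonneg_right
        (ContinuousMap.norm_coe_le_norm (⟨b, b.continuous⟩ : C(AddCircle (2 * π), ℂ)) x)
        (norm_nonneg _)

theorem coeFn_mulOp (b : CInf ℂ) (u : L2Circle) : mulOp b u =ᵐ[volume] fun x => b x * u x :=
  (memLp_smooth_mul b u).coeFn_toLp

theorem coeFn_toL2 (f : CInf ℂ) : toL2 f =ᵐ[volume] f :=
  ContinuousMap.coeFn_toLp (p := 2) (𝕜 := ℂ) volume (⟨f, f.continuous⟩ : C(AddCircle (2 * π), ℂ))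

theorem mulOp_toL2 (b f : CInf ℂ) : mulOp b (toL2 f) = toL2 (b * f) := by
  refine Lp.ext ?_
  filter_upwards [coeFn_mulOp b (toL2 f), coeFn_toL2 f, coeFn_toL2 (b * f)] with x h1 h2 h3
  rw [h1, h2, h3]
  rfl

/-- The function takes real values. -/
def IsRealValued (b : CInf ℂ) : Prop := ∀ θ, conj (b θ) = b θ

theorem IsRealValued.inner_mul {b : CInf ℂ} (hb : IsRealValued b) (f g : CInf ℂ) :
    ⟪toL2 (b * f), toL2 g⟫_ℂ = ⟪toL2 f, toL2 (b * g)⟫_ℂ := by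
  rw [inner_toL2, inner_toL2]
  congr 1
  funext θ
  rw [CInf.mul_apply, CInf.mul_apply, map_mul, hb]
  ring

theorem IsRealValued.inner_mulOp {b : CInf ℂ} (hb : IsRealValued b) (u v : L2Circle) :
    ⟪mulOp b u, v⟫_ℂ = ⟪u, mulOp b v⟫_ℂ := by
  induction u using dense_range_toL2.induction_on with
  | hp => exact isClosed_eq (by fun_prop) (by fun_prop)
  | ih f =>
    induction v using dense_range_toL2.induction_on with
    | hp => exact isClosed_eq (by fun_prop) (by fun_prop)
    | ih g => rw [mulOp_toL2, mulOp_toL2, hb.inner_mul]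

theorem inner_Λ (f g : CInf ℂ) : ⟪toL2 (Λ f), toL2 g⟫_ℂ = ⟪toL2 f, toL2 (Λ g)⟫_ℂ := by
  rw [inner_toL2_eq_tsum, inner_toL2_eq_tsum]
  congr 2
  funext n
  rw [fourierCoeff_Λ, fourierCoeff_Λ, map_mul, map_intCast]
  ring

/-! ### The compact operator `e^{inθ} ↦ |n|⁻¹ e^{inθ}` on `L²(𝕊)` -/

theorem hasSum_norm_sq_inner_modeBasis (u : L2Circle) :
    HasSum (fun n => ‖⟪modeBasis n, u⟫_ℂ‖ ^ 2) (‖u‖ ^ 2) := by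
  have h := Complex.reCLM.hasSum (modeBasis.hasSum_inner_mul_inner u u)
  rw [Complex.reCLM_apply, ← RCLike.re_eq_complex_re, inner_self_eq_norm_sq] at h
  refine h.congr_fun fun n => ?_
  rw [← inner_conj_symm u, Complex.reCLM_apply, ← Complex.normSq_eq_conj_mul_self,
    Complex.ofReal_re, Complex.normSq_eq_norm_sq]

theorem norm_le_of_inner_modeBasis_le {u v : L2Circle} {C : ℝ} (hC : 0 ≤ C)
    (h : ∀ n, ‖⟪modeBasis n, v⟫_ℂ‖ ≤ C * ‖⟪modeBasis n, u⟫_ℂ‖) : ‖v‖ ≤ C * ‖u‖ := by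
  refine le_of_sq_le_sq ?_ (by positivity)
  rw [mul_pow]
  refine hasSum_le (fun n => ?_) (hasSum_norm_sq_inner_modeBasis v)
    ((hasSum_norm_sq_inner_modeBasis u).mul_left (C ^ 2))
  rw [← mul_pow]
  exact pow_le_pow_left₀ (norm_nonneg _) (h n) 2

/-- The Fourier multiplier with bounded symbol `σ` on `L²(𝕊)`. -/
def diagOp (σ : ℤ → ℂ) (hσ : ∀ n, ‖σ n‖ ≤ 1) : L2Circle →L[ℂ] L2Circle :=
  have hm (u : L2Circle) : Memℓp (fun n => σ n * modeBasis.repr u n) 2 :=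
    (lp.memℓp (modeBasis.repr u)).mono' fun n => by
      rw [norm_mul]
      exact mul_le_of_le_one_left (norm_nonneg _) (hσ n)
  LinearMap.mkContinuous
    { toFun := fun u => modeBasis.repr.symm ⟨_, hm u⟩
      map_add' := fun u v => by
        rw [← map_add]
        congr 1
        ext n
        simp only [map_add, lp.coeFn_add, Pi.add_apply, mul_add]
      map_smul' := fun c u => by
        rw [RingHom.id_apply, ← map_smul]
        congr 1
        ext n
        simp [mul_left_comm] }
    1 fun u => norm_le_of_inner_modeBasis_le zero_le_one fun n => by
      rw [← HilbertBasis.repr_apply_apply, ← HilbertBasis.repr_apply_apply]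
      simp only [LinearMap.coe_mk, AddHom.coe_mk, LinearIsometryEquiv.apply_symm_apply, norm_mul]
      exact mul_le_mul_of_nonneg_right (hσ n) (norm_nonneg _)

theorem inner_modeBasis_diagOp (σ : ℤ → ℂ) (hσ : ∀ n, ‖σ n‖ ≤ 1) (u : L2Circle) (n : ℤ) :
    ⟪modeBasis n, diagOp σ hσ u⟫_ℂ = σ n * ⟪modeBasis n, u⟫_ℂ := by
  rw [← HilbertBasis.repr_apply_apply, ← HilbertBasis.repr_apply_apply, diagOp]
  simp only [LinearMap.mkContinuous_apply, LinearMap.coe_mk, AddHom.coe_mk,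
    LinearIsometryEquiv.apply_symm_apply]

theorem diagOp_toL2 (σ : ℤ → ℂ) (hσ : ∀ n, ‖σ n‖ ≤ 1) (f : CInf ℂ) :
    diagOp σ hσ (toL2 f) = toL2 (multiplier σ hσ f) :=
  ext_inner_modeBasis fun n => by
    rw [inner_modeBasis_diagOp, inner_modeBasis_toL2, inner_modeBasis_toL2, fourierCoeff_multiplier]
    ring

theorem isCompactOperator_rankOne (v w : L2Circle) :
    IsCompactOperator ((innerSL ℂ v).smulRight w) := by
  have h : IsCompactOperator (innerSL ℂ v) :=
    isCompactOperator_of_locallyCompactSpace_dom (innerSL ℂ v)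
  exact h.clm_comp (ContinuousLinearMap.toSpanSingleton ℂ w)

/-- Truncating the symbol to a finite set gives finite-rank operators. They converge in operator
norm because only finitely many |σ n| exceed a given threshold. -/
theorem isCompactOperator_diagOp (σ : ℤ → ℂ) (hσ : ∀ n, ‖σ n‖ ≤ 1)
    (h0 : Filter.Tendsto σ Filter.cofinite (nhds 0)) : IsCompactOperator (diagOp σ hσ) := by
  let F : Finset ℤ → (L2Circle →L[ℂ] L2Circle) := fun S =>
    ∑ n ∈ S, σ n • (innerSL ℂ (modeBasis n)).smulRight (modeBasis n)
  have hF : ∀ S u n, ⟪modeBasis n, F S u⟫_ℂ = if n ∈ S then σ n * ⟪modeBasis n, u⟫_ℂ else 0 := by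
    intro S u n
    simp only [F, sum_apply, inner_sum, _root_.smul_apply,
      ContinuousLinearMap.smulRight_apply, inner_smul_right, innerSL_apply_apply,
      orthonormal_iff_ite.1 modeBasis.orthonormal]
    simp [Finset.sum_ite_eq]
  refine isCompactOperator_of_tendsto (l := Filter.atTop) (F := F) ?_ ?_
  · rw [Metric.tendsto_atTop]
    intro ε hε
    have hfin : {n | ¬ ‖σ n‖ < ε / 2}.Finite := by
      have := h0.norm.eventually (gt_mem_nhds (show ‖(0 : ℂ)‖ < ε / 2 by simpa using hε))
      exact Filter.eventually_cofinite.1 this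
    refine ⟨hfin.toFinset, fun S hS => ?_⟩
    rw [dist_eq_norm]
    refine (ContinuousLinearMap.opNorm_le_bound _ (by positivity : 0 ≤ ε / 2) fun u => ?_).trans_lt
      (half_lt_self hε)
    refine norm_le_of_inner_modeBasis_le (by positivity) fun n => ?_
    rw [_root_.sub_apply, inner_sub_right, hF, inner_modeBasis_diagOp]
    split_ifs with hn
    · rw [sub_self, norm_zero]
      positivity
    · rw [zero_sub, norm_neg, norm_mul]
      refine mul_le_mul_of_nonneg_right ?_ (norm_nonneg _)
      by_contra hlt
      exact hn (hS (hfin.mem_toFinset.2 fun h => hlt h.le))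
  · refine Filter.Eventually.of_forall fun S => ?_
    induction S using Finset.induction_on with
    | empty =>
      simp only [F, Finset.sum_empty]
      exact isCompactOperator_zero
    | insert n S hn ih =>
      simp only [F, Finset.sum_insert hn]
      exact ((isCompactOperator_rankOne (modeBasis n) (modeBasis n)).smul (σ n)).add ih

/-- The operator `Λinv` on `L²(𝕊)`. -/
def ΛinvL2 : L2Circle →L[ℂ] L2Circle := diagOp _ norm_inv_abs_le

theorem isCompactOperator_ΛinvL2 : IsCompactOperator ΛinvL2 := by
  refine isCompactOperator_diagOp _ _ ?_
  rw [tendsto_zero_iff_norm_tendsto_zero]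
  simp only [Complex.norm_real, norm_inv, Real.norm_eq_abs, abs_abs]
  exact tendsto_inv_atTop_zero.comp
    ((tendsto_norm_cocompact_atTop (E := ℝ)).comp Int.tendsto_coe_cofinite)

/-! ### Orthonormal bases of eigenvectors -/

/-- The coefficients of `u` are summable against `(1 + |n|)^k`. -/
def WienerClass (k : ℕ) (u : L2Circle) : Prop :=
  Summable fun n : ℤ => (1 + |(n : ℝ)|) ^ k * ‖⟪modeBasis n, u⟫_ℂ‖

theorem WienerClass.add {k : ℕ} {u v : L2Circle} (hu : WienerClass k u) (hv : WienerClass k v) :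
    WienerClass k (u + v) :=
  Summable.of_nonneg_of_le (fun n => by positivity) (fun n => by
    rw [inner_add_right, ← mul_add]
    exact mul_le_mul_of_nonneg_left (norm_add_le _ _) (by positivity)) (Summable.add hu hv)

theorem WienerClass.smul {k : ℕ} {u : L2Circle} (hu : WienerClass k u) (c : ℂ) :
    WienerClass k (c • u) :=
  (Summable.mul_left ‖c‖ hu).congr fun n => by
    rw [inner_smul_right, norm_mul]
    ring

theorem summable_one_add_abs_pow_mul {c : ℤ → ℂ} (hc : RapidDecay c) (k : ℕ) :
    Summable fun n : ℤ => (1 + |(n : ℝ)|) ^ k * ‖c n‖ := by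
  simp_rw [add_comm (1 : ℝ), add_pow, Finset.sum_mul]
  refine summable_sum fun j _ => ((hc j).mul_left (k.choose j : ℝ)).congr fun n => ?_
  simp
  ring

theorem wienerClass_toL2 (k : ℕ) (f : CInf ℂ) : WienerClass k (toL2 f) := by
  refine ((summable_one_add_abs_pow_mul (rapidDecay_fourierCoeff f) k).mul_left
    ‖((√(2 * π) : ℝ) : ℂ)‖).congr fun n => ?_
  rw [inner_modeBasis_toL2, norm_mul]
  ring

theorem inner_modeBasis_ΛinvL2 (u : L2Circle) (n : ℤ) :
    ⟪modeBasis n, ΛinvL2 u⟫_ℂ = ((|(n : ℝ)|⁻¹ : ℝ) : ℂ) * ⟪modeBasis n, u⟫_ℂ :=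
  inner_modeBasis_diagOp _ _ u n

theorem norm_ofReal_inv_abs (x : ℝ) : ‖((|x|⁻¹ : ℝ) : ℂ)‖ = |x|⁻¹ := by
  rw [Complex.norm_real, Real.norm_eq_abs, abs_inv, abs_abs]

/-- The coefficients are products of the square-summable sequences 1/|n| and ⟨e_n, u⟩, hence
absolutely summable. This starts the regularity bootstrap. -/
theorem wienerClass_zero_ΛinvL2 (u : L2Circle) : WienerClass 0 (ΛinvL2 u) := by
  have h1 : Summable fun n : ℤ => 1 / (n : ℝ) ^ 2 := Real.summable_one_div_int_pow.2 one_lt_two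
  have h2 := (hasSum_norm_sq_inner_modeBasis u).summable
  refine Summable.of_nonneg_of_le (fun n => by positivity) (fun n => ?_) (h1.add h2)
  rw [pow_zero, one_mul, inner_modeBasis_ΛinvL2, norm_mul, norm_ofReal_inv_abs, ← sq_abs, one_div,
    ← inv_pow]
  nlinarith [sq_nonneg (|(n : ℝ)|⁻¹ - ‖⟪modeBasis n, u⟫_ℂ‖), sq_nonneg (|(n : ℝ)|⁻¹),
    sq_nonneg ‖⟪modeBasis n, u⟫_ℂ‖]

/-- One order of smoothness is gained since (1 + |n|)/|n| ≤ 2 for n ≠ 0, and the symbol is zero at n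
= 0. -/
theorem WienerClass.ΛinvL2 {k : ℕ} {u : L2Circle} (hu : WienerClass k u) :
    WienerClass (k + 1) (ΛinvL2 u) := by
  refine Summable.of_nonneg_of_le (fun n => by positivity) (fun n => ?_) (Summable.mul_left 2 hu)
  rw [inner_modeBasis_ΛinvL2, norm_mul, norm_ofReal_inv_abs, pow_succ]
  have h : (1 + |(n : ℝ)|) * |(n : ℝ)|⁻¹ ≤ 2 := by
    rcases eq_or_ne n 0 with rfl | hn
    · simp
    · have h1 : (1 : ℝ) ≤ |(n : ℝ)| := by exact_mod_cast Int.one_le_abs hn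
      rw [← div_eq_mul_inv, div_le_iff₀ (by linarith)]
      linarith
  calc (1 + |(n : ℝ)|) ^ k * (1 + |(n : ℝ)|) * (|(n : ℝ)|⁻¹ * ‖⟪modeBasis n, u⟫_ℂ‖)
      = ((1 + |(n : ℝ)|) * |(n : ℝ)|⁻¹) * ((1 + |(n : ℝ)|) ^ k * ‖⟪modeBasis n, u⟫_ℂ‖) := by ring
    _ ≤ _ := mul_le_mul_of_nonneg_right h (by positivity)

theorem inner_modeBasis_mul (b : CInf ℂ) (n l : ℤ) :
    ⟪modeBasis n, mulOp b (modeBasis l)⟫_ℂ = fourierCoeff b (n - l) := by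
  rw [modeBasis_apply l, map_smul, mulOp_toL2, inner_smul_right, inner_modeBasis_toL2,
    inv_mul_cancel_left₀ sqrt_two_pi_ne_zero]
  unfold fourierCoeff
  congr 1
  funext x
  rw [CInf.mul_apply, mode_apply, neg_sub, sub_eq_add_neg, add_comm, fourier_add]
  simp only [smul_eq_mul]
  rw [mul_comm (b x), mul_assoc]

/-- Multiplication acts on coefficients as convolution. The weight is submultiplicative, 1 + |n| ≤
(1 + |n - l|)(1 + |l|), so the weighted ℓ¹ space is stable under convolution with the rapidly
decreasing coefficients of b. -/
theorem WienerClass.mulOp {k : ℕ} {u : L2Circle} (hu : WienerClass k u) {b : CInf ℂ}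
    (hb : IsRealValued b) : WienerClass k (mulOp b u) := by
  have h1 := Summable.mul_of_nonneg
    (summable_one_add_abs_pow_mul (rapidDecay_fourierCoeff b) k) hu
    (fun n => by positivity) (fun n => by positivity)
  let e : ℤ × ℤ ≃ ℤ × ℤ :=
    { toFun := fun p => (p.1 - p.2, p.2)
      invFun := fun p => (p.1 + p.2, p.2)
      left_inv := fun p => by simp
      right_inv := fun p => by simp }
  have h2 := (e.summable_iff.2 h1).prod
  have h3 := (e.summable_iff.2 h1).prod_factor
  refine Summable.of_nonneg_of_le (fun n => by positivity) (fun n => ?_) h2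
  have hs := modeBasis.hasSum_inner_mul_inner (Steklov.mulOp b (modeBasis n)) u
  rw [hb.inner_mulOp] at hs
  have hn : ∀ l, ‖⟪Steklov.mulOp b (modeBasis n), modeBasis l⟫_ℂ * ⟪modeBasis l, u⟫_ℂ‖ =
      ‖fourierCoeff b (n - l)‖ * ‖⟪modeBasis l, u⟫_ℂ‖ := fun l => by
    rw [hb.inner_mulOp, inner_modeBasis_mul, norm_mul]
  have hle : ∀ l, (1 + |(n : ℝ)|) ^ k * (‖fourierCoeff b (n - l)‖ * ‖⟪modeBasis l, u⟫_ℂ‖) ≤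
      ((1 + |((n - l : ℤ) : ℝ)|) ^ k * ‖fourierCoeff b (n - l)‖) *
        ((1 + |(l : ℝ)|) ^ k * ‖⟪modeBasis l, u⟫_ℂ‖) := fun l => by
    have h : 1 + |(n : ℝ)| ≤ (1 + |((n - l : ℤ) : ℝ)|) * (1 + |(l : ℝ)|) := by
      have := abs_add_le ((n - l : ℤ) : ℝ) (l : ℝ)
      push_cast at this ⊢
      rw [sub_add_cancel] at this
      nlinarith [abs_nonneg ((n : ℝ) - l), abs_nonneg (l : ℝ),
        mul_nonneg (abs_nonneg ((n : ℝ) - l)) (abs_nonneg (l : ℝ))]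
    have h' := pow_le_pow_left₀ (by positivity) h k
    rw [mul_pow] at h'
    calc _ ≤ ((1 + |((n - l : ℤ) : ℝ)|) ^ k * (1 + |(l : ℝ)|) ^ k) *
          (‖fourierCoeff b (n - l)‖ * ‖⟪modeBasis l, u⟫_ℂ‖) :=
          mul_le_mul_of_nonneg_right h' (by positivity)
      _ = _ := by ring
  have hsum : Summable fun l =>
      (1 + |(n : ℝ)|) ^ k * (‖fourierCoeff b (n - l)‖ * ‖⟪modeBasis l, u⟫_ℂ‖) :=
    Summable.of_nonneg_of_le (fun l => by positivity) hle (h3 n)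
  have hsum' : Summable fun l => ‖fourierCoeff b (n - l)‖ * ‖⟪modeBasis l, u⟫_ℂ‖ :=
    (summable_mul_left_iff (by positivity)).1 hsum
  calc (1 + |(n : ℝ)|) ^ k * ‖⟪modeBasis n, Steklov.mulOp b u⟫_ℂ‖
      ≤ (1 + |(n : ℝ)|) ^ k * ∑' l, ‖fourierCoeff b (n - l)‖ * ‖⟪modeBasis l, u⟫_ℂ‖ := by
        refine mul_le_mul_of_nonneg_left ?_ (by positivity)
        rw [← hs.tsum_eq]
        refine (norm_tsum_le_tsum_norm ?_).trans_eq (tsum_congr hn)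
        exact hsum'.congr fun l => (hn l).symm
    _ = ∑' l, (1 + |(n : ℝ)|) ^ k * (‖fourierCoeff b (n - l)‖ * ‖⟪modeBasis l, u⟫_ℂ‖) :=
        tsum_mul_left.symm
    _ ≤ _ := hsum.tsum_le_tsum hle (h3 n)

theorem exists_toL2_eq_of_wienerClass {u : L2Circle} (hu : ∀ k, WienerClass k u) :
    ∃ f, toL2 f = u :=
  exists_toL2_eq_of_rapidDecay fun k =>
    Summable.of_nonneg_of_le (fun n => by positivity) (fun n =>
      mul_le_mul_of_nonneg_right (pow_le_pow_left₀ (abs_nonneg _) (by linarith) k)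
        (norm_nonneg _)) (hu k)

/-- Every basis vector has a nonzero coefficient against some exponential, and each exponential has
only countably many nonzero coefficients in the basis. With `HilbertBasis.infinite_index` this lets
eigenvectors be indexed by ℕ. -/
theorem HilbertBasis.countable_index {ι : Type*} (b : HilbertBasis ι ℂ L2Circle) :
    Countable ι := by
  have h : (univ : Set ι) ⊆
      ⋃ n : ℤ, Function.support fun i => ⟪modeBasis n, b i⟫_ℂ * ⟪b i, modeBasis n⟫_ℂ := by
    intro i _
    by_contra hi
    simp only [mem_iUnion, Function.mem_support, not_exists, not_not] at hi
    have h0 : b i = 0 := ext_inner_modeBasis fun n => by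
      rw [inner_zero_right]
      rcases mul_eq_zero.1 (hi n) with h | h
      · exact h
      · rw [← inner_conj_symm, h, map_zero]
    exact b.orthonormal.ne_zero i h0
  exact countable_univ_iff.1 ((countable_iUnion fun n =>
    (b.summable_inner_mul_inner (modeBasis n) (modeBasis n)).countable_support).mono h)

theorem HilbertBasis.infinite_index {ι : Type*} (b : HilbertBasis ι ℂ L2Circle) :
    Infinite ι := by
  by_contra hfin
  rw [not_infinite_iff_finite] at hfin
  have := Fintype.ofFinite ι
  have : FiniteDimensional ℂ L2Circle := b.toOrthonormalBasis.toBasis.finiteDimensional_of_finite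
  exact not_finite_iff_infinite.2 inferInstance
    (modeBasis.orthonormal.linearIndependent.finite)

/-- An injective compact self-adjoint operator has a Hilbert basis of eigenvectors. -/
theorem exists_hilbertBasis_eigenvectors {H : Type} [NormedAddCommGroup H] [InnerProductSpace ℂ H]
    [CompleteSpace H] {G : H →L[ℂ] H} (hcomp : IsCompactOperator G)
    (hsymm : (G : H →ₗ[ℂ] H).IsSymmetric) (hker : ∀ u, G u = 0 → u = 0) :
    ∃ (ι : Type) (B : HilbertBasis ι ℂ H) (μ : ι → ℂ), ∀ i, G (B i) = μ i • B i := by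
  set T : Module.End ℂ H := (G : H →ₗ[ℂ] H) with hT
  -- Compactness controls only the eigenvalues μ ≠ 0; injectivity disposes of μ = 0.
  have hfd : ∀ μ : ℂ, FiniteDimensional ℂ (Module.End.eigenspace T μ) := by
    intro μ
    rcases eq_or_ne μ 0 with rfl | hμ
    · have : Module.End.eigenspace T 0 = ⊥ := by
        rw [eq_bot_iff]
        intro u hu
        rw [Module.End.mem_eigenspace_iff, zero_smul] at hu
        exact (Submodule.mem_bot ℂ).2 (hker u hu)
      rw [this]
      infer_instance
    · exact ContinuousLinearMap.finite_dimensional_eigenspace hcomp μ hμ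
  let ι := Σ μ : ℂ, Fin (Module.finrank ℂ (Module.End.eigenspace T μ))
  let v : ι → H := fun i => (stdOrthonormalBasis ℂ (Module.End.eigenspace T i.1) i.2 :
    H)
  have hv : Orthonormal ℂ v :=
    hsymm.orthogonalFamily_eigenspaces.orthonormal_sigma_orthonormal
      fun μ => (stdOrthonormalBasis ℂ (Module.End.eigenspace T μ)).orthonormal
  -- The spectral theorem says that the eigenspaces have trivial common orthogonal complement; each
  -- is spanned by its own finite orthonormal basis.
  have hspan : (Submodule.span ℂ (range v))ᗮ = ⊥ := by
    rw [eq_bot_iff, ← ContinuousLinearMap.orthogonalComplement_iSup_eigenspaces_eq_bot hcomp hsymm]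
    refine Submodule.orthogonal_le (iSup_le fun μ u hu => ?_)
    have h := (stdOrthonormalBasis ℂ (Module.End.eigenspace T μ)).sum_repr ⟨u, hu⟩
    have h' := congrArg (Submodule.subtype _) h
    rw [map_sum] at h'
    rw [show u = Submodule.subtype _ (⟨u, hu⟩ : Module.End.eigenspace T μ) from rfl, ← h']
    refine Submodule.sum_mem _ fun i _ => ?_
    rw [map_smul]
    exact Submodule.smul_mem _ _ (Submodule.subset_span ⟨⟨μ, i⟩, rfl⟩)
  let B : HilbertBasis ι ℂ H := HilbertBasis.mkOfOrthogonalEqBot hv hspan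
  have hB : ∀ i, B i = v i := fun i => congrFun (HilbertBasis.coe_mkOfOrthogonalEqBot hv hspan) i
  refine ⟨ι, B, fun i => i.1, fun i => ?_⟩
  rw [hB]
  exact Module.End.mem_eigenspace_iff.1 (stdOrthonormalBasis ℂ (Module.End.eigenspace T i.1) i.2).2

/-- A symmetric positive operator on `C^∞(𝕊; ℂ)` whose inverse extends to a compact operator on
`L²(𝕊)` with smooth eigenvectors has an eigenbasis. -/
theorem nonempty_eigenbasis {A Gs : CInf ℂ →ₗ[ℂ] CInf ℂ} {G : L2Circle →L[ℂ] L2Circle}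
    (hG : ∀ f, G (toL2 f) = toL2 (Gs f)) (hAG : ∀ f, A (Gs f) = f) (hGA : ∀ f, Gs (A f) = f)
    (hcomp : IsCompactOperator G) (hsymm : (G : L2Circle →ₗ[ℂ] L2Circle).IsSymmetric)
    (hreg : ∀ (μ : ℂ) (u : L2Circle), μ ≠ 0 → G u = μ • u → ∃ f, toL2 f = u)
    (hpos : ∀ f, 0 ≤ (⟪toL2 f, toL2 (A f)⟫_ℂ).re) : Nonempty (Eigenbasis A) := by
  -- A vector killed by the symmetric G is orthogonal to the range of G, which contains every smooth
  -- function f as G(Af) and is therefore dense.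
  have hker : ∀ u, G u = 0 → u = 0 := by
    intro u hu
    refine dense_range_toL2.eq_zero_of_inner_right (𝕜 := ℂ) fun f => ?_
    have h : G (toL2 (A f)) = toL2 f := by rw [hG, hGA]
    have h2 := hsymm (toL2 (A f)) u
    simp only [ContinuousLinearMap.coe_coe, h, hu, inner_zero_right] at h2
    exact h2
  obtain ⟨ι, v, μ, hTv⟩ := exists_hilbertBasis_eigenvectors hcomp hsymm hker
  have := HilbertBasis.countable_index v
  have := HilbertBasis.infinite_index v
  obtain ⟨e⟩ := nonempty_equiv_of_countable (α := ℕ) (β := ι)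
  have hne : ∀ i, v i ≠ 0 := fun i => v.orthonormal.ne_zero i
  have hμ : ∀ i : ι, μ i ≠ 0 := fun i h => hne i (hker _ (by rw [hTv, h, zero_smul]))
  choose f hf using fun i : ι => hreg (μ i) (v i) (hμ i) (hTv i)
  have hA : ∀ i : ι, A (f i) = (μ i)⁻¹ • f i := by
    intro i
    have h1 : Gs (f i) = μ i • f i := toL2_injective (by rw [← hG, hf, hTv, map_smul, hf])
    have h2 := hAG (f i)
    rw [h1, map_smul] at h2
    calc A (f i) = (μ i)⁻¹ • μ i • A (f i) := by
          rw [smul_smul, inv_mul_cancel₀ (hμ i), one_smul]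
      _ = _ := by rw [h2]
  have hreal : ∀ i : ι, conj (μ i) = μ i := fun i =>
    hsymm.conj_eigenvalue_eq_self (Module.End.hasEigenvalue_of_hasEigenvector
      (x := v i) ⟨Module.End.mem_eigenspace_iff.2 (hTv i), hne i⟩)
  have hre : ∀ i : ι, (((μ i)⁻¹.re : ℝ) : ℂ) = (μ i)⁻¹ := fun i =>
    Complex.conj_eq_iff_re.1 (by rw [map_inv₀, hreal])
  have hfv : (fun k => toL2 (f (e k))) = fun k => v (e k) := funext fun k => hf (e k)
  refine ⟨{ vec := fun k => f (e k), eig := fun k => (μ (e k))⁻¹.re, eig_pos := fun k => ?_,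
            apply_vec := fun k => by rw [hre, hA], orthonormal := ?_, complete := ?_ }⟩
  · have h := hpos (f (e k))
    rw [hA, map_smul, inner_smul_right, hf, inner_self_eq_norm_sq_to_K, v.orthonormal.1] at h
    -- The eigenvalue of A is the real number μ⁻¹. It is nonnegative by positivity of the form and
    -- nonzero as an inverse.
    refine lt_of_le_of_ne (by simpa using h) fun h0 => inv_ne_zero (hμ (e k)) ?_
    rw [← hre, ← h0, Complex.ofReal_zero]
  · rw [hfv]
    exact v.orthonormal.comp e e.injective
  · rw [hfv, show (range fun k => v (e k)) = range v from e.surjective.range_comp v]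
    exact v.dense_span

/-! ### The operator `Λ_a + P₀` and its inverse -/

/-- The function `a^{-1/2}`. -/
def invSqrtFun (ha : IsNormalized a) : CInf ℂ :=
  ⟨fun θ => (((√(a θ))⁻¹ : ℝ) : ℂ),
    Complex.ofRealCLM.contDiff.comp ((a.contDiff.sqrt fun θ => (ha.pos θ).ne').inv
      fun θ => (Real.sqrt_pos.2 (ha.pos θ)).ne')⟩

theorem isCompactOperator_comp_add {H : Type} [NormedAddCommGroup H] [InnerProductSpace ℂ H]
    {Q B R P : H →L[ℂ] H} (hR : IsCompactOperator R) (hP : IsCompactOperator P) :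
    IsCompactOperator (Q ∘L B ∘L R ∘L B ∘L Q + P : H →L[ℂ] H) :=
  ((hR.comp_clm (B ∘L Q)).clm_comp (Q ∘L B)).add hP

section

variable (ha : IsNormalized a)

theorem sqrtFun_apply (θ) : sqrtFun ha θ = ((√(a θ) : ℝ) : ℂ) := rfl

theorem invSqrtFun_apply (θ) : invSqrtFun ha θ = (((√(a θ))⁻¹ : ℝ) : ℂ) := rfl

theorem isRealValued_sqrtFun : IsRealValued (sqrtFun ha) := fun _ => Complex.conj_ofReal _

theorem isRealValued_invSqrtFun : IsRealValued (invSqrtFun ha) := fun _ => Complex.conj_ofReal _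

theorem sqrtFun_mul_invSqrtFun : sqrtFun ha * invSqrtFun ha = 1 := CInf.ext fun θ => by
  rw [CInf.mul_apply, sqrtFun_apply, invSqrtFun_apply, ← Complex.ofReal_mul,
    mul_inv_cancel₀ (Real.sqrt_pos.2 (ha.pos θ)).ne', Complex.ofReal_one, CInf.one_apply]

theorem sqrtFun_mul_cancel (f : CInf ℂ) : sqrtFun ha * (invSqrtFun ha * f) = f := by
  rw [← mul_assoc, sqrtFun_mul_invSqrtFun, one_mul]

theorem invSqrtFun_mul_cancel (f : CInf ℂ) : invSqrtFun ha * (sqrtFun ha * f) = f := by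
  rw [← mul_assoc, mul_comm (invSqrtFun ha), sqrtFun_mul_invSqrtFun, one_mul]

theorem Λa_apply (f : CInf ℂ) : Λa ha f = sqrtFun ha * Λ (sqrtFun ha * f) := rfl

theorem P₀_apply (f : CInf ℂ) : P₀ ha f = ⟪toL2 (φ ha 0), toL2 f⟫_ℂ • φ ha 0 := rfl

theorem φ_apply (n : ℤ) (θ : ℝ) : φ ha n (θ : AddCircle (2 * π)) = φFun a n θ := rfl

/-- The function `e^{inΦ}`, where `Φ' = 1 / a`. -/
def phase (n : ℤ) : CInf ℂ := ((√(2 * π) : ℝ) : ℂ) • (sqrtFun ha * φ ha n)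

theorem φ_eq (n : ℤ) :
    φ ha n = (((√(2 * π) : ℝ) : ℂ)⁻¹) • (invSqrtFun ha * phase ha n) := by
  rw [phase, mul_smul_comm, smul_smul, inv_mul_cancel₀ sqrt_two_pi_ne_zero, one_smul,
    invSqrtFun_mul_cancel]

theorem phase_apply (n : ℤ) (θ : ℝ) : phase ha n (θ : AddCircle (2 * π)) =
    Complex.exp (Complex.I * n * ((∫ s : ℝ in 0..θ, (a (s : AddCircle (2 * π)))⁻¹ : ℝ) : ℂ)) := by
  rw [phase, CInf.smul_apply, CInf.mul_apply, φ_apply, φFun, sqrtFun_apply, ← mul_assoc, ← mul_assoc]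
  rw [← Complex.ofReal_mul, ← Complex.ofReal_mul, ← Real.sqrt_mul Real.two_pi_pos.le,
    mul_one_div_cancel (Real.sqrt_pos.2 (mul_pos Real.two_pi_pos (ha.pos θ))).ne',
    Complex.ofReal_one, one_mul]

theorem CInf.ext_real {𝕜 : Type} [RCLike 𝕜] {f g : CInf 𝕜}
    (h : ∀ θ : ℝ, f (θ : AddCircle (2 * π)) = g (θ : AddCircle (2 * π))) : f = g :=
  CInf.ext fun θ => QuotientAddGroup.induction_on θ h

theorem dθ_apply (f : CInf ℂ) (θ : ℝ) :
    dθ f (θ : AddCircle (2 * π)) = deriv (fun θ : ℝ => f (θ : AddCircle (2 * π))) θ := rfl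

theorem phase_zero : phase ha 0 = 1 := CInf.ext_real fun θ => by
  rw [phase_apply, Int.cast_zero, mul_zero, zero_mul, Complex.exp_zero, CInf.one_apply]

theorem φ_zero : φ ha 0 = (((√(2 * π) : ℝ) : ℂ)⁻¹) • invSqrtFun ha := by
  rw [φ_eq, phase_zero, mul_one]

/-- This relation, a⁻¹g = n⁻¹(-i g'), removes the weight 1/a from inner products and leaves sums
over the Fourier coefficients of g alone. -/
theorem dθ_phase (n : ℤ) :
    dθ (phase ha n) = (Complex.I * n) • (invSqrtFun ha * (invSqrtFun ha * phase ha n)) :=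
  CInf.ext_real fun θ => by
    have hd : HasDerivAt (fun θ : ℝ => ∫ s : ℝ in 0..θ, (a (s : AddCircle (2 * π)))⁻¹)
        ((a (θ : AddCircle (2 * π)))⁻¹) θ :=
      ((continuous_inv ha).integral_hasStrictDerivAt 0 θ).hasDerivAt
    have h := (hd.ofReal_comp.const_mul (Complex.I * n)).cexp
    rw [dθ_apply, funext (phase_apply ha n), h.deriv, CInf.smul_apply, CInf.mul_apply,
      CInf.mul_apply, phase_apply, invSqrtFun_apply, ← mul_assoc (((√(a θ))⁻¹ : ℝ) : ℂ),
      ← Complex.ofReal_mul, ← mul_inv, Real.mul_self_sqrt (ha.pos θ).le]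
    ring

theorem inner_invSqrtFun_self :
    ⟪toL2 (invSqrtFun ha), toL2 (invSqrtFun ha)⟫_ℂ = 2 * π := by
  rw [inner_toL2]
  have h : (fun x => invSqrtFun ha x * conj (invSqrtFun ha x)) = fun x => (((a x)⁻¹ : ℝ) : ℂ) := by
    funext x
    rw [isRealValued_invSqrtFun, invSqrtFun_apply, ← Complex.ofReal_mul, ← mul_inv,
      Real.mul_self_sqrt (ha.pos x).le]
  rw [h, integral_complex_ofReal, ← AddCircle.intervalIntegral_preimage (2 * π) 0, zero_add]
  have h1 := ha.integral_eq
  rw [one_div, inv_mul_eq_div, div_eq_one_iff_eq Real.two_pi_pos.ne'] at h1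
  rw [h1]
  push_cast
  rfl

theorem inner_φ_zero_self : ⟪toL2 (φ ha 0), toL2 (φ ha 0)⟫_ℂ = 1 := by
  rw [φ_zero, map_smul, inner_smul_left, inner_smul_right, inner_invSqrtFun_self, map_inv₀,
    Complex.conj_ofReal, ← sqrt_two_pi_mul_self]
  field_simp [sqrt_two_pi_ne_zero]

/-- As φ₀ is a multiple of a^{-1/2}, orthogonality to φ₀ means that a^{-1/2}f has mean zero, which
is the solvability condition for Λ. -/
theorem inner_φ_zero (f : CInf ℂ) : ⟪toL2 (φ ha 0), toL2 f⟫_ℂ =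
    ((√(2 * π) : ℝ) : ℂ) * fourierCoeff (invSqrtFun ha * f : CInf ℂ) 0 := by
  rw [φ_zero, map_smul, inner_smul_left, map_inv₀, Complex.conj_ofReal]
  have h := (isRealValued_invSqrtFun ha).inner_mul 1 f
  rw [mul_one] at h
  rw [h, ← mode_zero, inner_mode, ← sqrt_two_pi_mul_self]
  field_simp [sqrt_two_pi_ne_zero]

theorem P₀_P₀ (f : CInf ℂ) : P₀ ha (P₀ ha f) = P₀ ha f := by
  rw [P₀_apply ha f, map_smul, P₀_apply, inner_φ_zero_self, one_smul]

theorem Λ_one : Λ (1 : CInf ℂ) = 0 := CInf.ext_fourierCoeff fun n => by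
  rw [fourierCoeff_Λ, ← mode_zero, fourierCoeff_mode]
  have h0 : fourierCoeff (0 : CInf ℂ) n = 0 := by
    have := fourierCoeff_smul 0 (0 : CInf ℂ) n
    rwa [zero_smul, zero_mul] at this
  rw [h0]
  split_ifs with h
  · simp [h]
  · simp

theorem Λa_φ_zero : Λa ha (φ ha 0) = 0 := by
  rw [φ_zero, map_smul, Λa_apply, sqrtFun_mul_invSqrtFun, Λ_one, mul_zero, smul_zero]

theorem Λa_P₀ (f : CInf ℂ) : Λa ha (P₀ ha f) = 0 := by
  rw [P₀_apply, map_smul, Λa_φ_zero, smul_zero]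

theorem inner_Λa (f g : CInf ℂ) :
    ⟪toL2 (Λa ha f), toL2 g⟫_ℂ = ⟪toL2 f, toL2 (Λa ha g)⟫_ℂ := by
  rw [Λa_apply, Λa_apply, (isRealValued_sqrtFun ha).inner_mul, inner_Λ,
    (isRealValued_sqrtFun ha).inner_mul]

theorem P₀_Λa (f : CInf ℂ) : P₀ ha (Λa ha f) = 0 := by
  rw [P₀_apply, ← inner_Λa, Λa_φ_zero, map_zero, inner_zero_left, zero_smul]

theorem inner_P₀ (f g : CInf ℂ) :
    ⟪toL2 (P₀ ha f), toL2 g⟫_ℂ = ⟪toL2 f, toL2 (P₀ ha g)⟫_ℂ := by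
  rw [P₀_apply, P₀_apply, map_smul, map_smul, inner_smul_left, inner_smul_right, inner_conj_symm]
  ring

theorem inner_Λa_add_P₀ (f g : CInf ℂ) :
    ⟪toL2 ((Λa ha + P₀ ha) f), toL2 g⟫_ℂ = ⟪toL2 f, toL2 ((Λa ha + P₀ ha) g)⟫_ℂ := by
  rw [LinearMap.add_apply, LinearMap.add_apply, map_add, map_add, inner_add_left, inner_add_right,
    inner_Λa, inner_P₀]

theorem re_inner_Λ_self_nonneg (f : CInf ℂ) : 0 ≤ (⟪toL2 f, toL2 (Λ f)⟫_ℂ).re := by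
  have h := Complex.reCLM.hasSum (hasSum_conj_fourierCoeff_mul f (Λ f))
  have h2 : 0 ≤ Complex.reCLM ((2 * π : ℂ)⁻¹ * ⟪toL2 f, toL2 (Λ f)⟫_ℂ) := by
    refine h.nonneg fun n => ?_
    rw [fourierCoeff_Λ, mul_left_comm, ← Complex.normSq_eq_conj_mul_self, ← Complex.ofReal_intCast,
      ← Complex.ofReal_mul, Complex.reCLM_apply, Complex.ofReal_re]
    exact mul_nonneg (by exact_mod_cast abs_nonneg n) (Complex.normSq_nonneg _)
  rw [show (2 * π : ℂ)⁻¹ = (((2 * π)⁻¹ : ℝ) : ℂ) by push_cast; rfl, Complex.reCLM_apply,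
    Complex.re_ofReal_mul] at h2
  exact (mul_nonneg_iff_of_pos_left (inv_pos.2 Real.two_pi_pos)).1 h2

theorem re_inner_Λa_add_P₀_nonneg (f : CInf ℂ) :
    0 ≤ (⟪toL2 f, toL2 ((Λa ha + P₀ ha) f)⟫_ℂ).re := by
  rw [LinearMap.add_apply, map_add, inner_add_right, Complex.add_re, Λa_apply,
    ← (isRealValued_sqrtFun ha).inner_mul, P₀_apply, map_smul, inner_smul_right,
    ← RCLike.re_eq_complex_re, inner_mul_symm_re_eq_norm]
  exact add_nonneg (re_inner_Λ_self_nonneg _) (norm_nonneg _)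

/-- The inverse of `Λ_a + P₀` on `C^∞(𝕊; ℂ)`. -/
def invOp : CInf ℂ →ₗ[ℂ] CInf ℂ :=
  (LinearMap.id - P₀ ha) ∘ₗ LinearMap.mulLeft ℂ (invSqrtFun ha) ∘ₗ Λinv ∘ₗ
    LinearMap.mulLeft ℂ (invSqrtFun ha) ∘ₗ (LinearMap.id - P₀ ha) + P₀ ha

theorem invOp_apply (f : CInf ℂ) : invOp ha f =
    (invSqrtFun ha * Λinv (invSqrtFun ha * (f - P₀ ha f)) -
      P₀ ha (invSqrtFun ha * Λinv (invSqrtFun ha * (f - P₀ ha f)))) + P₀ ha f := rfl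

theorem Λ_Λinv {f : CInf ℂ} (hf : fourierCoeff f 0 = 0) : Λ (Λinv f) = f :=
  CInf.ext_fourierCoeff fun n => by
    rw [fourierCoeff_Λ, fourierCoeff_Λinv, ← mul_assoc]
    rcases eq_or_ne n 0 with rfl | hn
    · rw [hf, mul_zero]
    · have : ((|n| : ℤ) : ℂ) ≠ 0 := by exact_mod_cast abs_ne_zero.2 hn
      rw [show |(n : ℝ)| = ((|n| : ℤ) : ℝ) by push_cast; rfl, Complex.ofReal_inv,
        Complex.ofReal_intCast, mul_inv_cancel₀ this, one_mul]

theorem Λinv_Λ (f : CInf ℂ) : Λinv (Λ f) = f - fourierCoeff f 0 • 1 :=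
  CInf.ext_fourierCoeff fun n => by
    rw [fourierCoeff_Λinv, fourierCoeff_Λ, fourierCoeff_sub, fourierCoeff_smul, ← mode_zero,
      fourierCoeff_mode, ← mul_assoc]
    rcases eq_or_ne n 0 with rfl | hn
    · simp
    · have : ((|n| : ℤ) : ℂ) ≠ 0 := by exact_mod_cast abs_ne_zero.2 hn
      rw [show |(n : ℝ)| = ((|n| : ℤ) : ℝ) by push_cast; rfl, Complex.ofReal_inv,
        Complex.ofReal_intCast, inv_mul_cancel₀ this, one_mul, if_neg hn, mul_zero, sub_zero]

theorem inner_φ_zero_sub_P₀ (f : CInf ℂ) : ⟪toL2 (φ ha 0), toL2 (f - P₀ ha f)⟫_ℂ = 0 := by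
  rw [map_sub, inner_sub_right, P₀_apply, map_smul, inner_smul_right, inner_φ_zero_self, mul_one,
    sub_self]

theorem fourierCoeff_invSqrtFun_mul_eq_zero {f : CInf ℂ} (hf : ⟪toL2 (φ ha 0), toL2 f⟫_ℂ = 0) :
    fourierCoeff (invSqrtFun ha * f : CInf ℂ) 0 = 0 := by
  rw [inner_φ_zero] at hf
  exact (mul_eq_zero.1 hf).resolve_left sqrt_two_pi_ne_zero

/-- The inner projection supplies the mean-zero condition needed for Λ Λinv = 1. The outer one
removes the component along φ₀, which Λ_a does not see but P₀ would. -/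
theorem Λa_add_P₀_invOp (f : CInf ℂ) : (Λa ha + P₀ ha) (invOp ha f) = f := by
  have h : Λa ha (invSqrtFun ha * Λinv (invSqrtFun ha * (f - P₀ ha f))) = f - P₀ ha f := by
    rw [Λa_apply, sqrtFun_mul_cancel, Λ_Λinv (fourierCoeff_invSqrtFun_mul_eq_zero ha
      (inner_φ_zero_sub_P₀ ha f)), sqrtFun_mul_cancel]
  rw [invOp_apply, LinearMap.add_apply, map_add, map_sub, h, Λa_P₀, Λa_P₀, map_add, map_sub, P₀_P₀,
    P₀_P₀]
  abel

/-- Λinv Λ loses only the mean; after multiplication by a^{-1/2} this loss is a multiple of φ₀,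
which the outer projection discards and the summand P₀ handles. -/
theorem invOp_Λa_add_P₀ (f : CInf ℂ) : invOp ha ((Λa ha + P₀ ha) f) = f := by
  have h1 : P₀ ha ((Λa ha + P₀ ha) f) = P₀ ha f := by
    rw [LinearMap.add_apply, map_add, P₀_Λa, P₀_P₀, zero_add]
  have h2 : (Λa ha + P₀ ha) f - P₀ ha ((Λa ha + P₀ ha) f) = Λa ha f := by
    rw [h1, LinearMap.add_apply, add_sub_cancel_right]
  have h3 : P₀ ha (invSqrtFun ha) = invSqrtFun ha := by
    have : invSqrtFun ha = ((√(2 * π) : ℝ) : ℂ) • φ ha 0 := by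
      rw [φ_zero, smul_smul, mul_inv_cancel₀ sqrt_two_pi_ne_zero, one_smul]
    rw [this, map_smul, P₀_apply, inner_φ_zero_self, one_smul]
  rw [invOp_apply, h2, h1, Λa_apply, invSqrtFun_mul_cancel, Λinv_Λ, mul_sub, invSqrtFun_mul_cancel,
    mul_smul_comm, mul_one, map_sub, map_smul, h3]
  abel

/-- The projection `P₀` on `L²(𝕊)`. -/
def P₀L2 : L2Circle →L[ℂ] L2Circle :=
  (innerSL ℂ (toL2 (φ ha 0))).smulRight (toL2 (φ ha 0))

theorem P₀L2_apply (u : L2Circle) :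
    P₀L2 ha u = ⟪toL2 (φ ha 0), u⟫_ℂ • toL2 (φ ha 0) := rfl

/-- The inverse of `Λ_a + P₀` on `L²(𝕊)`. -/
def invOpL2 : L2Circle →L[ℂ] L2Circle :=
  (ContinuousLinearMap.id ℂ _ - P₀L2 ha) ∘L mulOp (invSqrtFun ha) ∘L ΛinvL2 ∘L
    mulOp (invSqrtFun ha) ∘L (ContinuousLinearMap.id ℂ _ - P₀L2 ha) + P₀L2 ha

theorem invOpL2_apply (u : L2Circle) : invOpL2 ha u =
    (mulOp (invSqrtFun ha) (ΛinvL2 (mulOp (invSqrtFun ha) (u - P₀L2 ha u))) -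
      P₀L2 ha (mulOp (invSqrtFun ha) (ΛinvL2 (mulOp (invSqrtFun ha) (u - P₀L2 ha u))))) +
        P₀L2 ha u := rfl

theorem P₀L2_toL2 (f : CInf ℂ) : P₀L2 ha (toL2 f) = toL2 (P₀ ha f) := by
  rw [P₀_apply, map_smul, P₀L2_apply]

theorem ΛinvL2_toL2 (f : CInf ℂ) : ΛinvL2 (toL2 f) = toL2 (Λinv f) := diagOp_toL2 _ _ f

theorem invOpL2_toL2 (f : CInf ℂ) : invOpL2 ha (toL2 f) = toL2 (invOp ha f) := by
  rw [invOpL2_apply, invOp_apply, P₀L2_toL2, ← map_sub, mulOp_toL2, ΛinvL2_toL2, mulOp_toL2,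
    P₀L2_toL2, ← map_sub, ← map_add]

theorem isCompactOperator_invOpL2 : IsCompactOperator (invOpL2 ha) :=
  isCompactOperator_comp_add isCompactOperator_ΛinvL2 (isCompactOperator_rankOne _ _)

theorem inner_invOp (f g : CInf ℂ) :
    ⟪toL2 (invOp ha f), toL2 g⟫_ℂ = ⟪toL2 f, toL2 (invOp ha g)⟫_ℂ := by
  conv_lhs => rw [← Λa_add_P₀_invOp ha g]
  rw [← inner_Λa_add_P₀, Λa_add_P₀_invOp]

theorem isSymmetric_invOpL2 : (invOpL2 ha : L2Circle →ₗ[ℂ] L2Circle).IsSymmetric := by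
  intro u v
  simp only [ContinuousLinearMap.coe_coe]
  induction u using dense_range_toL2.induction_on with
  | hp => exact isClosed_eq (by fun_prop) (by fun_prop)
  | ih f =>
    induction v using dense_range_toL2.induction_on with
    | hp => exact isClosed_eq (by fun_prop) (by fun_prop)
    | ih g => rw [invOpL2_toL2, invOpL2_toL2, inner_invOp]

/-- Bootstrap on u = μ⁻¹Gu: terms with P₀ are smooth, multiplication by a^{-1/2} preserves each
Wiener class, and Λinv raises the class by one. -/
theorem exists_toL2_eq_of_invOpL2_eq {μ : ℂ} {u : L2Circle} (hμ : μ ≠ 0)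
    (hu : invOpL2 ha u = μ • u) : ∃ f, toL2 f = u := by
  have hb := isRealValued_invSqrtFun ha
  have hP : ∀ k v, WienerClass k (P₀L2 ha v) := fun k v => (wienerClass_toL2 k _).smul _
  have hneg : ∀ k v w, WienerClass k v → WienerClass k (v - P₀L2 ha w) := fun k v w hv => by
    rw [sub_eq_add_neg, ← neg_one_smul ℂ]
    exact hv.add ((hP k w).smul _)
  have key : ∀ k, WienerClass k (ΛinvL2 (mulOp (invSqrtFun ha) (u - P₀L2 ha u))) →
      WienerClass k u := by
    intro k hk
    have h : u = μ⁻¹ • invOpL2 ha u := by rw [hu, smul_smul, inv_mul_cancel₀ hμ, one_smul]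
    rw [h, invOpL2_apply]
    exact ((hneg k _ _ (hk.mulOp hb)).add (hP k u)).smul _
  refine exists_toL2_eq_of_wienerClass fun k => ?_
  induction k with
  | zero => exact key 0 (wienerClass_zero_ΛinvL2 _)
  | succ k ih => exact key (k + 1) ((hneg k u u ih).mulOp hb).ΛinvL2

theorem nonempty_eigenbasis_Λa_add_P₀ : Nonempty (Eigenbasis (Λa ha + P₀ ha)) :=
  nonempty_eigenbasis (invOpL2_toL2 ha) (Λa_add_P₀_invOp ha) (invOp_Λa_add_P₀ ha)
    (isCompactOperator_invOpL2 ha) (isSymmetric_invOpL2 ha)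
    (fun _ _ hμ hu => exists_toL2_eq_of_invOpL2_eq ha hμ hu) (re_inner_Λa_add_P₀_nonneg ha)

end

/-! ### Real powers -/

namespace Eigenbasis

variable {A Gs : CInf ℂ →ₗ[ℂ] CInf ℂ} (E : Eigenbasis A)

/-- The eigenvectors as a Hilbert basis of `L²(𝕊)`. -/
def hilbertBasis : HilbertBasis ℕ ℂ L2Circle := HilbertBasis.mk E.orthonormal E.complete.ge

theorem hilbertBasis_apply (k : ℕ) : E.hilbertBasis k = toL2 (E.vec k) := by
  rw [hilbertBasis, HilbertBasis.coe_mk]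

theorem hasSum_norm_sq_inner_vec (f : CInf ℂ) :
    HasSum (fun k => ‖⟪toL2 (E.vec k), toL2 f⟫_ℂ‖ ^ 2) (‖toL2 f‖ ^ 2) := by
  have h := Complex.reCLM.hasSum (E.hilbertBasis.hasSum_inner_mul_inner (toL2 f) (toL2 f))
  rw [Complex.reCLM_apply, ← RCLike.re_eq_complex_re, inner_self_eq_norm_sq] at h
  refine h.congr_fun fun k => ?_
  rw [hilbertBasis_apply, ← inner_conj_symm (toL2 f), Complex.reCLM_apply,
    ← Complex.normSq_eq_conj_mul_self, Complex.ofReal_re, Complex.normSq_eq_norm_sq]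

theorem inner_vec_apply
    (hA : ∀ f g, ⟪toL2 (A f), toL2 g⟫_ℂ = ⟪toL2 f, toL2 (A g)⟫_ℂ)
    (f : CInf ℂ) (k : ℕ) :
    ⟪toL2 (E.vec k), toL2 (A f)⟫_ℂ = E.eig k * ⟪toL2 (E.vec k), toL2 f⟫_ℂ := by
  rw [← hA, E.apply_vec, map_smul, inner_smul_left, Complex.conj_ofReal]

theorem inner_vec_iterate
    (hA : ∀ f g, ⟪toL2 (A f), toL2 g⟫_ℂ = ⟪toL2 f, toL2 (A g)⟫_ℂ)
    (f : CInf ℂ) (j k : ℕ) :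
    ⟪toL2 (E.vec k), toL2 (A^[j] f)⟫_ℂ = (E.eig k : ℂ) ^ j * ⟪toL2 (E.vec k), toL2 f⟫_ℂ := by
  induction j with
  | zero => simp
  | succ j ih => rw [Function.iterate_succ_apply', E.inner_vec_apply hA, ih, pow_succ]; ring

theorem inner_vec_inv
    (hA : ∀ f g, ⟪toL2 (A f), toL2 g⟫_ℂ = ⟪toL2 f, toL2 (A g)⟫_ℂ)
    (hAG : ∀ f, A (Gs f) = f) (f : CInf ℂ) (k : ℕ) :
    ⟪toL2 (E.vec k), toL2 (Gs f)⟫_ℂ = (E.eig k : ℂ)⁻¹ * ⟪toL2 (E.vec k), toL2 f⟫_ℂ := by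
  have h := E.inner_vec_apply hA (Gs f) k
  have hne : (E.eig k : ℂ) ≠ 0 := Complex.ofReal_ne_zero.2 (E.eig_pos k).ne'
  rw [hAG] at h
  rw [h, inv_mul_cancel_left₀ hne]

theorem inner_vec_inv_iterate
    (hA : ∀ f g, ⟪toL2 (A f), toL2 g⟫_ℂ = ⟪toL2 f, toL2 (A g)⟫_ℂ)
    (hAG : ∀ f, A (Gs f) = f) (f : CInf ℂ) (j k : ℕ) :
    ⟪toL2 (E.vec k), toL2 (Gs^[j] f)⟫_ℂ =
      ((E.eig k : ℂ)⁻¹) ^ j * ⟪toL2 (E.vec k), toL2 f⟫_ℂ := by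
  induction j with
  | zero => simp
  | succ j ih => rw [Function.iterate_succ_apply', E.inner_vec_inv hA hAG, ih, pow_succ]; ring

/-- Since λ^s ≤ λ^j + λ^{-j} for an integer j ≥ |s|, the coefficients are dominated by those of A^j
u and of the j-th iterate of the inverse on u, both of which lie in L². -/
theorem summable_powTerm
    (hA : ∀ f g, ⟪toL2 (A f), toL2 g⟫_ℂ = ⟪toL2 f, toL2 (A g)⟫_ℂ)
    (hAG : ∀ f, A (Gs f) = f) (s : ℝ) (u : CInf ℂ) :
    Summable (E.powTerm s u) := by
  obtain ⟨j, hj⟩ := exists_nat_ge |s|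
  have hle : ∀ k, E.eig k ^ s ≤ E.eig k ^ j + (E.eig k)⁻¹ ^ j := by
    intro k
    have h0 := E.eig_pos k
    rcases le_total 1 (E.eig k) with h | h
    · refine (Real.rpow_le_rpow_of_exponent_le h ((le_abs_self s).trans hj)).trans ?_
      rw [Real.rpow_natCast]
      exact le_add_of_nonneg_right (by positivity)
    · refine (Real.rpow_le_rpow_of_exponent_ge h0 h (neg_le.1 ((neg_le_abs s).trans hj))).trans ?_
      rw [Real.rpow_neg h0.le, Real.rpow_natCast, inv_pow]
      exact le_add_of_nonneg_left (by positivity)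
  have hm : Memℓp (fun k => ((E.eig k ^ s : ℝ) : ℂ) * ⟪toL2 (E.vec k), toL2 u⟫_ℂ) 2 := by
    refine memℓp_gen ?_
    have h1 := (E.hasSum_norm_sq_inner_vec (A^[j] u)).summable
    have h2 := (E.hasSum_norm_sq_inner_vec (Gs^[j] u)).summable
    refine Summable.of_nonneg_of_le (fun k => by positivity) (fun k => ?_)
      ((h1.add h2).mul_left 2)
    rw [E.inner_vec_iterate hA, E.inner_vec_inv_iterate hA hAG, ENNReal.toReal_ofNat,
      Real.rpow_ofNat]
    simp only [norm_mul, norm_pow, norm_inv, Complex.norm_real, Real.norm_eq_abs,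
      abs_of_pos (E.eig_pos k), abs_of_pos (Real.rpow_pos_of_pos (E.eig_pos k) s)]
    have h3 := mul_le_mul_of_nonneg_right (hle k) (norm_nonneg ⟪toL2 (E.vec k), toL2 u⟫_ℂ)
    have h4 : 0 ≤ E.eig k ^ s * ‖⟪toL2 (E.vec k), toL2 u⟫_ℂ‖ :=
      mul_nonneg (Real.rpow_pos_of_pos (E.eig_pos k) s).le (norm_nonneg _)
    refine (pow_le_pow_left₀ h4 h3 2).trans ?_
    rw [add_mul]
    exact add_sq_le
  have h := (E.hilbertBasis.hasSum_repr_symm ⟨_, hm⟩).summable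
  exact h.congr fun k => by rw [hilbertBasis_apply]; rfl

/-- By symmetry of A, ⟨ψ'_j, ψ_k⟩ = 0 unless the two eigenvalues agree. So λ_k^s may be replaced by
λ'_j^s in each term, which identifies the coefficients of the sum in the second basis. -/
theorem hasSum_powTerm_congr
    (hA : ∀ f g, ⟪toL2 (A f), toL2 g⟫_ℂ = ⟪toL2 f, toL2 (A g)⟫_ℂ)
    (E' : Eigenbasis A) {s : ℝ} {u : CInf ℂ} {w : L2Circle}
    (hw : HasSum (E.powTerm s u) w) : HasSum (E'.powTerm s u) w := by
  have key : ∀ j, ⟪toL2 (E'.vec j), w⟫_ℂ =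
      ((E'.eig j ^ s : ℝ) : ℂ) * ⟪toL2 (E'.vec j), toL2 u⟫_ℂ := by
    intro j
    have h1 := hw.mapL (innerSL ℂ (toL2 (E'.vec j)))
    have h2 := (E.hilbertBasis.hasSum_inner_mul_inner (toL2 (E'.vec j)) (toL2 u)).mul_left
      ((E'.eig j ^ s : ℝ) : ℂ)
    refine h1.unique (h2.congr_fun fun k => ?_)
    rw [innerSL_apply_apply, powTerm, inner_smul_right, hilbertBasis_apply]
    have h3 : ((E.eig k : ℂ) - E'.eig j) * ⟪toL2 (E'.vec j), toL2 (E.vec k)⟫_ℂ = 0 := by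
      have := E'.inner_vec_apply hA (E.vec k) j
      rw [E.apply_vec, map_smul, inner_smul_right] at this
      rw [sub_mul, this, sub_self]
    rcases mul_eq_zero.1 h3 with h | h
    · rw [show E.eig k = E'.eig j by exact_mod_cast sub_eq_zero.1 h]
      ring
    · rw [h]
      ring
  refine (E'.hilbertBasis.hasSum_repr w).congr_fun fun j => ?_
  rw [HilbertBasis.repr_apply_apply, hilbertBasis_apply, key, powTerm]

theorem hasSum_realPower
    (hA : ∀ f g, ⟪toL2 (A f), toL2 g⟫_ℂ = ⟪toL2 f, toL2 (A g)⟫_ℂ)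
    (hAG : ∀ f, A (Gs f) = f) (s : ℝ) (u : CInf ℂ) :
    HasSum (E.powTerm s u) (realPower A s u) := by
  have hne : Nonempty (Eigenbasis A) := ⟨E⟩
  refine hne.some.hasSum_powTerm_congr hA E ?_
  rw [realPower, dif_pos hne]
  exact (hne.some.summable_powTerm hA hAG s u).hasSum

theorem hasSum_inner_realPower
    (hA : ∀ f g, ⟪toL2 (A f), toL2 g⟫_ℂ = ⟪toL2 f, toL2 (A g)⟫_ℂ)
    (hAG : ∀ f, A (Gs f) = f) (s : ℝ) (u : CInf ℂ) :
    HasSum (fun k => E.eig k ^ s * ‖⟪toL2 (E.vec k), toL2 u⟫_ℂ‖ ^ 2)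
      (⟪toL2 u, realPower A s u⟫_ℂ).re := by
  have h := Complex.reCLM.hasSum ((E.hasSum_realPower hA hAG s u).mapL (innerSL ℂ (toL2 u)))
  refine h.congr_fun fun k => ?_
  rw [innerSL_apply_apply, powTerm, inner_smul_right, mul_assoc, ← inner_conj_symm (toL2 u),
    mul_comm ⟪toL2 (E.vec k), toL2 u⟫_ℂ, ← Complex.normSq_eq_conj_mul_self, ← Complex.ofReal_mul,
    Complex.reCLM_apply, Complex.ofReal_re, Complex.normSq_eq_norm_sq]

theorem hasSum_eig_mul
    (hA : ∀ f g, ⟪toL2 (A f), toL2 g⟫_ℂ = ⟪toL2 f, toL2 (A g)⟫_ℂ)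
    (f : CInf ℂ) :
    HasSum (fun k => E.eig k * ‖⟪toL2 (E.vec k), toL2 f⟫_ℂ‖ ^ 2)
      (⟪toL2 f, toL2 (A f)⟫_ℂ).re := by
  have h := Complex.reCLM.hasSum (E.hilbertBasis.hasSum_inner_mul_inner (toL2 f) (toL2 (A f)))
  refine h.congr_fun fun k => ?_
  rw [hilbertBasis_apply, E.inner_vec_apply hA, ← inner_conj_symm (toL2 f), mul_left_comm,
    ← Complex.normSq_eq_conj_mul_self, ← Complex.ofReal_mul, Complex.reCLM_apply,
    Complex.ofReal_re, Complex.normSq_eq_norm_sq]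

theorem hasSum_eig_sq_mul
    (hA : ∀ f g, ⟪toL2 (A f), toL2 g⟫_ℂ = ⟪toL2 f, toL2 (A g)⟫_ℂ)
    (f : CInf ℂ) :
    HasSum (fun k => E.eig k ^ 2 * ‖⟪toL2 (E.vec k), toL2 f⟫_ℂ‖ ^ 2) (‖toL2 (A f)‖ ^ 2) :=
  (E.hasSum_norm_sq_inner_vec (A f)).congr_fun fun k => by
    rw [E.inner_vec_apply hA, norm_mul, Complex.norm_real, mul_pow, Real.norm_eq_abs, sq_abs]

theorem hasSum_inv_eig_mul
    (hA : ∀ f g, ⟪toL2 (A f), toL2 g⟫_ℂ = ⟪toL2 f, toL2 (A g)⟫_ℂ)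
    (hAG : ∀ f, A (Gs f) = f) (f : CInf ℂ) :
    HasSum (fun k => (E.eig k)⁻¹ * ‖⟪toL2 (E.vec k), toL2 f⟫_ℂ‖ ^ 2)
      (⟪toL2 f, toL2 (Gs f)⟫_ℂ).re := by
  have h := Complex.reCLM.hasSum (E.hilbertBasis.hasSum_inner_mul_inner (toL2 f) (toL2 (Gs f)))
  refine h.congr_fun fun k => ?_
  rw [hilbertBasis_apply, E.inner_vec_inv hA hAG, ← inner_conj_symm (toL2 f), mul_left_comm,
    ← Complex.normSq_eq_conj_mul_self, ← Complex.ofReal_inv, ← Complex.ofReal_mul,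
    Complex.reCLM_apply, Complex.ofReal_re, Complex.normSq_eq_norm_sq]

theorem hasSum_inv_eig_sq_mul
    (hA : ∀ f g, ⟪toL2 (A f), toL2 g⟫_ℂ = ⟪toL2 f, toL2 (A g)⟫_ℂ)
    (hAG : ∀ f, A (Gs f) = f) (f : CInf ℂ) :
    HasSum (fun k => (E.eig k)⁻¹ ^ 2 * ‖⟪toL2 (E.vec k), toL2 f⟫_ℂ‖ ^ 2) (‖toL2 (Gs f)‖ ^ 2) :=
  (E.hasSum_norm_sq_inner_vec (Gs f)).congr_fun fun k => by
    rw [E.inner_vec_inv hA hAG, norm_mul, norm_inv, Complex.norm_real, mul_pow, Real.norm_eq_abs,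
      inv_pow |E.eig k|, sq_abs, inv_pow]

end Eigenbasis

theorem powersWellDefined_Λa_add_P₀ (ha : IsNormalized a) :
    PowersWellDefined (Λa ha + P₀ ha) :=
  ⟨nonempty_eigenbasis_Λa_add_P₀ ha, fun E s u =>
    E.hasSum_realPower (inner_Λa_add_P₀ ha) (Λa_add_P₀_invOp ha) s u⟩

/-! ### An upper bound for small powers -/

/-- The last fraction is (x-1)³/(6x²). Right side minus left side vanishes at 1 and has derivative
(x-1)³/(3x³), so its minimum is at x = 1. Only the powers x, 1, 1/x, 1/x² occur, whose means are
accessible. -/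
theorem log_le_sub_inv_sub_cube {x : ℝ} (hx : 0 < x) :
    Real.log x ≤ (x - x⁻¹) / 2 - (x - 3 + 3 * x⁻¹ - (x⁻¹) ^ 2) / 6 := by
  let h : ℝ → ℝ := fun x => (x - x⁻¹) / 2 - (x - 3 + 3 * x⁻¹ - (x⁻¹) ^ 2) / 6 - Real.log x
  have hd : ∀ y : ℝ, 0 < y → HasDerivAt h ((y - 1) ^ 3 / (3 * y ^ 3)) y := by
    intro y hy
    have hi := hasDerivAt_inv hy.ne'
    have hh : HasDerivAt h _ y := (((((hasDerivAt_id y).sub hi).div_const 2).sub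
      (((((hasDerivAt_id y).sub_const 3).add (hi.const_mul 3)).sub (hi.pow 2)).div_const 6)).sub
      (Real.hasDerivAt_log hy.ne'))
    refine hh.congr_deriv ?_
    push_cast
    field_simp
    ring
  have h1 : h 1 = 0 := by simp [h]
  have hmono : MonotoneOn h (Set.Ici 1) := by
    refine monotoneOn_of_deriv_nonneg (convex_Ici 1)
      (fun y hy => (hd y (zero_lt_one.trans_le hy)).continuousAt.continuousWithinAt) ?_ ?_
    · intro y hy
      rw [interior_Ici] at hy
      exact (hd y (zero_lt_one.trans hy)).differentiableAt.differentiableWithinAt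
    · intro y hy
      rw [interior_Ici] at hy
      have hy1 : 1 < y := hy
      rw [(hd y (zero_lt_one.trans hy)).deriv]
      have : 0 < y - 1 := by linarith
      positivity
  have hanti : AntitoneOn h (Set.Ioc 0 1) := by
    refine antitoneOn_of_deriv_nonpos (convex_Ioc 0 1)
      (fun y hy => (hd y hy.1).continuousAt.continuousWithinAt) ?_ ?_
    · intro y hy
      rw [interior_Ioc] at hy
      exact (hd y hy.1).differentiableAt.differentiableWithinAt
    · intro y hy
      rw [interior_Ioc] at hy
      rw [(hd y hy.1).deriv]
      refine div_nonpos_of_nonpos_of_nonneg ?_ (by have := hy.1; positivity)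
      exact Odd.pow_nonpos (by decide) (by linarith [hy.2])
  have hnn : 0 ≤ h x := by
    rw [← h1]
    rcases le_total 1 x with hx1 | hx1
    · exact hmono (Set.mem_Ici.2 le_rfl) hx1 hx1
    · exact hanti ⟨hx, hx1⟩ ⟨zero_lt_one, le_rfl⟩ hx1
  linarith [show h x = (x - x⁻¹) / 2 - (x - 3 + 3 * x⁻¹ - (x⁻¹) ^ 2) / 6 - Real.log x from rfl]

/-- In the exponential series the terms of order at least two gain a factor s^n ≤ s². Passing to |y|
first makes all terms nonnegative. -/
theorem exp_mul_le {y s : ℝ} (hs : 0 ≤ s) (hs1 : s ≤ 1) :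
    Real.exp (s * y) ≤ 1 + s * y + s ^ 2 * (Real.exp y + Real.exp (-y)) := by
  have h1 : Real.exp |s * y| - 1 - |s * y| ≤ s ^ 2 * (Real.exp |y| - 1 - |y|) := by
    have e1 := (NormedSpace.expSeries_div_hasSum_exp (|s * y|)).sub
      (hasSum_sum_of_ne_finset_zero (f := fun n : ℕ => if n < 2 then |s * y| ^ n / n.factorial else 0)
        (s := Finset.range 2) fun n hn => if_neg (by simpa using hn))
    have e2 := ((NormedSpace.expSeries_div_hasSum_exp (|y|)).sub
      (hasSum_sum_of_ne_finset_zero (f := fun n : ℕ => if n < 2 then |y| ^ n / n.factorial else 0)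
        (s := Finset.range 2) fun n hn => if_neg (by simpa using hn))).mul_left (s ^ 2)
    have e3 := hasSum_le (fun n => ?_) e1 e2
    · simp [Finset.sum_range_succ, ← Real.exp_eq_exp_ℝ] at e3
      rw [abs_mul]
      linarith
    · by_cases hn : n < 2
      · simp [hn]
      · simp only [hn, if_false, sub_zero]
        rw [abs_mul, abs_of_nonneg hs, mul_pow, mul_div_assoc]
        exact mul_le_mul_of_nonneg_right (pow_le_pow_of_le_one hs hs1 (not_lt.1 hn))
          (by positivity)
  have h2 : Real.exp (s * y) - 1 - s * y ≤ Real.exp |s * y| - 1 - |s * y| := by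
    rcases le_total 0 (s * y) with h | h
    · rw [abs_of_nonneg h]
    · rw [abs_of_nonpos h]
      have := Real.self_le_sinh_iff.2 (neg_nonneg.2 h)
      rw [Real.sinh_eq, neg_neg] at this
      linarith
  have h3 : Real.exp |y| ≤ Real.exp y + Real.exp (-y) := by
    rcases abs_cases y with ⟨h, _⟩ | ⟨h, _⟩ <;> rw [h] <;> linarith [Real.exp_pos y, Real.exp_pos (-y)]
  have h4 : s ^ 2 * (Real.exp |y| - 1 - |y|) ≤ s ^ 2 * (Real.exp y + Real.exp (-y)) :=
    mul_le_mul_of_nonneg_left (by linarith [abs_nonneg y]) (sq_nonneg s)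
  linarith

/-- A probability distribution on `(0, ∞)` with `E[x] = E[1/x] = 1 + δ` and
`E[1/x²] < 1 + 4δ` has `E[x^s] < 1` for small positive `s`. -/
theorem exists_forall_hasSum_rpow_lt_one {w x : ℕ → ℝ} {δ q : ℝ} (hx : ∀ k, 0 < x k)
    (hw : ∀ k, 0 ≤ w k) (h0 : HasSum w 1) (h1 : HasSum (fun k => x k * w k) (1 + δ))
    (h2 : HasSum (fun k => (x k)⁻¹ * w k) (1 + δ)) (h3 : HasSum (fun k => (x k)⁻¹ ^ 2 * w k) q)
    (hq : q < 1 + 4 * δ) :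
    ∃ s₀ > (0 : ℝ), ∀ s ∈ Ioo 0 s₀, ∀ F, HasSum (fun k => x k ^ s * w k) F → F < 1 := by
  have hδ : 0 ≤ 1 + δ := h1.nonneg fun k => mul_nonneg (hx k).le (hw k)
  -- -κ is the mean of the upper bound for log x: the part (x - 1/x)/2 averages to zero and the rest
  -- gives -((1+δ) - 3 + 3(1+δ) - q)/6.
  set κ := (1 + 4 * δ - q) / 6 with hκ
  have hκ0 : 0 < κ := by rw [hκ]; linarith
  -- The mean of x^s is at most 1 - sκ + 2s²(1 + δ). The extra 1 keeps the denominator positive even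
  -- when only 1 + δ ≥ 0 is known.
  refine ⟨min 1 (κ / (2 * (1 + δ) + 1)), lt_min one_pos (by positivity), fun s hs F hF => ?_⟩
  have hs0 := hs.1
  have hs1 : s < 1 := hs.2.trans_le (min_le_left _ _)
  have hs2 : s * (2 * (1 + δ) + 1) < κ :=
    (lt_div_iff₀ (by positivity)).1 (hs.2.trans_le (min_le_right _ _))
  have hsum : HasSum (fun k => (1 + s * ((x k - (x k)⁻¹) / 2 -
      (x k - 3 + 3 * (x k)⁻¹ - ((x k)⁻¹) ^ 2) / 6) + s ^ 2 * (x k + (x k)⁻¹)) * w k)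
      (1 + s * (((1 + δ) - (1 + δ)) / 2 - ((1 + δ) - 3 * 1 + 3 * (1 + δ) - q) / 6) +
        s ^ 2 * ((1 + δ) + (1 + δ))) := by
    refine ((h0.add ((((h1.sub h2).div_const 2).sub ((((h1.sub (h0.mul_left 3)).add
      (h2.mul_left 3)).sub h3).div_const 6)).mul_left s)).add
        ((h1.add h2).mul_left (s ^ 2))).congr_fun fun k => ?_
    ring
  have hle := hasSum_le (fun k => mul_le_mul_of_nonneg_right (?_ : x k ^ s ≤ _) (hw k)) hF hsum
  · refine hle.trans_lt ?_
    have : s * (s * (2 * (1 + δ) + 1)) < s * κ := mul_lt_mul_of_pos_left hs2 hs0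
    rw [hκ] at this
    nlinarith [sq_nonneg s]
  · have h := exp_mul_le (y := Real.log (x k)) hs0.le hs1.le
    rw [Real.exp_neg, Real.exp_log (hx k), mul_comm, ← Real.rpow_def_of_pos (hx k)] at h
    have h' := mul_le_mul_of_nonneg_left (log_le_sub_inv_sub_cube (hx k)) hs0.le
    linarith

/-! ### Moments of the spectral measure of `φ_n` -/

/-- Parseval's identity for functions obtained from `g` by real Fourier multipliers. -/
theorem hasSum_mul_mul_norm_sq {f g h : CInf ℂ} {σ τ : ℤ → ℝ}
    (hf : ∀ l, fourierCoeff f l = σ l * fourierCoeff g l)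
    (hh : ∀ l, fourierCoeff h l = τ l * fourierCoeff g l) :
    HasSum (fun l => σ l * τ l * ‖fourierCoeff g l‖ ^ 2)
      ((2 * π)⁻¹ * (⟪toL2 f, toL2 h⟫_ℂ).re) := by
  have h1 := Complex.reCLM.hasSum (hasSum_conj_fourierCoeff_mul f h)
  rw [show (2 * π : ℂ)⁻¹ = (((2 * π)⁻¹ : ℝ) : ℂ) by push_cast; rfl, Complex.reCLM_apply,
    Complex.re_ofReal_mul] at h1
  refine h1.congr_fun fun l => ?_
  rw [hf, hh, map_mul (starRingEnd ℂ), Complex.conj_ofReal, show ∀ a b c d : ℂ, a * b * (c * d) = a * c * (b * d)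
    from fun a b c d => by ring, ← Complex.normSq_eq_conj_mul_self, ← Complex.ofReal_mul,
    ← Complex.ofReal_mul, Complex.reCLM_apply, Complex.ofReal_re, Complex.normSq_eq_norm_sq]

theorem norm_toL2_mul_sq_le {h : CInf ℂ} {C : ℝ} (hC : ∀ θ, ‖h θ‖ ^ 2 ≤ C) (f : CInf ℂ) :
    ‖toL2 (h * f)‖ ^ 2 ≤ C * ‖toL2 f‖ ^ 2 := by
  have hC0 : 0 ≤ C := (sq_nonneg _).trans (hC 0)
  have h1 : ‖toL2 (h * f)‖ ≤ √C * ‖toL2 f‖ := by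
    refine Lp.norm_le_mul_norm_of_ae_le_mul ?_
    filter_upwards [coeFn_toL2 f, coeFn_toL2 (h * f)] with x h1 h2
    rw [h1, h2, CInf.mul_apply, norm_mul]
    exact mul_le_mul_of_nonneg_right (Real.le_sqrt_of_sq_le (hC x)) (norm_nonneg _)
  calc _ ≤ (√C * ‖toL2 f‖) ^ 2 := pow_le_pow_left₀ (norm_nonneg _) h1 2
    _ = _ := by rw [mul_pow, Real.sq_sqrt hC0]

theorem norm_toL2_sq (f : CInf ℂ) : ‖toL2 f‖ ^ 2 = (⟪toL2 f, toL2 f⟫_ℂ).re := by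
  rw [← RCLike.re_eq_complex_re, inner_self_eq_norm_sq]

theorem fourierCoeff_neg_I_smul_dθ (f : CInf ℂ) (l : ℤ) :
    fourierCoeff (-Complex.I • dθ f : CInf ℂ) l = ((l : ℝ) : ℂ) * fourierCoeff f l := by
  rw [fourierCoeff_smul, fourierCoeff_dθ, ← mul_assoc, ← mul_assoc, neg_mul, Complex.I_mul_I,
    neg_neg, one_mul, Complex.ofReal_intCast]

theorem Λinv_neg_I_smul_dθ (f : CInf ℂ) : Λinv (-Complex.I • dθ f) = hilb f :=
  CInf.ext_fourierCoeff fun l => by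
    rw [fourierCoeff_Λinv, fourierCoeff_neg_I_smul_dθ, fourierCoeff_hilb, ← mul_assoc,
      ← Complex.ofReal_mul, ← Complex.ofReal_intCast l.sign]
    congr 2
    rcases lt_trichotomy l 0 with h | rfl | h
    · have h' : (l : ℝ) < 0 := by exact_mod_cast h
      rw [Int.sign_eq_neg_one_of_neg h, abs_of_neg h', inv_neg, neg_mul, inv_mul_cancel₀ h'.ne]
      simp
    · simp
    · have h' : (0 : ℝ) < l := by exact_mod_cast h
      rw [Int.sign_eq_one_of_pos h, abs_of_pos h', inv_mul_cancel₀ h'.ne']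
      simp

section

variable (ha : IsNormalized a) (n : ℕ)

theorem norm_phase (n : ℤ) (θ) : ‖phase ha n θ‖ = 1 := by
  induction θ using QuotientAddGroup.induction_on with
  | H θ =>
    have h := phase_apply ha n θ
    refine (congrArg norm h).trans ?_
    rw [mul_assoc, mul_comm, ← Complex.ofReal_intCast, ← Complex.ofReal_mul,
      Complex.norm_exp_ofReal_mul_I]

theorem inner_invSqrtFun_mul_phase (n : ℤ) :
    ⟪toL2 (invSqrtFun ha * phase ha n), toL2 (invSqrtFun ha * phase ha n)⟫_ℂ = 2 * π := by
  rw [← inner_invSqrtFun_self ha, inner_toL2, inner_toL2]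
  congr 1
  funext θ
  rw [CInf.mul_apply, map_mul, mul_mul_mul_comm, Complex.mul_conj (phase ha n θ),
    Complex.normSq_eq_norm_sq, norm_phase, one_pow, Complex.ofReal_one, mul_one]

theorem neg_I_smul_dθ_phase (n : ℤ) : -Complex.I • dθ (phase ha n) =
    (n : ℂ) • (invSqrtFun ha * (invSqrtFun ha * phase ha n)) := by
  rw [dθ_phase, smul_smul, ← mul_assoc, neg_mul, Complex.I_mul_I, neg_neg, one_mul]

variable {n}

theorem invSqrtFun_mul_invSqrtFun_mul_phase {n : ℤ} (hn : n ≠ 0) :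
    invSqrtFun ha * (invSqrtFun ha * phase ha n) = (n : ℂ)⁻¹ • (-Complex.I • dθ (phase ha n)) := by
  rw [neg_I_smul_dθ_phase, smul_smul, inv_mul_cancel₀ (Int.cast_ne_zero.2 hn), one_smul]

/-- The product a^{-1/2}φ_n is a multiple of the derivative of e^{inΦ}, hence has mean zero. -/
theorem P₀_φ {n : ℤ} (hn : n ≠ 0) : P₀ ha (φ ha n) = 0 := by
  rw [P₀_apply, inner_φ_zero, φ_eq, mul_smul_comm, invSqrtFun_mul_invSqrtFun_mul_phase ha hn,
    fourierCoeff_smul, fourierCoeff_smul, fourierCoeff_neg_I_smul_dθ]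
  simp

theorem Λa_add_P₀_φ {n : ℤ} (hn : n ≠ 0) : (Λa ha + P₀ ha) (φ ha n) =
    (((√(2 * π) : ℝ) : ℂ)⁻¹) • (sqrtFun ha * Λ (phase ha n)) := by
  rw [LinearMap.add_apply, P₀_φ ha hn, add_zero, Λa_apply, φ_eq, mul_smul_comm, sqrtFun_mul_cancel,
    map_smul, mul_smul_comm]

/-- With D = -i d/dθ, a⁻¹g = n⁻¹Dg and |D|⁻¹D is the Hilbert transform, so the inverse on φ_n
involves no smoothing operator any more. -/
theorem invOp_φ {n : ℤ} (hn : n ≠ 0) : invOp ha (φ ha n) =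
    (((√(2 * π) : ℝ) : ℂ)⁻¹ * (n : ℂ)⁻¹) • (invSqrtFun ha * hilb (phase ha n) -
      P₀ ha (invSqrtFun ha * hilb (phase ha n))) := by
  rw [invOp_apply, P₀_φ ha hn, sub_zero, add_zero, φ_eq, mul_smul_comm,
    invSqrtFun_mul_invSqrtFun_mul_phase ha hn, smul_smul, map_smul, Λinv_neg_I_smul_dθ,
    mul_smul_comm, map_smul, smul_sub]

theorem norm_φ_sq (n : ℤ) : ‖toL2 (φ ha n)‖ ^ 2 = 1 := by
  have h := norm_toL2_sq (invSqrtFun ha * phase ha n)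
  rw [inner_invSqrtFun_mul_phase, ← Complex.ofReal_ofNat, ← Complex.ofReal_mul,
    Complex.ofReal_re] at h
  rw [φ_eq, map_smul, norm_smul, mul_pow, h, norm_inv, Complex.norm_real, inv_pow, Real.norm_eq_abs,
    sq_abs, Real.sq_sqrt Real.two_pi_pos.le, inv_mul_cancel₀ Real.two_pi_pos.ne']

/-- The squared moduli of the Fourier coefficients of `e^{inΦ}`. -/
def phaseWeight (ha : IsNormalized a) (n : ℕ) (l : ℤ) : ℝ := ‖fourierCoeff (phase ha n) l‖ ^ 2

theorem re_inner_smul_smul (f g : CInf ℂ) :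
    (⟪toL2 ((((√(2 * π) : ℝ) : ℂ)⁻¹) • f), toL2 ((((√(2 * π) : ℝ) : ℂ)⁻¹) • g)⟫_ℂ).re =
      (2 * π)⁻¹ * (⟪toL2 f, toL2 g⟫_ℂ).re := by
  rw [map_smul, map_smul, inner_smul_left, inner_smul_right, map_inv₀, Complex.conj_ofReal,
    ← mul_assoc, ← mul_inv, sqrt_two_pi_mul_self,
    show (2 * π : ℂ)⁻¹ = (((2 * π)⁻¹ : ℝ) : ℂ) by push_cast; rfl, Complex.re_ofReal_mul]

theorem hasSum_abs_mul_phaseWeight (hn : 0 < n) :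
    HasSum (fun l : ℤ => |(l : ℝ)| * phaseWeight ha n l)
      (⟪toL2 (φ ha n), toL2 ((Λa ha + P₀ ha) (φ ha n))⟫_ℂ).re := by
  have h := hasSum_mul_mul_norm_sq (f := phase ha n) (g := phase ha n) (h := Λ (phase ha n))
    (σ := fun _ => 1) (τ := fun l => |(l : ℝ)|) (fun l => by rw [Complex.ofReal_one, one_mul])
    (fun l => by
      rw [fourierCoeff_Λ, show |(l : ℝ)| = ((|l| : ℤ) : ℝ) by push_cast; rfl,
        Complex.ofReal_intCast])
  simp only [one_mul] at h
  have hn' : (n : ℤ) ≠ 0 := by exact_mod_cast hn.ne'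
  rw [Λa_add_P₀_φ ha hn', φ_eq ha n, re_inner_smul_smul, ← (isRealValued_sqrtFun ha).inner_mul,
    sqrtFun_mul_cancel]
  exact h

/-- The winding number of `e^{inΦ}` in terms of its Fourier coefficients. -/
theorem hasSum_mul_phaseWeight : HasSum (fun l : ℤ => (l : ℝ) * phaseWeight ha n l) n := by
  have h := hasSum_mul_mul_norm_sq (f := phase ha n) (g := phase ha n)
    (h := -Complex.I • dθ (phase ha n))
    (σ := fun _ => 1) (τ := fun l => (l : ℝ)) (fun l => by rw [Complex.ofReal_one, one_mul])
    (fourierCoeff_neg_I_smul_dθ _)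
  simp only [one_mul] at h
  rw [neg_I_smul_dθ_phase, map_smul, inner_smul_right, ← (isRealValued_invSqrtFun ha).inner_mul,
    inner_invSqrtFun_mul_phase, show ((n : ℤ) : ℂ) * (2 * π) = ((n * (2 * π) : ℝ) : ℂ) by
      push_cast; rfl, Complex.ofReal_re] at h
  have h1 : (2 * π)⁻¹ * (n * (2 * π)) = n := by
    have := Real.pi_ne_zero
    field_simp
  exact h1 ▸ h

theorem inner_mul_phase_mul {f : CInf ℂ} (hn : 0 < n) :
    (⟪toL2 (invSqrtFun ha * phase ha n), toL2 (invSqrtFun ha * f)⟫_ℂ).re =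
      (n : ℝ)⁻¹ * (⟪toL2 (-Complex.I • dθ (phase ha n)), toL2 f⟫_ℂ).re := by
  have hn' : (n : ℤ) ≠ 0 := by exact_mod_cast hn.ne'
  rw [← (isRealValued_invSqrtFun ha).inner_mul, invSqrtFun_mul_invSqrtFun_mul_phase ha hn',
    map_smul toL2 _ (-Complex.I • dθ (phase ha n)), inner_smul_left,
    show ((n : ℤ) : ℂ)⁻¹ = (((n : ℝ)⁻¹ : ℝ) : ℂ) by push_cast; rfl, Complex.conj_ofReal,
    Complex.re_ofReal_mul]

theorem P₀_invSqrtFun_mul_phase (hn : 0 < n) : P₀ ha (invSqrtFun ha * phase ha n) = 0 := by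
  have h := P₀_φ ha (n := n) (by exact_mod_cast hn.ne')
  rw [φ_eq, map_smul] at h
  exact (smul_eq_zero.1 h).resolve_left (inv_ne_zero sqrt_two_pi_ne_zero)

/-- Both forms reduce to ∑ |l||c_l|²: on the left the weight arises as l · sgn(l), from pairing -i
g' with the Hilbert transform of g. -/
theorem re_inner_φ_invOp_φ (hn : 0 < n) :
    (⟪toL2 (φ ha n), toL2 (invOp ha (φ ha n))⟫_ℂ).re =
      ((n : ℝ)⁻¹) ^ 2 * (⟪toL2 (φ ha n), toL2 ((Λa ha + P₀ ha) (φ ha n))⟫_ℂ).re := by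
  have hn' : (n : ℤ) ≠ 0 := by exact_mod_cast hn.ne'
  have h := hasSum_mul_mul_norm_sq (f := -Complex.I • dθ (phase ha n)) (g := phase ha n)
    (h := hilb (phase ha n)) (σ := fun l => l) (τ := fun l => (l.sign : ℝ))
    (fourierCoeff_neg_I_smul_dθ _) (fun l => by rw [fourierCoeff_hilb, Complex.ofReal_intCast])
  have h' : HasSum (fun l : ℤ => |(l : ℝ)| * phaseWeight ha n l) _ := h.congr_fun fun l => by
    rw [phaseWeight, show |(l : ℝ)| = (l : ℝ) * (l.sign : ℝ) by
      exact_mod_cast (Int.mul_sign_self l ▸ Int.abs_eq_natAbs l)]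
  rw [(hasSum_abs_mul_phaseWeight ha hn).unique h', invOp_φ ha hn', φ_eq ha n, ← smul_smul,
    re_inner_smul_smul, map_smul, inner_smul_right, map_sub, inner_sub_right, ← inner_P₀,
    P₀_invSqrtFun_mul_phase ha hn, map_zero, inner_zero_left, sub_zero,
    show ((n : ℤ) : ℂ)⁻¹ = (((n : ℝ)⁻¹ : ℝ) : ℂ) by push_cast; rfl, Complex.re_ofReal_mul,
    inner_mul_phase_mul ha hn]
  ring

/-! ### Upper bounds for the second moments -/

theorem norm_sub_P₀_le (f : CInf ℂ) : ‖toL2 (f - P₀ ha f)‖ ≤ ‖toL2 f‖ := by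
  have h : ‖toL2 (f - P₀ ha f)‖ ^ 2 ≤ ‖toL2 (f - P₀ ha f)‖ * ‖toL2 f‖ := by
    have h1 : ⟪toL2 (f - P₀ ha f), toL2 (P₀ ha f)⟫_ℂ = 0 := by
      rw [← inner_P₀, map_sub (P₀ ha), P₀_P₀, sub_self, map_zero, inner_zero_left]
    rw [norm_toL2_sq, map_sub, inner_sub_right, ← map_sub, h1, sub_zero]
    exact (Complex.re_le_norm _).trans (norm_inner_le_norm _ _)
  rcases (norm_nonneg (toL2 (f - P₀ ha f))).eq_or_lt with h0 | h0
  · rw [← h0]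
    exact norm_nonneg _
  · rw [sq] at h
    exact le_of_mul_le_mul_left h h0

theorem norm_add_sq_toL2 (f g : CInf ℂ) : ‖toL2 (f + g)‖ ^ 2 =
    ‖toL2 f‖ ^ 2 + 2 * (⟪toL2 f, toL2 g⟫_ℂ).re + ‖toL2 g‖ ^ 2 := by
  rw [map_add]
  exact norm_add_sq (𝕜 := ℂ) _ _

theorem norm_sub_sq_toL2 (f g : CInf ℂ) : ‖toL2 (f - g)‖ ^ 2 =
    ‖toL2 f‖ ^ 2 - 2 * (⟪toL2 f, toL2 g⟫_ℂ).re + ‖toL2 g‖ ^ 2 := by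
  rw [map_sub]
  exact norm_sub_sq (𝕜 := ℂ) _ _

theorem norm_inv_sqrt_smul_sq (f : CInf ℂ) :
    ‖toL2 ((((√(2 * π) : ℝ) : ℂ)⁻¹) • f)‖ ^ 2 = (2 * π)⁻¹ * ‖toL2 f‖ ^ 2 := by
  rw [norm_toL2_sq, re_inner_smul_smul, norm_toL2_sq]

theorem norm_invSqrtFun_mul_phase_sq : ‖toL2 (invSqrtFun ha * phase ha n)‖ ^ 2 = 2 * π := by
  rw [norm_toL2_sq, inner_invSqrtFun_mul_phase, ← Complex.ofReal_ofNat, ← Complex.ofReal_mul,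
    Complex.ofReal_re]

/-- Write Hg = g - (g - Hg). The main part has norm one after normalization, the cross term is
exactly 2T/n because l(1 - sgn l) = -(|l| - l), and only the square of g - Hg, supported on l ≤ 0,
is estimated through sup 1/a. Discarding the component along φ₀ lowers the norm. -/
theorem norm_invOp_φ_sq_le (hn : 0 < n) {W T X : ℝ} (hW : ∀ θ, (a θ)⁻¹ ≤ W)
    (hT : HasSum (fun l : ℤ => (|(l : ℝ)| - l) * phaseWeight ha n l) T)
    (hX : HasSum (fun l : ℤ => (1 - (l.sign : ℝ)) ^ 2 * phaseWeight ha n l) X) :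
    ‖toL2 (invOp ha (φ ha n))‖ ^ 2 ≤ ((n : ℝ)⁻¹) ^ 2 * (1 + 2 * T / n + W * X) := by
  have hn' : (n : ℤ) ≠ 0 := by exact_mod_cast hn.ne'
  set g := phase ha n with hg
  set b := invSqrtFun ha with hb
  have hq : ∀ l, fourierCoeff (g - hilb g : CInf ℂ) l =
      ((1 - (l.sign : ℝ) : ℝ) : ℂ) * fourierCoeff g l := fun l => by
    rw [fourierCoeff_sub, fourierCoeff_hilb]
    push_cast
    ring
  have h1 := hasSum_mul_mul_norm_sq (fourierCoeff_neg_I_smul_dθ g) hq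
  have h2 := hasSum_mul_mul_norm_sq hq hq
  have h3 : (2 * π)⁻¹ * (⟪toL2 (-Complex.I • dθ g), toL2 (g - hilb g)⟫_ℂ).re = -T := by
    refine h1.unique (hT.neg.congr_fun fun l => ?_)
    rw [show |(l : ℝ)| = (l : ℝ) * (l.sign : ℝ) by
      exact_mod_cast (Int.mul_sign_self l ▸ Int.abs_eq_natAbs l), phaseWeight]
    ring
  have h4 : (2 * π)⁻¹ * ‖toL2 (g - hilb g)‖ ^ 2 = X := by
    rw [norm_toL2_sq]
    refine h2.unique (hX.congr_fun fun l => ?_)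
    rw [phaseWeight, sq (1 - (l.sign : ℝ))]
  have h5 : ‖toL2 (b * (g - hilb g))‖ ^ 2 ≤ W * ‖toL2 (g - hilb g)‖ ^ 2 :=
    norm_toL2_mul_sq_le (fun θ => by
      rw [hb, invSqrtFun_apply, Complex.norm_real, Real.norm_eq_abs, sq_abs, inv_pow,
        Real.sq_sqrt (ha.pos θ).le]
      exact hW θ) _
  have h6 : ‖toL2 (b * hilb g)‖ ^ 2 = 2 * π + 2 * ((n : ℝ)⁻¹ * (2 * π * T)) +
      ‖toL2 (b * (g - hilb g))‖ ^ 2 := by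
    have h7 : b * hilb g = b * g - b * (g - hilb g) := by ring
    rw [h7, norm_sub_sq_toL2, hb, hg, norm_invSqrtFun_mul_phase_sq, inner_mul_phase_mul ha hn, ← hg,
      (inv_mul_eq_iff_eq_mul₀ Real.two_pi_pos.ne').1 h3]
    ring
  have h8 : ‖toL2 (invOp ha (φ ha n))‖ ^ 2 ≤
      ((n : ℝ)⁻¹) ^ 2 * ((2 * π)⁻¹ * ‖toL2 (b * hilb g)‖ ^ 2) := by
    rw [invOp_φ ha hn', ← smul_smul, norm_inv_sqrt_smul_sq, map_smul, norm_smul, norm_inv,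
      Complex.norm_intCast, mul_pow, Int.cast_natCast, Nat.abs_cast, mul_left_comm]
    exact mul_le_mul_of_nonneg_left (mul_le_mul_of_nonneg_left
      (pow_le_pow_left₀ (norm_nonneg _) (norm_sub_P₀_le ha _) 2)
      (inv_nonneg.2 Real.two_pi_pos.le)) (by positivity)
  refine h8.trans (mul_le_mul_of_nonneg_left ?_ (by positivity))
  rw [h6, ← h4]
  have h9 := mul_le_mul_of_nonneg_left h5 (inv_nonneg.2 Real.two_pi_pos.le)
  have h10 : (2 * π)⁻¹ * (2 * π + 2 * ((n : ℝ)⁻¹ * (2 * π * T))) = 1 + 2 * T / n := by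
    have := Real.pi_ne_zero
    have : (n : ℝ) ≠ 0 := by exact_mod_cast hn.ne'
    field_simp
  rw [mul_add, h10]
  linarith

/-- Write Λg = -i g' + r, with r supported on negative frequencies. After multiplication by a^{1/2}
the first part is n a^{-1/2}g, so the cross term loses its weight and equals 2nT; only r is
estimated through sup a. -/
theorem norm_Λa_add_P₀_φ_sq_le (hn : 0 < n) {C T X : ℝ} (hC : ∀ θ, a θ ≤ C)
    (hT : HasSum (fun l : ℤ => (|(l : ℝ)| - l) * phaseWeight ha n l) T)
    (hX : HasSum (fun l : ℤ => (|(l : ℝ)| - l) ^ 2 * phaseWeight ha n l) X) :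
    ‖toL2 ((Λa ha + P₀ ha) (φ ha n))‖ ^ 2 ≤ (n : ℝ) ^ 2 + 2 * n * T + C * X := by
  have hn' : (n : ℤ) ≠ 0 := by exact_mod_cast hn.ne'
  set g := phase ha n with hg
  set r := Λ g - (-Complex.I • dθ g) with hr
  have hq : ∀ l, fourierCoeff r l = ((|(l : ℝ)| - l : ℝ) : ℂ) * fourierCoeff g l := fun l => by
    rw [hr, fourierCoeff_sub, fourierCoeff_neg_I_smul_dθ, fourierCoeff_Λ,
      show |(l : ℝ)| = ((|l| : ℤ) : ℝ) by push_cast; rfl, Complex.ofReal_sub, sub_mul,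
      Complex.ofReal_intCast |l|]
  have h1 := hasSum_mul_mul_norm_sq (f := g) (g := g) (σ := fun _ => 1)
    (fun l => by rw [Complex.ofReal_one, one_mul]) hq
  have h2 := hasSum_mul_mul_norm_sq hq hq
  have h3 : (2 * π)⁻¹ * (⟪toL2 g, toL2 r⟫_ℂ).re = T := by
    refine h1.unique (hT.congr_fun fun l => ?_)
    rw [one_mul, phaseWeight]
  have h4 : (2 * π)⁻¹ * ‖toL2 r‖ ^ 2 = X := by
    rw [norm_toL2_sq]
    refine h2.unique (hX.congr_fun fun l => ?_)
    rw [phaseWeight, sq (|(l : ℝ)| - l)]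
  have h5 : ‖toL2 (sqrtFun ha * r)‖ ^ 2 ≤ C * ‖toL2 r‖ ^ 2 :=
    norm_toL2_mul_sq_le (fun θ => by
      rw [sqrtFun_apply, Complex.norm_real, Real.norm_eq_abs, sq_abs, Real.sq_sqrt (ha.pos θ).le]
      exact hC θ) _
  have h6 : ‖toL2 (sqrtFun ha * Λ g)‖ ^ 2 = (n : ℝ) ^ 2 * (2 * π) + 2 * (n * (2 * π * T)) +
      ‖toL2 (sqrtFun ha * r)‖ ^ 2 := by
    have h7 : sqrtFun ha * Λ g = ((n : ℤ) : ℂ) • (invSqrtFun ha * g) + sqrtFun ha * r := by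
      have : Λ g = ((n : ℤ) : ℂ) • (invSqrtFun ha * (invSqrtFun ha * g)) + r := by
        rw [hr, hg, neg_I_smul_dθ_phase]
        abel
      rw [this, mul_add, mul_smul_comm, sqrtFun_mul_cancel]
    rw [h7, norm_add_sq_toL2, map_smul, norm_smul, inner_smul_left,
      ← (isRealValued_sqrtFun ha).inner_mul, sqrtFun_mul_cancel, mul_pow, hg,
      norm_invSqrtFun_mul_phase_sq, ← hg, Complex.norm_intCast, Int.cast_natCast, Nat.abs_cast,
      Int.cast_natCast, Complex.conj_natCast, ← Complex.ofReal_natCast, Complex.re_ofReal_mul,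
      (inv_mul_eq_iff_eq_mul₀ Real.two_pi_pos.ne').1 h3]
  rw [Λa_add_P₀_φ ha hn', norm_inv_sqrt_smul_sq, h6, ← h4]
  have h9 := mul_le_mul_of_nonneg_left h5 (inv_nonneg.2 Real.two_pi_pos.le)
  have h10 : (2 * π)⁻¹ * ((n : ℝ) ^ 2 * (2 * π) + 2 * (n * (2 * π * T))) =
      (n : ℝ) ^ 2 + 2 * n * T := by
    have := Real.pi_ne_zero
    field_simp
  rw [mul_add, h10]
  linarith

/-! ### Sufficient conditions for the strict inequalities at φ_n -/

theorem re_powerForm_eq (s : ℝ) (E : Eigenbasis (Λa ha + P₀ ha)) :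
    HasSum (fun k => E.eig k ^ s * ‖⟪toL2 (E.vec k), toL2 (φ ha n)⟫_ℂ‖ ^ 2)
      (powerForm ha s n).re :=
  E.hasSum_inner_realPower (inner_Λa_add_P₀ ha) (Λa_add_P₀_invOp ha) s (φ ha n)

theorem re_inner_φ_Λa_add_P₀_φ (hn : 0 < n) {T : ℝ}
    (hT : HasSum (fun l : ℤ => (|(l : ℝ)| - l) * phaseWeight ha n l) T) :
    (⟪toL2 (φ ha n), toL2 ((Λa ha + P₀ ha) (φ ha n))⟫_ℂ).re = n + T := by
  refine (hasSum_abs_mul_phaseWeight ha hn).unique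
    (((hasSum_mul_phaseWeight ha).add hT).congr_fun fun l => ?_)
  ring

theorem hasSum_of_eq_mul {ι : Type} {f g : ι → ℝ} {A B : ℝ} (hf : HasSum f A) (c : ℝ)
    (hfg : ∀ k, g k = c * f k) (hB : B = c * A) : HasSum g B := by
  rw [hB]
  exact (hf.mul_left c).congr_fun hfg

/-- The form of small positive powers at `φ_n` lies below `n^s`. -/
theorem exists_re_powerForm_lt (hn : 0 < n) {W T X : ℝ} (hW : ∀ θ, (a θ)⁻¹ ≤ W)
    (hT : HasSum (fun l : ℤ => (|(l : ℝ)| - l) * phaseWeight ha n l) T)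
    (hX : HasSum (fun l : ℤ => (1 - (l.sign : ℝ)) ^ 2 * phaseWeight ha n l) X)
    (h : W * X < 2 * T / n) :
    ∃ s₀ > (0 : ℝ), ∀ s ∈ Ioo 0 s₀, (powerForm ha s n).re < (n : ℝ) ^ s := by
  obtain ⟨E⟩ := nonempty_eigenbasis_Λa_add_P₀ ha
  have hn0 : (0 : ℝ) < n := by exact_mod_cast hn
  have hA := inner_Λa_add_P₀ ha
  have hAG := Λa_add_P₀_invOp ha
  have m0 := E.hasSum_norm_sq_inner_vec (φ ha n)
  rw [norm_φ_sq] at m0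
  have m1 := E.hasSum_eig_mul hA (φ ha n)
  have m2 := E.hasSum_inv_eig_mul hA hAG (φ ha n)
  have m3 := E.hasSum_inv_eig_sq_mul hA hAG (φ ha n)
  have hq := norm_invOp_φ_sq_le ha hn hW hT hX
  rw [re_inner_φ_invOp_φ ha hn] at m2
  rw [re_inner_φ_Λa_add_P₀_φ ha hn hT] at m1 m2
  obtain ⟨s₀, hs₀, hs⟩ := exists_forall_hasSum_rpow_lt_one (x := fun k => E.eig k / n)
    (δ := T / n) (q := (n : ℝ) ^ 2 * ‖toL2 (invOp ha (φ ha n))‖ ^ 2)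
    (fun k => div_pos (E.eig_pos k) hn0) (fun k => sq_nonneg _) m0
    (hasSum_of_eq_mul m1 (n : ℝ)⁻¹ (fun k => by ring) (by field_simp))
    (hasSum_of_eq_mul m2 (n : ℝ) (fun k => by simp only [inv_div]; ring) (by field_simp))
    (hasSum_of_eq_mul m3 ((n : ℝ) ^ 2) (fun k => by simp only [inv_div]; ring) rfl)
    (by
      have := mul_le_mul_of_nonneg_left hq (sq_nonneg (n : ℝ))
      rw [← mul_assoc (_ ^ 2), ← mul_pow _ (n : ℝ)⁻¹, mul_inv_cancel₀ hn0.ne', one_pow,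
        one_mul] at this
      refine this.trans_lt ?_
      rw [mul_div_assoc] at h ⊢
      linarith)
  refine ⟨s₀, hs₀, fun s hs' => ?_⟩
  have hp := Real.rpow_pos_of_pos hn0 s
  have := hs s hs' (((n : ℝ) ^ s)⁻¹ * (powerForm ha s n).re)
    (((re_powerForm_eq ha s E).mul_left _).congr_fun fun k => by
      rw [Real.div_rpow (E.eig_pos k).le hn0.le]
      ring)
  rwa [inv_mul_lt_iff₀ hp, mul_one] at this

/-- The form of small negative powers at `φ_n` lies below `n^{-s}`. -/
theorem exists_re_powerForm_neg_lt (hn : 0 < n) {C T X : ℝ} (hC : ∀ θ, a θ ≤ C)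
    (hT : HasSum (fun l : ℤ => (|(l : ℝ)| - l) * phaseWeight ha n l) T)
    (hX : HasSum (fun l : ℤ => (|(l : ℝ)| - l) ^ 2 * phaseWeight ha n l) X)
    (h : C * X < 2 * n * T) :
    ∃ s₀ > (0 : ℝ), ∀ s ∈ Ioo 0 s₀, (powerForm ha (-s) n).re < (n : ℝ) ^ (-s) := by
  obtain ⟨E⟩ := nonempty_eigenbasis_Λa_add_P₀ ha
  have hn0 : (0 : ℝ) < n := by exact_mod_cast hn
  have hA := inner_Λa_add_P₀ ha
  have hAG := Λa_add_P₀_invOp ha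
  have m0 := E.hasSum_norm_sq_inner_vec (φ ha n)
  rw [norm_φ_sq] at m0
  have m1 := E.hasSum_eig_mul hA (φ ha n)
  have m2 := E.hasSum_inv_eig_mul hA hAG (φ ha n)
  have m3 := E.hasSum_eig_sq_mul hA (φ ha n)
  have hq := norm_Λa_add_P₀_φ_sq_le ha hn hC hT hX
  rw [re_inner_φ_invOp_φ ha hn] at m2
  rw [re_inner_φ_Λa_add_P₀_φ ha hn hT] at m1 m2
  -- For negative powers the variable is n/λ. The two first moments exchange roles, and the mean of
  -- 1/x² becomes n⁻²‖Aφ_n‖².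
  obtain ⟨s₀, hs₀, hs⟩ := exists_forall_hasSum_rpow_lt_one (x := fun k => n / E.eig k)
    (δ := T / n) (q := ((n : ℝ) ^ 2)⁻¹ * ‖toL2 ((Λa ha + P₀ ha) (φ ha n))‖ ^ 2)
    (fun k => div_pos hn0 (E.eig_pos k)) (fun k => sq_nonneg _) m0
    (hasSum_of_eq_mul m2 (n : ℝ) (fun k => by ring) (by field_simp))
    (hasSum_of_eq_mul m1 (n : ℝ)⁻¹ (fun k => by simp only [inv_div]; ring) (by field_simp))
    (hasSum_of_eq_mul m3 ((n : ℝ) ^ 2)⁻¹ (fun k => by simp only [inv_div]; ring) rfl)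
    (by
      rw [inv_mul_lt_iff₀ (by positivity)]
      refine hq.trans_lt ?_
      have : (n : ℝ) ^ 2 * (1 + 4 * (T / n)) = n ^ 2 + 4 * n * T := by field_simp
      rw [this]
      linarith)
  refine ⟨s₀, hs₀, fun s hs' => ?_⟩
  have hp := Real.rpow_pos_of_pos hn0 s
  have := hs s hs' ((n : ℝ) ^ s * (powerForm ha (-s) n).re)
    (((re_powerForm_eq ha (-s) E).mul_left _).congr_fun fun k => by
      rw [Real.div_rpow hn0.le (E.eig_pos k).le, Real.rpow_neg (E.eig_pos k).le]
      ring)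
  rwa [← lt_inv_mul_iff₀ hp, mul_one, ← Real.rpow_neg hn0.le] at this

end

/-! ### The functions `1 / a = 1 + η cos(Nθ)` -/

theorem mode_apply_real (n : ℤ) (θ : ℝ) :
    mode n (θ : AddCircle (2 * π)) = Complex.exp (Complex.I * n * θ) := by
  rw [mode_apply, fourier_coe_apply]
  congr 1
  have : (π : ℂ) ≠ 0 := by exact_mod_cast Real.pi_ne_zero
  push_cast
  field_simp

theorem norm_toL2_one_sq : ‖toL2 1‖ ^ 2 = 2 * π := by
  rw [norm_toL2_sq]
  nth_rw 1 [← mode_zero]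
  rw [inner_mode, ← mode_zero, fourierCoeff_mode, if_pos rfl, mul_one, ← Complex.ofReal_ofNat,
    ← Complex.ofReal_mul, Complex.ofReal_re]

theorem two_pi_inv_mul_norm_toL2_sq_le {f : CInf ℂ} {C : ℝ}
    (hC : ∀ θ : ℝ, ‖f (θ : AddCircle (2 * π))‖ ≤ C) : (2 * π)⁻¹ * ‖toL2 f‖ ^ 2 ≤ C ^ 2 := by
  have h := norm_toL2_mul_sq_le (h := f) (C := C ^ 2) (fun θ => by
    induction θ using QuotientAddGroup.induction_on with
    | H θ => exact pow_le_pow_left₀ (norm_nonneg _) (hC θ) 2) 1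
  rw [mul_one, norm_toL2_one_sq] at h
  rw [inv_mul_le_iff₀ Real.two_pi_pos]
  linarith

theorem hasSum_norm_fourierCoeff_sq (f : CInf ℂ) :
    HasSum (fun l => ‖fourierCoeff f l‖ ^ 2) ((2 * π)⁻¹ * ‖toL2 f‖ ^ 2) := by
  have h := hasSum_mul_mul_norm_sq (f := f) (g := f) (h := f) (σ := fun _ => 1) (τ := fun _ => 1)
    (fun l => by rw [Complex.ofReal_one, one_mul]) (fun l => by rw [Complex.ofReal_one, one_mul])
  rw [norm_toL2_sq]
  simpa only [one_mul] using h

theorem hasSum_sq_mul_norm_fourierCoeff_sq (f : CInf ℂ) :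
    HasSum (fun l : ℤ => (l : ℝ) ^ 2 * ‖fourierCoeff f l‖ ^ 2)
      ((2 * π)⁻¹ * ‖toL2 (dθ f)‖ ^ 2) := by
  refine (hasSum_norm_fourierCoeff_sq (dθ f)).congr_fun fun l => ?_
  rw [fourierCoeff_dθ, norm_mul, norm_mul, Complex.norm_I, one_mul, Complex.norm_intCast, mul_pow,
    sq_abs]

section

variable (ha : IsNormalized a) {η : ℝ} {n N : ℕ}

/-- The remainder in the expansion of `e^{inΦ}`, `Φ = θ + ε sin(Nθ)`, to first order in `ε`. -/
def phaseRem (ha : IsNormalized a) (ε : ℝ) (n N : ℕ) : CInf ℂ :=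
  phase ha n - mode n - ((n * ε / 2 : ℝ) : ℂ) • (mode (n + N) - mode (n - N))

theorem integral_inv_eq (hN : 0 < N)
    (haη : ∀ θ : ℝ, (a (θ : AddCircle (2 * π)))⁻¹ = 1 + η * Real.cos (N * θ)) (θ : ℝ) :
    ∫ s : ℝ in 0..θ, (a (s : AddCircle (2 * π)))⁻¹ = θ + η / N * Real.sin (N * θ) := by
  have hN' : (N : ℝ) ≠ 0 := by exact_mod_cast hN.ne'
  have hd : ∀ x : ℝ, HasDerivAt (fun x : ℝ => x + η / N * Real.sin (N * x))
      (1 + η * Real.cos (N * x)) x := fun x => by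
    have h := (hasDerivAt_id x).add
      ((((hasDerivAt_id x).const_mul (N : ℝ)).sin).const_mul (η / N))
    refine h.congr_deriv ?_
    simp only [id]
    field_simp
  rw [funext haη, intervalIntegral.integral_eq_sub_of_hasDerivAt (fun x _ => hd x)
    (Continuous.intervalIntegrable (by fun_prop) _ _)]
  simp

/-- With y = nε sin(Nθ), the two exponentials removed are exactly the linear term i y e^{inθ}, which
leaves the quadratic Taylor remainder of e^{iy}. -/
theorem phaseRem_apply (hN : 0 < N)
    (haη : ∀ θ : ℝ, (a (θ : AddCircle (2 * π)))⁻¹ = 1 + η * Real.cos (N * θ)) (θ : ℝ) :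
    phaseRem ha (η / N) n N (θ : AddCircle (2 * π)) = Complex.exp (Complex.I * n * θ) *
      (Complex.exp (Complex.I * ((n * (η / N) * Real.sin (N * θ) : ℝ) : ℂ)) - 1 -
        Complex.I * ((n * (η / N) * Real.sin (N * θ) : ℝ) : ℂ)) := by
  rw [phaseRem, CInf.sub_apply, CInf.sub_apply, CInf.smul_apply, CInf.sub_apply, phase_apply,
    mode_apply_real, mode_apply_real, mode_apply_real, integral_inv_eq hN haη]
  have h1 : Complex.exp (Complex.I * ((n : ℤ) : ℂ) * ((θ + η / N * Real.sin (N * θ) : ℝ) : ℂ)) =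
      Complex.exp (Complex.I * n * θ) *
        Complex.exp (Complex.I * ((n * (η / N) * Real.sin (N * θ) : ℝ) : ℂ)) := by
    rw [← Complex.exp_add]
    congr 1
    push_cast
    ring
  have h2 : Complex.exp (Complex.I * ((n + N : ℤ) : ℂ) * θ) =
      Complex.exp (Complex.I * n * θ) * Complex.exp (N * θ * Complex.I) := by
    rw [← Complex.exp_add]
    congr 1
    push_cast
    ring
  have h3 : Complex.exp (Complex.I * ((n - N : ℤ) : ℂ) * θ) =
      Complex.exp (Complex.I * n * θ) * Complex.exp (-(N * θ) * Complex.I) := by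
    rw [← Complex.exp_add]
    congr 1
    push_cast
    ring
  rw [h1, h2, h3]
  have h4 : Complex.I * ((n * (η / N) * Real.sin (N * θ) : ℝ) : ℂ) = ((n * (η / N) / 2 : ℝ) : ℂ) *
      (Complex.exp (N * θ * Complex.I) - Complex.exp (-(N * θ) * Complex.I)) := by
    push_cast
    rw [Complex.sin]
    linear_combination (n * (η / N) / 2 * (Complex.exp (-(N * θ) * Complex.I) -
      Complex.exp (N * θ * Complex.I))) * Complex.I_mul_I
  rw [show (Complex.exp (Complex.I * ((n : ℤ) : ℂ) * θ)) = Complex.exp (Complex.I * n * θ) by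
    push_cast; rfl]
  rw [h4]
  ring

theorem norm_exp_I_mul_sub_one_sub_le {y : ℝ} (hy : |y| ≤ 1) :
    ‖Complex.exp (Complex.I * y) - 1 - Complex.I * y‖ ≤ y ^ 2 := by
  have h := Complex.norm_exp_sub_one_sub_id_le (x := Complex.I * y) (by
    rwa [norm_mul, Complex.norm_I, one_mul, Complex.norm_real])
  rwa [norm_mul, Complex.norm_I, one_mul, Complex.norm_real, Real.norm_eq_abs, sq_abs] at h

theorem norm_exp_I_mul_natCast_mul (n : ℕ) (θ : ℝ) : ‖Complex.exp (Complex.I * n * θ)‖ = 1 := by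
  rw [show Complex.I * n * θ = ((n * θ : ℝ) : ℂ) * Complex.I by push_cast; ring,
    Complex.norm_exp_ofReal_mul_I]

theorem abs_mul_sin_le {x : ℝ} (hx : 0 ≤ x) (y : ℝ) : |x * Real.sin y| ≤ x := by
  rw [abs_mul, abs_of_nonneg hx]
  exact mul_le_of_le_one_right hx (Real.abs_sin_le_one y)

theorem norm_phaseRem_le (hN : 0 < N) (hη : 0 ≤ η) (h1 : n * (η / N) ≤ 1)
    (haη : ∀ θ : ℝ, (a (θ : AddCircle (2 * π)))⁻¹ = 1 + η * Real.cos (N * θ)) (θ : ℝ) :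
    ‖phaseRem ha (η / N) n N (θ : AddCircle (2 * π))‖ ≤ (n * (η / N)) ^ 2 := by
  have h0 : 0 ≤ n * (η / N) := by positivity
  have hy := abs_mul_sin_le h0 (N * θ)
  rw [phaseRem_apply ha hN haη, norm_mul, norm_exp_I_mul_natCast_mul, one_mul]
  refine (norm_exp_I_mul_sub_one_sub_le (hy.trans h1)).trans ?_
  rw [← sq_abs]
  exact pow_le_pow_left₀ (abs_nonneg _) hy 2

/-- The product rule gives in e^{inθ}(e^{iy} - 1 - iy) + i y' e^{inθ}(e^{iy} - 1). With q = nε,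
where ε = η/N, the two terms are at most nq² and qN · q. -/
theorem norm_dθ_phaseRem_le (hN : 0 < N) (hη : 0 ≤ η) (h1 : n * (η / N) ≤ 1)
    (haη : ∀ θ : ℝ, (a (θ : AddCircle (2 * π)))⁻¹ = 1 + η * Real.cos (N * θ)) (θ : ℝ) :
    ‖dθ (phaseRem ha (η / N) n N) (θ : AddCircle (2 * π))‖ ≤
      (n * (η / N)) ^ 2 * (n + N) := by
  have h0 : 0 ≤ n * (η / N) := by positivity
  have hy := abs_mul_sin_le h0 (N * θ)
  set q := n * (η / N) with hq
  have hds : HasDerivAt (fun θ : ℝ => q * Real.sin (N * θ)) (q * N * Real.cos (N * θ)) θ := by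
    have h := (((hasDerivAt_id θ).const_mul (N : ℝ)).sin).const_mul q
    refine h.congr_deriv ?_
    simp only [id]
    ring
  have he : HasDerivAt (fun θ : ℝ => Complex.exp (Complex.I * n * θ))
      (Complex.exp (Complex.I * n * θ) * (Complex.I * n)) θ := by
    have h := ((hasDerivAt_id θ).ofReal_comp.const_mul (Complex.I * n)).cexp
    simpa using h
  have hi := hds.ofReal_comp.const_mul Complex.I
  have hd := he.mul ((hi.cexp.sub_const 1).sub hi)
  have heq : deriv (fun θ : ℝ => phaseRem ha (η / N) n N (θ : AddCircle (2 * π))) θ =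
      Complex.exp (Complex.I * n * θ) * (Complex.I * n) *
        (Complex.exp (Complex.I * ((q * Real.sin (N * θ) : ℝ) : ℂ)) - 1 -
          Complex.I * ((q * Real.sin (N * θ) : ℝ) : ℂ)) +
      Complex.exp (Complex.I * n * θ) *
        (Complex.exp (Complex.I * ((q * Real.sin (N * θ) : ℝ) : ℂ)) *
          (Complex.I * ((q * N * Real.cos (N * θ) : ℝ) : ℂ)) -
            Complex.I * ((q * N * Real.cos (N * θ) : ℝ) : ℂ)) := by
    rw [funext (phaseRem_apply ha hN haη)]
    exact hd.deriv
  rw [dθ_apply, heq]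
  set e := Complex.exp (Complex.I * n * θ) with hedef
  have hen : ‖e‖ = 1 := norm_exp_I_mul_natCast_mul n θ
  set y := q * Real.sin (N * θ) with hydef
  have b1 : ‖Complex.exp (Complex.I * y) - 1 - Complex.I * y‖ ≤ q ^ 2 :=
    (norm_exp_I_mul_sub_one_sub_le (hy.trans h1)).trans (by
      rw [← sq_abs]
      exact pow_le_pow_left₀ (abs_nonneg _) hy 2)
  have b2 : ‖Complex.exp (Complex.I * y) - 1‖ ≤ q := by
    have := Real.norm_exp_I_mul_ofReal_sub_one_le (x := y)
    exact this.trans hy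
  have b3 : ‖((q * N * Real.cos (N * θ) : ℝ) : ℂ)‖ ≤ q * N := by
    rw [Complex.norm_real, Real.norm_eq_abs, abs_mul, abs_of_nonneg (by positivity)]
    exact mul_le_of_le_one_right (by positivity) (Real.abs_cos_le_one _)
  refine (norm_add_le _ _).trans ?_
  have t1 : ‖e * (Complex.I * n) * (Complex.exp (Complex.I * y) - 1 - Complex.I * y)‖ ≤
      n * q ^ 2 := by
    rw [norm_mul, norm_mul, norm_mul, hen, Complex.norm_I, one_mul, one_mul, Complex.norm_natCast]
    exact mul_le_mul_of_nonneg_left b1 (Nat.cast_nonneg n)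
  have t2 : ‖e * (Complex.exp (Complex.I * y) *
      (Complex.I * ((q * N * Real.cos (N * θ) : ℝ) : ℂ)) -
        Complex.I * ((q * N * Real.cos (N * θ) : ℝ) : ℂ))‖ ≤ q * (q * N) := by
    rw [← sub_one_mul, norm_mul, norm_mul, norm_mul, hen, Complex.norm_I, one_mul, one_mul]
    exact mul_le_mul b2 b3 (norm_nonneg _) h0
  refine (add_le_add t1 t2).trans_eq ?_
  ring

theorem fourierCoeff_phase_eq (ε : ℝ) (l : ℤ) : fourierCoeff (phase ha n) l =
    fourierCoeff (phaseRem ha ε n N) l + (if l = n then 1 else 0) +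
      ((n * ε / 2 : ℝ) : ℂ) * ((if l = n + N then 1 else 0) - (if l = n - N then 1 else 0)) := by
  rw [phaseRem, fourierCoeff_sub, fourierCoeff_sub, fourierCoeff_smul, fourierCoeff_sub,
    fourierCoeff_mode, fourierCoeff_mode, fourierCoeff_mode]
  ring

/-- The other explicit frequencies n and n + N are positive. -/
theorem fourierCoeff_phase_of_nonpos (hn : 0 < n) (ε : ℝ) {l : ℤ} (hl : l ≤ 0)
    (hne : l ≠ n - N) : fourierCoeff (phase ha n) l = fourierCoeff (phaseRem ha ε n N) l := by
  rw [fourierCoeff_phase_eq ha (N := N) ε, if_neg (by lia), if_neg (by lia), if_neg hne]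
  simp

/-- The dominant negative Fourier coefficient of `e^{inΦ}`, together with bounds for the others. -/
theorem phaseWeight_bounds (hn : 0 < n) (hN : 0 < N) (hη : 0 ≤ η) (h1 : n * (η / N) ≤ 1 / 4)
    (haη : ∀ θ : ℝ, (a (θ : AddCircle (2 * π)))⁻¹ = 1 + η * Real.cos (N * θ)) :
    ∃ ρ : ℤ → ℝ, ∃ Y₀ Y₁ : ℝ, (∀ l, 0 ≤ ρ l) ∧
      (∀ l : ℤ, l ≤ 0 → l ≠ n - N → phaseWeight ha n l = ρ l) ∧
      (n * (η / N)) ^ 2 / 16 ≤ phaseWeight ha n (n - N) ∧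
      HasSum ρ Y₀ ∧ Y₀ ≤ ((n * (η / N)) ^ 2 * (n + N)) ^ 2 ∧
      HasSum (fun l : ℤ => (l : ℝ) ^ 2 * ρ l) Y₁ ∧ Y₁ ≤ ((n * (η / N)) ^ 2 * (n + N)) ^ 2 := by
  set q := n * (η / N) with hq
  have hq0 : 0 ≤ q := by positivity
  have hn1 : (1 : ℝ) ≤ n := by exact_mod_cast hn
  have hN1 : (1 : ℝ) ≤ N := by exact_mod_cast hN
  set R := phaseRem ha (η / N) n N with hR
  have hY0 := two_pi_inv_mul_norm_toL2_sq_le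
    (norm_phaseRem_le ha hN hη (h1.trans (by norm_num)) haη)
  have hY1 := two_pi_inv_mul_norm_toL2_sq_le
    (norm_dθ_phaseRem_le ha hN hη (h1.trans (by norm_num)) haη)
  have hs := hasSum_norm_fourierCoeff_sq R
  refine ⟨fun l => ‖fourierCoeff R l‖ ^ 2, _, _, fun l => sq_nonneg _, fun l hl hne => ?_, ?_,
    hs, hY0.trans ?_, hasSum_sq_mul_norm_fourierCoeff_sq R, hY1⟩
  · rw [phaseWeight, fourierCoeff_phase_of_nonpos ha hn (η / N) hl hne]
  · have hc : ‖fourierCoeff R ((n : ℤ) - N)‖ ≤ q ^ 2 := by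
      refine le_of_sq_le_sq ?_ (by positivity)
      exact (hs.summable.le_tsum _ fun j _ => sq_nonneg _).trans (hs.tsum_eq.le.trans hY0)
    have h2 : fourierCoeff (phase ha n) ((n : ℤ) - N) =
        fourierCoeff R ((n : ℤ) - N) - ((q / 2 : ℝ) : ℂ) := by
      rw [fourierCoeff_phase_eq ha (N := N) (η / N), if_neg (by lia), if_neg (by lia), if_pos rfl]
      rw [← hq, ← hR]
      ring
    -- The linear term contributes q/2 and the remainder at most q² ≤ q/4.
    have h3 : q / 4 ≤ ‖fourierCoeff (phase ha n) ((n : ℤ) - N)‖ := by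
      have h4 := norm_sub_norm_le ((q / 2 : ℝ) : ℂ) (fourierCoeff R ((n : ℤ) - N))
      rw [norm_sub_rev, ← h2, Complex.norm_real, Real.norm_eq_abs,
        abs_of_nonneg (by positivity)] at h4
      nlinarith
    rw [phaseWeight]
    have h5 := pow_le_pow_left₀ (by positivity) h3 2
    linarith [show (q / 4) ^ 2 = q ^ 2 / 16 by ring]
  · refine pow_le_pow_left₀ (by positivity) ?_ 2
    exact le_mul_of_one_le_right (by positivity) (by linarith)

end

/-! ### Strict inequalities for 1/a = 1 + η cos((2m+1)θ) -/

section

variable (ha : IsNormalized a) {η : ℝ}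

theorem hasSum_abs_sub_mul_phaseWeight {n : ℕ} (hn : 0 < n) :
    HasSum (fun l : ℤ => (|(l : ℝ)| - l) * phaseWeight ha n l)
      ((⟪toL2 (φ ha n), toL2 ((Λa ha + P₀ ha) (φ ha n))⟫_ℂ).re - n) :=
  ((hasSum_abs_mul_phaseWeight ha hn).sub (hasSum_mul_phaseWeight ha)).congr_fun fun l => by ring

theorem phaseWeight_nonneg (n : ℕ) (l : ℤ) : 0 ≤ phaseWeight ha n l := sq_nonneg _

/-- All terms of T are nonnegative; the single frequency n - N ≤ 0 contributes 2(N - n) times its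
weight. -/
theorem two_mul_phaseWeight_le {n N : ℕ} {T : ℝ} (hnN : n ≤ N)
    (hT : HasSum (fun l : ℤ => (|(l : ℝ)| - l) * phaseWeight ha n l) T) :
    2 * ((N : ℝ) - n) * phaseWeight ha n (n - N) ≤ T := by
  have h := le_hasSum hT ((n : ℤ) - N) fun l _ =>
    mul_nonneg (sub_nonneg.2 (le_abs_self _)) (phaseWeight_nonneg ha n l)
  have hnN' : (n : ℝ) ≤ N := by exact_mod_cast hnN
  refine le_trans (le_of_eq ?_) h
  push_cast
  rw [abs_of_nonpos (by linarith)]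
  ring

theorem inv_le_one_add (hη : 0 ≤ η) {N : ℕ}
    (haη : ∀ θ : ℝ, (a (θ : AddCircle (2 * π)))⁻¹ = 1 + η * Real.cos (N * θ)) (θ) :
    (a θ)⁻¹ ≤ 1 + η := by
  induction θ using QuotientAddGroup.induction_on with
  | H θ =>
    refine (haη θ).trans_le ?_
    have := mul_le_mul_of_nonneg_left (Real.cos_le_one (N * θ)) hη
    linarith

theorem le_inv_one_sub (hη : 0 ≤ η) (hη1 : η < 1) {N : ℕ}
    (haη : ∀ θ : ℝ, (a (θ : AddCircle (2 * π)))⁻¹ = 1 + η * Real.cos (N * θ)) (θ) :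
    a θ ≤ (1 - η)⁻¹ := by
  induction θ using QuotientAddGroup.induction_on with
  | H θ =>
    rw [← inv_inv (a _)]
    refine inv_anti₀ (by linarith) (le_of_le_of_eq ?_ (haη θ).symm)
    have := mul_le_mul_of_nonneg_left (Real.neg_one_le_cos (N * θ)) hη
    linarith

/-- The dominant frequency m - N = -(m+1) gives T ≥ 2(m+1)w against an error sum close to 4w, and
(m+1)/m > 1 beats the factor 1 + η and the remainder. -/
theorem re_powerForm_lt_of_cos {m : ℕ} (hm : 0 < m) (hη : 0 < η) (h : η * (24 * (m + 1) ^ 3) < 1)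
    (haη : ∀ θ : ℝ, (a (θ : AddCircle (2 * π)))⁻¹ = 1 + η * Real.cos ((2 * m + 1 : ℕ) * θ)) :
    ∃ s₀ > (0 : ℝ), ∀ s ∈ Ioo 0 s₀, (powerForm ha s m).re < (m : ℝ) ^ s := by
  set N := 2 * m + 1 with hN
  have hm1 : (1 : ℝ) ≤ m := by exact_mod_cast hm
  have hNr : (N : ℝ) = 2 * m + 1 := by rw [hN]; push_cast; ring
  have hqη : m * (η / N) ≤ η / 2 := by
    rw [hNr, ← mul_div_assoc, div_le_iff₀ (by positivity)]
    nlinarith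
  have hq0 : 0 < m * (η / N) := by positivity
  have hcub : (m + 1 : ℝ) ^ 3 = m ^ 3 + 3 * m ^ 2 + 3 * m + 1 := by ring
  have hmm : (0 : ℝ) ≤ m ^ 2 := by positivity
  have hmmm : (0 : ℝ) ≤ m ^ 3 := by positivity
  have e0 : η * m ≤ 1 / 24 := by nlinarith
  have e1 : η ≤ 1 / 24 := by nlinarith
  obtain ⟨ρ, Y₀, Y₁, hρ, hne, hmain, hY₀, hY₀', -, -⟩ :=
    phaseWeight_bounds ha (N := N) hm (by lia) hη.le (by linarith) haη
  set q := m * (η / N) with hq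
  set w := phaseWeight ha m (m - N) with hw
  have hT := hasSum_abs_sub_mul_phaseWeight ha hm
  set T := (⟪toL2 (φ ha m), toL2 ((Λa ha + P₀ ha) (φ ha m))⟫_ℂ).re - m
  have hTw := two_mul_phaseWeight_le ha (N := N) (by lia) hT
  -- The factor (1 - sgn l)² is 0 for l > 0, 1 at l = 0 and 4 for l < 0.
  have hbd : ∀ l : ℤ, (1 - (l.sign : ℝ)) ^ 2 * phaseWeight ha m l ≤
      (if l = m - N then 4 * w else 0) + 4 * ρ l := by
    intro l
    rcases lt_or_ge 0 l with hl | hl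
    · rw [Int.sign_eq_one_of_pos hl, if_neg (by lia)]
      have := hρ l
      norm_num
      exact this
    · have hs : (1 - (l.sign : ℝ)) ^ 2 ≤ 4 := by
        rcases hl.eq_or_lt with rfl | hl
        · norm_num
        · rw [Int.sign_eq_neg_one_of_neg hl]
          norm_num
      have h4 := mul_le_mul_of_nonneg_right hs (phaseWeight_nonneg ha m l)
      split_ifs with hk
      · rw [hk] at h4 ⊢
        have := hρ (m - N)
        linarith
      · rw [← hne l hl hk, zero_add]
        exact h4
  have hsb : HasSum (fun l : ℤ => (if l = m - N then 4 * w else 0) + 4 * ρ l) (4 * w + 4 * Y₀) :=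
    (hasSum_ite_eq _ _).add (hY₀.mul_left 4)
  have hX : Summable fun l : ℤ => (1 - (l.sign : ℝ)) ^ 2 * phaseWeight ha m l :=
    Summable.of_nonneg_of_le (fun l => mul_nonneg (sq_nonneg _) (phaseWeight_nonneg ha m l)) hbd
      hsb.summable
  have hXle := hasSum_le hbd hX.hasSum hsb
  refine exists_re_powerForm_lt ha hm (inv_le_one_add hη.le haη) hT hX.hasSum ?_
  rw [lt_div_iff₀ (by positivity)]
  have hP : 8 * m * (m + N) * q < 1 := by
    have h1 : 8 * m * (m + N) * q ≤ 8 * m * (m + N) * (η / 2) :=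
      mul_le_mul_of_nonneg_left hqη (by positivity)
    refine h1.trans_lt (lt_of_le_of_lt ?_ h)
    rw [hNr, hcub]
    nlinarith
  -- This puts m times the remainder below q²/64, a quarter of the guaranteed lower bound q²/16 for
  -- w.
  have hP2 : 64 * m * (q * (m + N)) ^ 2 < 1 := by
    have h1 : (8 * m * (m + N) * q) ^ 2 < 1 := by
      rw [sq_lt_one_iff₀ (by positivity)]
      exact hP
    have h2 : (8 * m * (m + N) * q) ^ 2 = m * (64 * m * (q * (m + N)) ^ 2) := by ring
    rw [h2] at h1
    have h3 : 0 ≤ 64 * m * (q * (m + N)) ^ 2 := by positivity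
    nlinarith
  have hA : (1 + η) * ∑' l : ℤ, (1 - (l.sign : ℝ)) ^ 2 * phaseWeight ha m l ≤
      (1 + η) * (4 * w + 4 * (q ^ 2 * (m + N)) ^ 2) :=
    mul_le_mul_of_nonneg_left (by linarith) (by linarith)
  have hB : 2 * (m + 1) * w ≤ T := by
    rw [hNr] at hTw
    linarith [show 2 * (2 * m + 1 - m : ℝ) * w = 2 * (m + 1) * w by ring]
  have hq2 : 0 < q ^ 2 := by positivity
  have hC : m * (q ^ 2 * (m + N)) ^ 2 < q ^ 2 / 64 := by
    have : m * (q ^ 2 * (m + N)) ^ 2 = q ^ 2 / 64 * (64 * m * (q * (m + N)) ^ 2) := by ring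
    rw [this]
    exact mul_lt_of_lt_one_right (by positivity) hP2
  -- This is the target (1+η)m(w + remainder) < (m+1)w with the multiples of w collected on the
  -- right.
  have hD : (1 + η) * (m * (q ^ 2 * (m + N)) ^ 2) < (1 - η * m) * w := by
    have h1 : (1 + η) * (m * (q ^ 2 * (m + N)) ^ 2) < (1 + η) * (q ^ 2 / 64) :=
      mul_lt_mul_of_pos_left hC (by linarith)
    have h2 : (1 - 1 / 24) * (q ^ 2 / 16) ≤ (1 - η * m) * w :=
      mul_le_mul (by linarith) hmain (by positivity) (by linarith)
    nlinarith
  calc _ ≤ (1 + η) * (4 * w + 4 * (q ^ 2 * (m + N)) ^ 2) * m :=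
        mul_le_mul_of_nonneg_right hA (by positivity)
    _ < 2 * (2 * (m + 1) * w) := by nlinarith
    _ ≤ 2 * T := by linarith

/-- For n = m + 1 the dominant frequency is n - N = -m. Its share of the error is 4m²w, against 2nT
≥ 4m(m+1)w; here the reflected frequency is smaller than n in modulus, the reverse of the case of
positive powers. -/
theorem re_powerForm_neg_lt_of_cos {m : ℕ} (hm : 0 < m) (hη : 0 < η)
    (h : η * (24 * (m + 1) ^ 3) < 1)
    (haη : ∀ θ : ℝ, (a (θ : AddCircle (2 * π)))⁻¹ = 1 + η * Real.cos ((2 * m + 1 : ℕ) * θ)) :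
    ∃ s₀ > (0 : ℝ), ∀ s ∈ Ioo 0 s₀,
      (powerForm ha (-s) (m + 1 : ℕ)).re < ((m + 1 : ℕ) : ℝ) ^ (-s) := by
  set N := 2 * m + 1 with hN
  set n := m + 1 with hn
  have hm1 : (1 : ℝ) ≤ m := by exact_mod_cast hm
  have hNr : (N : ℝ) = 2 * m + 1 := by rw [hN]; push_cast; ring
  have hnr : (n : ℝ) = m + 1 := by rw [hn]; push_cast; ring
  have hqη : n * (η / N) ≤ η := by
    rw [hNr, hnr, ← mul_div_assoc, div_le_iff₀ (by positivity)]
    nlinarith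
  have hq0 : 0 < n * (η / N) := by rw [hnr, hNr]; positivity
  have hcub : (m + 1 : ℝ) ^ 3 = m ^ 3 + 3 * m ^ 2 + 3 * m + 1 := by ring
  have hmm : (0 : ℝ) ≤ m ^ 2 := by positivity
  have hmmm : (0 : ℝ) ≤ m ^ 3 := by positivity
  have e0 : η * (m + 1) ≤ 1 / 24 := by nlinarith
  have e1 : η ≤ 1 / 24 := by nlinarith
  obtain ⟨ρ, Y₀, Y₁, hρ, hne, hmain, -, -, hY₁, hY₁'⟩ :=
    phaseWeight_bounds ha (n := n) (N := N) (by lia) (by lia) hη.le (by linarith) haη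
  set q := n * (η / N) with hq
  set w := phaseWeight ha n (n - N) with hw
  have hT := hasSum_abs_sub_mul_phaseWeight ha (n := n) (by lia)
  set T := (⟪toL2 (φ ha n), toL2 ((Λa ha + P₀ ha) (φ ha n))⟫_ℂ).re - n
  have hTw := two_mul_phaseWeight_le ha (N := N) (by lia) hT
  -- For l ≤ 0 the factor is 4l², so the remainder must be summable against l²; this is where the
  -- bound on its derivative enters.
  have hbd : ∀ l : ℤ, (|(l : ℝ)| - l) ^ 2 * phaseWeight ha n l ≤
      (if l = n - N then 4 * (m : ℝ) ^ 2 * w else 0) + 4 * ((l : ℝ) ^ 2 * ρ l) := by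
    intro l
    have h0 : 0 ≤ (l : ℝ) ^ 2 * ρ l := mul_nonneg (sq_nonneg _) (hρ l)
    rcases lt_or_ge 0 l with hl | hl
    · rw [if_neg (by lia), abs_of_pos (by exact_mod_cast hl)]
      linarith [show ((l : ℝ) - l) ^ 2 * phaseWeight ha n l = 0 by ring]
    · rw [abs_of_nonpos (by exact_mod_cast hl)]
      split_ifs with hk
      · have hl' : (l : ℝ) = -m := by
          rw [hk]
          push_cast
          rw [hnr, hNr]
          ring
        rw [hl'] at h0 ⊢
        rw [hk] at h0 ⊢
        rw [← hw]
        linarith [show (-(-(m : ℝ)) - -m) ^ 2 * w = 4 * (m : ℝ) ^ 2 * w by ring]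
      · rw [← hne l hl hk]
        exact le_of_eq (by ring)
  have hsb : HasSum (fun l : ℤ => (if l = n - N then 4 * (m : ℝ) ^ 2 * w else 0) +
      4 * ((l : ℝ) ^ 2 * ρ l)) (4 * (m : ℝ) ^ 2 * w + 4 * Y₁) :=
    (hasSum_ite_eq _ _).add (hY₁.mul_left 4)
  have hX : Summable fun l : ℤ => (|(l : ℝ)| - l) ^ 2 * phaseWeight ha n l :=
    Summable.of_nonneg_of_le (fun l => mul_nonneg (sq_nonneg _) (phaseWeight_nonneg ha n l)) hbd
      hsb.summable
  have hXle := hasSum_le hbd hX.hasSum hsb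
  refine exists_re_powerForm_neg_lt ha (by lia) (le_inv_one_sub hη.le (by linarith) haη) hT
    hX.hasSum ?_
  rw [inv_mul_lt_iff₀ (by linarith)]
  have hP : 8 * (n + N) * q < 1 := by
    have h1 : 8 * (n + N) * q ≤ 8 * (n + N) * η := mul_le_mul_of_nonneg_left hqη (by positivity)
    refine h1.trans_lt (lt_of_le_of_lt ?_ h)
    rw [hNr, hnr, hcub]
    nlinarith
  have hP2 : 64 * (q * (n + N)) ^ 2 < 1 := by
    have h1 : (8 * (n + N) * q) ^ 2 < 1 := by
      rw [sq_lt_one_iff₀ (by positivity)]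
      exact hP
    linarith [show (8 * (n + N) * q) ^ 2 = 64 * (q * (n + N)) ^ 2 by ring]
  have hq2 : 0 < q ^ 2 := by positivity
  have hC : (q ^ 2 * (n + N)) ^ 2 < q ^ 2 / 64 := by
    have : (q ^ 2 * (n + N)) ^ 2 = q ^ 2 / 64 * (64 * (q * (n + N)) ^ 2) := by ring
    rw [this]
    exact mul_lt_of_lt_one_right (by positivity) hP2
  have hB : 2 * m * w ≤ T := by
    rw [hNr, hnr] at hTw
    linarith [show 2 * (2 * m + 1 - (m + 1) : ℝ) * w = 2 * m * w by ring]
  have hw0 : 0 < w := lt_of_lt_of_le (by positivity) hmain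
  -- The surplus m(m+1)(1-η)w - m²w equals mw(1 - η(m+1)).
  have hD : (q ^ 2 * (n + N)) ^ 2 < m * w * (1 - η * (m + 1)) := by
    have h2 : 1 * (q ^ 2 / 16) ≤ m * w := mul_le_mul hm1 hmain (by positivity) (by positivity)
    have h3 : m * w * (1 - 1 / 24) ≤ m * w * (1 - η * (m + 1)) :=
      mul_le_mul_of_nonneg_left (by linarith) (by positivity)
    nlinarith
  have hE : (1 - η) * (2 * n * (2 * m * w)) ≤ (1 - η) * (2 * n * T) :=
    mul_le_mul_of_nonneg_left (mul_le_mul_of_nonneg_left hB (by positivity)) (by linarith)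
  refine lt_of_lt_of_le ?_ hE
  rw [hnr] at hD hY₁' ⊢
  linarith [show (1 - η) * (2 * (m + 1) * (2 * m * w)) =
    4 * (m : ℝ) ^ 2 * w + 4 * (m * w * (1 - η * (m + 1))) by ring]

end

/-! ### Convergence in `C^∞` -/

/-- The derivative in θ is the directional derivative along (0, 1) of a jointly smooth function, so
joint smoothness passes through the induction. -/
theorem continuous_iteratedDeriv_of_contDiff (k : ℕ) {F : ℝ → ℝ → ℝ}
    (hF : ContDiff ℝ ∞ (Function.uncurry F)) :
    Continuous (Function.uncurry fun t => iteratedDeriv k (F t)) := by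
  induction k generalizing F with
  | zero => simpa only [iteratedDeriv_zero] using hF.continuous
  | succ k ih =>
    have hd : ∀ t, deriv (F t) = fun θ => fderiv ℝ (Function.uncurry F) (t, θ) (0, 1) := by
      intro t
      funext θ
      have h1 := ((hF.differentiable (by simp)) (t, θ)).hasFDerivAt
      exact (h1.comp_hasDerivAt θ ((hasDerivAt_const θ t).prodMk (hasDerivAt_id θ))).deriv
    simp only [iteratedDeriv_succ', hd]
    refine ih ?_
    exact (hF.fderiv_right (m := ∞) (by simp)).clm_apply contDiff_const

theorem periodic_iteratedDeriv {f : ℝ → ℝ} {c : ℝ} (hf : Function.Periodic f c) (k : ℕ) :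
    Function.Periodic (iteratedDeriv k f) c := by
  induction k generalizing f with
  | zero => simpa only [iteratedDeriv_zero] using hf
  | succ k ih =>
    rw [iteratedDeriv_succ']
    refine ih fun x => ?_
    rw [← deriv_comp_add_const]
    exact congrArg (deriv · x) (funext hf)

/-- A jointly smooth family of periodic functions is continuous into `C^∞`. -/
theorem continuous_family_CInf {b : ℝ → CInf ℝ}
    (hb : ContDiff ℝ ∞ (Function.uncurry fun (t θ : ℝ) => b t (θ : AddCircle (2 * π)))) :
    Continuous b := by
  refine continuous_iInf_rng.2 fun k => continuous_induced_rng.2 ?_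
  rw [continuous_iff_continuousAt]
  intro t₀
  refine UniformFun.tendsto_iff_tendstoUniformly.2 ?_
  have hc := continuous_iteratedDeriv_of_contDiff k hb
  -- Joint continuity gives uniform convergence only over a compact set; periodicity then extends it
  -- from [0, 2π] to the whole line.
  have hc' : Continuous (Function.uncurry fun (t : ℝ) (θ : Icc 0 (2 * π)) =>
      iteratedDeriv k (fun θ : ℝ => b t (θ : AddCircle (2 * π))) θ) :=
    hc.comp (continuous_fst.prodMk (continuous_subtype_val.comp continuous_snd))
  have hu := Continuous.tendstoUniformly (fun (t : ℝ) (θ : Icc 0 (2 * π)) =>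
    iteratedDeriv k (fun θ : ℝ => b t (θ : AddCircle (2 * π))) θ) hc' t₀
  rw [Metric.tendstoUniformly_iff] at hu ⊢
  intro ε hε
  filter_upwards [hu ε hε] with t ht θ
  have hp : ∀ t, Function.Periodic
      (iteratedDeriv k fun θ : ℝ => b t (θ : AddCircle (2 * π))) (2 * π) := fun t =>
    periodic_iteratedDeriv (fun θ => by simp only [AddCircle.coe_add_period]) k
  have hpair : Function.Periodic (fun θ : ℝ =>
      (iteratedDeriv k (fun θ : ℝ => b t₀ (θ : AddCircle (2 * π))) θ,
        iteratedDeriv k (fun θ : ℝ => b t (θ : AddCircle (2 * π))) θ)) (2 * π) := fun x =>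
    Prod.ext (hp t₀ x) (hp t x)
  obtain ⟨y, hy, hxy⟩ := hpair.exists_mem_Ico₀ Real.two_pi_pos θ
  have h1 := ht ⟨y, hy.1, hy.2.le⟩
  have h2 := congrArg Prod.fst hxy
  have h3 := congrArg Prod.snd hxy
  simp only at h2 h3 h1
  change dist (iteratedDeriv k (fun θ : ℝ => b t₀ (θ : AddCircle (2 * π))) θ)
    (iteratedDeriv k (fun θ : ℝ => b t (θ : AddCircle (2 * π))) θ) < ε
  rw [h2, h3]
  exact h1

/-! ### A curve of normalized functions through the constant 1 -/

/-- The amplitude (sin t)/2 stays within 1/2 for every real t, so the family is smooth and positive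
over the whole line, without restrictions on the parameter. -/
theorem one_add_sin_mul_cos_pos (t x : ℝ) : 0 < 1 + Real.sin t / 2 * Real.cos x := by
  have h : |Real.sin t / 2 * Real.cos x| ≤ 1 / 2 := by
    rw [abs_mul, abs_div, abs_two]
    have h1 := Real.abs_sin_le_one t
    have h2 := Real.abs_cos_le_one x
    have := abs_nonneg (Real.sin t)
    have := abs_nonneg (Real.cos x)
    nlinarith
  linarith [(abs_le.1 h).1]

theorem contDiff_inv_one_add_cos (N : ℕ) : ContDiff ℝ ∞
    (Function.uncurry fun t θ : ℝ => (1 + Real.sin t / 2 * Real.cos (N * θ))⁻¹) := by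
  refine ContDiff.inv ?_ fun p => (one_add_sin_mul_cos_pos p.1 _).ne'
  exact contDiff_const.add (((Real.contDiff_sin.comp contDiff_fst).div_const 2).mul
    (Real.contDiff_cos.comp (contDiff_const.mul contDiff_snd)))

theorem contDiff_inv_one_add_cos_right (N : ℕ) (t : ℝ) :
    ContDiff ℝ ∞ fun θ : ℝ => (1 + Real.sin t / 2 * Real.cos (N * θ))⁻¹ := by
  refine ContDiff.inv ?_ fun θ => (one_add_sin_mul_cos_pos t _).ne'
  exact contDiff_const.add (contDiff_const.mul
    (Real.contDiff_cos.comp (contDiff_const.mul contDiff_id)))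

theorem periodic_inv_one_add_cos (N : ℕ) (t : ℝ) :
    Function.Periodic (fun θ : ℝ => (1 + Real.sin t / 2 * Real.cos (N * θ))⁻¹) (2 * π) :=
  fun θ => by
    simp only [mul_add, Real.cos_add_nat_mul_two_pi]

/-- The function `1 / (1 + (sin t / 2) cos(Nθ))`. -/
def cosFamily (N : ℕ) (t : ℝ) : CInf ℝ :=
  CInf.ofPeriodic _ (periodic_inv_one_add_cos N t) (contDiff_inv_one_add_cos_right N t)

theorem cosFamily_apply (N : ℕ) (t θ : ℝ) : cosFamily N t (θ : AddCircle (2 * π)) =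
    (1 + Real.sin t / 2 * Real.cos (N * θ))⁻¹ := rfl

theorem continuous_cosFamily (N : ℕ) : Continuous (cosFamily N) :=
  continuous_family_CInf (contDiff_inv_one_add_cos N)

theorem cosFamily_zero (N : ℕ) : cosFamily N 0 = 1 := CInf.ext_real fun θ => by
  rw [cosFamily_apply, CInf.one_apply]
  simp

theorem isNormalized_cosFamily {N : ℕ} (hN : 0 < N) (t : ℝ) : IsNormalized (cosFamily N t) where
  pos θ := by
    induction θ using QuotientAddGroup.induction_on with
    | H θ => exact inv_pos.2 (one_add_sin_mul_cos_pos t _)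
  integral_eq := by
    have hs : Real.sin (N * (2 * π)) = 0 := by simpa using Real.sin_add_nat_mul_two_pi 0 N
    rw [integral_inv_eq hN (η := Real.sin t / 2) fun θ => by rw [cosFamily_apply, inv_inv], hs]
    have := Real.pi_ne_zero
    field_simp
    ring

end Steklov

end

theorem corollary1 (U : Set (Steklov.CInf ℝ)) (hU : IsOpen U) (h1 : (1 : Steklov.CInf ℝ) ∈ U)
    (m : ℕ) (hm : 0 < m) :
    ∃ (a : Steklov.CInf ℝ) (ha : Steklov.IsNormalized a), a ∈ U ∧
      Steklov.PowersWellDefined (Steklov.Λa ha + Steklov.P₀ ha) ∧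
      ∃ m' : ℕ, 0 < m' ∧ ∃ sm ∈ Set.Ioo (0 : ℝ) 1, ∀ s ∈ Set.Ioo (0 : ℝ) sm,
        (Steklov.powerForm ha s m).re < (m : ℝ) ^ s ∧
        (Steklov.powerForm ha (-s) m').re < (m' : ℝ) ^ (-s) := by
  have hV := hU.preimage (Steklov.continuous_cosFamily (2 * m + 1))
  obtain ⟨δ, hδ, hball⟩ := Metric.isOpen_iff.1 hV 0 (by
    rw [Set.mem_preimage, Steklov.cosFamily_zero]
    exact h1)
  have hc : (24 : ℝ) ≤ 24 * ((m : ℝ) + 1) ^ 3 := by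
    have : (1 : ℝ) ≤ ((m : ℝ) + 1) ^ 3 := one_le_pow₀ (by linarith [Nat.cast_nonneg (α := ℝ) m])
    linarith
  have hc0 : (0 : ℝ) < 24 * ((m : ℝ) + 1) ^ 3 := by linarith
  -- t < δ keeps the function in `U`; t < 1/(24(m+1)³) and sin t < t give the smallness of η = (sin
  -- t)/2.
  obtain ⟨t, ht0, ht⟩ := exists_between (lt_min hδ (inv_pos.2 hc0))
  have htδ := ht.trans_le (min_le_left _ _)
  have htc := ht.trans_le (min_le_right _ _)
  have ht1 : t < 1 := htc.trans_le (inv_le_one_of_one_le₀ (by linarith))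
  have hη : 0 < Real.sin t / 2 :=
    half_pos (Real.sin_pos_of_pos_of_lt_pi ht0 (by linarith [Real.pi_gt_three]))
  have hη' : Real.sin t / 2 * (24 * ((m : ℝ) + 1) ^ 3) < 1 := by
    have h2 : Real.sin t / 2 < (24 * ((m : ℝ) + 1) ^ 3)⁻¹ := by linarith [Real.sin_lt ht0]
    rwa [lt_inv_comm₀ hη hc0, ← one_div, lt_div_iff₀ hη, mul_comm] at h2
  have ha := Steklov.isNormalized_cosFamily (N := 2 * m + 1) (by lia) t
  have haη : ∀ θ : ℝ, (Steklov.cosFamily (2 * m + 1) t (θ : AddCircle (2 * π)))⁻¹ =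
      1 + Real.sin t / 2 * Real.cos ((2 * m + 1 : ℕ) * θ) := fun θ => by
    rw [Steklov.cosFamily_apply, inv_inv]
  obtain ⟨s₁, hs₁, h₁⟩ := Steklov.re_powerForm_lt_of_cos ha hm hη hη' haη
  obtain ⟨s₂, hs₂, h₂⟩ := Steklov.re_powerForm_neg_lt_of_cos ha hm hη hη' haη
  -- The second index is m + 1, whose reflection through N = 2m + 1 is -m. The bound 1/2 only places
  -- the threshold inside (0, 1).
  refine ⟨_, ha, hball ?_, Steklov.powersWellDefined_Λa_add_P₀ ha, m + 1, by lia,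
    min (1 / 2) (min s₁ s₂), ⟨lt_min (by norm_num) (lt_min hs₁ hs₂),
      (min_le_left _ _).trans_lt (by norm_num)⟩, fun s hs => ⟨h₁ s ⟨hs.1, ?_⟩, h₂ s ⟨hs.1, ?_⟩⟩⟩
  · rwa [Metric.mem_ball, Real.dist_eq, sub_zero, abs_of_pos ht0]
  · exact hs.2.trans_le ((min_le_right _ _).trans (min_le_left _ _))
  · exact hs.2.trans_le ((min_le_right _ _).trans (min_le_right _ _))
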